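/- Let $n\ge 0$, let $J_0(x,y)=(-y,x)$ on $\mathbb{R}^{2n}=\mathbb{C}^n$ (so $J_0$ is multiplication by $i$ on $x+iy$), and let $\omega_0=\sum_j dx_j\wedge dy_j$. For a path $\Phi:[0,1]\to \mathrm{Sp}(2n)$ with $\Phi(0)=\mathrm{Id}$, let $\operatorname{CZ}\Phi\in\frac12\mathbb{Z}$ be its (Robbin–Salamon) Conley–Zehnder index: the Maslov index, relative to the diagonal $\Delta$ of $(\mathbb{R}^{2n}\times\mathbb{R}^{2n},(-\omega_0)\oplus\omega_0)$, of the path of graphs of $\Phi(t)$. Here the Maslov index, relative to a Lagrangian $L_0$, of a path of Lagrangian subspaces is $$\tfrac12\operatorname{sign}Q_0+\sum_{0<t<1}\operatorname{sign}Q_t+\tfrac12\operatorname{sign}Q_1 ,$$ computed for any $C^1$ path of Lagrangians $\alpha$ that is homotopic to the given path with fixed endpoints and has only regular crossings, where $Q_t(v)=\omega(v,\tilde\alpha'(t)\tilde\alpha(t)^{-1}v)$ on $\alpha(t)\cap L_0$ for a $C^1$ Lagrangian frame $\tilde\alpha$ of $\alpha$, and a crossing $t$ (that is, $\alpha(t)\cap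 L_0\ne 0$) is regular if $Q_t$ is nondegenerate. Put $$\max\operatorname{CZ}\Phi=\operatorname{CZ}\Phi+\tfrac12\dim\operatorname{Ker}(\Phi(1)-\mathrm{Id}).$$ For real $x$ let $[x]^<$ be the largest integer less than $x$. Let $S^0,S^1:[0,1]\to\mathfrak{gl}(2n;\mathbb{R})$ be continuous paths of symmetric matrices and let $\Phi^0,\Phi^1:[0,1]\to \mathrm{Sp}(2n)$ be the fundamental solutions of $\dot x=J_0S^0(t)x$ and $\dot x=J_0S^1(t)x$, that is, $\partial_t\Phi^k(t)=J_0S^k(t)\Phi^k(t)$ and $\Phi^k(0)=\mathrm{Id}$. If $S^0(t)\le S^1(t)$ (as quadratic forms) for all $t\in[0,1]$, then $\operatorname{CZ}\Phi^0\le\operatorname{CZ}\Phi^1$. Moreover, let $S$ be a continuous path of symmetric $2n\times 2n$ matrices on $[0,1]$ with fundamental solution $\Phi$, and let $C\in\mathbb{R}$. (i) If $S(t)\le -C$ for all $t\in[0,1]$, then $\max\operatorname{CZ}\Phi\le -n-2n\left[\frac{C}{2\pi}\right]^<$. (ii) If $\varepsilon>0$, $V\subset\mathbb{R}^{2n}=\mathbb{C}^n$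 is a complex subspace with orthogonal complement $V^\perp$, and $S(t)\le -C|_{V\times V}\oplus-\varepsilon|_{V^\perp\times V^\perp}$ for all $t\in[0,1]$, then $\max\operatorname{CZ}\Phi\le -n-2\dim_{\mathbb{C}}V\left[\frac{C}{2\pi}\right]^<$. -/

import Mathlib

open Set

noncomputable section

/-! ### Paths of Lagrangian subspaces and their Maslov index -/

section Maslov

variable {V : Type*} [NormedAddCommGroup V] [NormedSpace ℝ V]
variable {E : Type*} [NormedAddCommGroup E] [NormedSpace ℝ E]

/-- `L` is a Lagrangian subspace of `(V, ω)`: it equals its own `ω`-orthogonal complement. -/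
def IsLagrangian (ω : LinearMap.BilinForm ℝ V) (L : Submodule ℝ V) : Prop :=
  ∀ v, v ∈ L ↔ ∀ w ∈ L, ω v w = 0

/-- A Lagrangian frame: an injective linear map from a model space `E` (playing the role of
`ℝ ^ (dim V / 2)`) whose image is a Lagrangian subspace. -/
def IsLagrangianFrame (ω : LinearMap.BilinForm ℝ V) (A : E →L[ℝ] V) : Prop :=
  Function.Injective A ∧ IsLagrangian ω A.range

/-- The crossing space of a Lagrangian `A(E)` with `L₀`, transported to the model space `E`:
the frame `A` maps it isomorphically onto `A(E) ∩ L₀`. -/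
def crossingSpace (L₀ : Submodule ℝ V) (A : E →L[ℝ] V) : Submodule ℝ E :=
  L₀.comap (A : E →ₗ[ℝ] V)

/-- The crossing form at time `t ∈ [0,1]` of the path of Lagrangian subspaces `t ↦ A(t)(E)`.
On `A(t)(E) ∩ L₀` it is `(v, w) ↦ ω(v, A'(t) A(t)⁻¹ w)`; here it is pulled back by the frame
`A(t)` to the crossing space in `E`, that is, `(x, y) ↦ ω(A(t) x, A'(t) y)`. -/
def crossingForm (ω : LinearMap.BilinForm ℝ V) (L₀ : Submodule ℝ V) (A : ℝ → (E →L[ℝ] V))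
    (t : ℝ) : LinearMap.BilinForm ℝ (crossingSpace L₀ (A t)) :=
  ω.compl₁₂ ((A t).toLinearMap ∘ₗ (crossingSpace L₀ (A t)).subtype)
    ((derivWithin A (Icc 0 1) t : E →L[ℝ] V).toLinearMap ∘ₗ (crossingSpace L₀ (A t)).subtype)

/-- The signature of the crossing form at time `t`: the number of positive minus the number of
negative squares. -/
def crossingSign (ω : LinearMap.BilinForm ℝ V) (L₀ : Submodule ℝ V) (A : ℝ → (E →L[ℝ] V))
    (t : ℝ) : ℤ :=
  (sigPos (crossingForm ω L₀ A t).toQuadraticMap : ℤ)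
    - (sigNeg (crossingForm ω L₀ A t).toQuadraticMap : ℤ)

/-- A continuously differentiable path of Lagrangian frames over `[0,1]` all of whose crossings
with `L₀` are regular, that is, have a nondegenerate crossing form. -/
structure IsRegularFramePath (ω : LinearMap.BilinForm ℝ V) (L₀ : Submodule ℝ V)
    (A : ℝ → (E →L[ℝ] V)) : Prop where
  contDiffOn : ContDiffOn ℝ 1 A (Icc 0 1)
  frame : ∀ t ∈ Icc (0 : ℝ) 1, IsLagrangianFrame ω (A t)
  regular : ∀ t ∈ Icc (0 : ℝ) 1, (crossingForm ω L₀ A t).Nondegenerate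

/-- The sum over all crossings in `[0,1]` of the signatures of the crossing forms, the crossings
at the endpoints being counted with weight `1 / 2`.  (For a path with regular crossings the
crossings are isolated, so that the sum is finite; the signature is `0` where there is no
crossing.) -/
def crossingSum (ω : LinearMap.BilinForm ℝ V) (L₀ : Submodule ℝ V) (A : ℝ → (E →L[ℝ] V)) : ℝ :=
  (1 / 2) * (crossingSign ω L₀ A 0 : ℝ) + ∑ᶠ t ∈ Ioo (0 : ℝ) 1, (crossingSign ω L₀ A t : ℝ)
    + (1 / 2) * (crossingSign ω L₀ A 1 : ℝ)

variable (E) in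
/-- `α` and `β` are homotopic with fixed endpoints, as paths `[0,1] → {Lagrangian subspaces}`.
A continuous map from the square to the Lagrangian Grassmannian is given by a continuous family
of Lagrangian frames. -/
def LagrangianHomotopic (ω : LinearMap.BilinForm ℝ V) (α β : ℝ → Submodule ℝ V) : Prop :=
  ∃ F : ℝ × ℝ → (E →L[ℝ] V),
    ContinuousOn F (Icc 0 1 ×ˢ Icc 0 1) ∧
    (∀ s ∈ Icc (0 : ℝ) 1, ∀ t ∈ Icc (0 : ℝ) 1, IsLagrangianFrame ω (F (s, t))) ∧
    (∀ t ∈ Icc (0 : ℝ) 1, (F (0, t)).range = α t) ∧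
    (∀ t ∈ Icc (0 : ℝ) 1, (F (1, t)).range = β t) ∧
    (∀ s ∈ Icc (0 : ℝ) 1, (F (s, 0)).range = α 0) ∧
    (∀ s ∈ Icc (0 : ℝ) 1, (F (s, 1)).range = α 1)

variable (E) in
/-- `μ` is obtained by deforming the path `α`, with fixed endpoints, to a path with regular
crossings only, and summing the signatures of the crossing forms. -/
def IsMaslovIndex (ω : LinearMap.BilinForm ℝ V) (L₀ : Submodule ℝ V) (α : ℝ → Submodule ℝ V)
    (μ : ℝ) : Prop :=
  ∃ A : ℝ → (E →L[ℝ] V), IsRegularFramePath ω L₀ A ∧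
    LagrangianHomotopic E ω α (fun t => (A t).range) ∧ μ = crossingSum ω L₀ A

open scoped Classical in
variable (E) in
/-- The Maslov index of a path `α` of Lagrangian subspaces of `(V, ω)` relative to `L₀`. -/
def maslovIndex (ω : LinearMap.BilinForm ℝ V) (L₀ : Submodule ℝ V) (α : ℝ → Submodule ℝ V) : ℝ :=
  if h : ∃ μ, IsMaslovIndex E ω L₀ α μ then h.choose else 0

end Maslov

/-! ### The Conley–Zehnder index -/

/-- `ℝ ^ (2n)` with coordinates `(x, y) = (v ∘ inl, v ∘ inr)`. -/
abbrev R2 (n : ℕ) : Type := Fin n ⊕ Fin n → ℝ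

/-- Real `2n × 2n` matrices. -/
abbrev Mat2 (n : ℕ) : Type := Matrix (Fin n ⊕ Fin n) (Fin n ⊕ Fin n) ℝ

/-- The standard complex structure `J₀ (x, y) = (-y, x)`. -/
abbrev J0 (n : ℕ) : Mat2 n := Matrix.J (Fin n) ℝ

/-- The standard symplectic form `ω₀ = ∑ dxⱼ ∧ dyⱼ`. -/
def omega0 (n : ℕ) : LinearMap.BilinForm ℝ (R2 n) :=
  LinearMap.mk₂ ℝ
    (fun v w => ∑ j, (v (Sum.inl j) * w (Sum.inr j) - v (Sum.inr j) * w (Sum.inl j)))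
    (fun v v' w => by
      rw [← Finset.sum_add_distrib]; refine Finset.sum_congr rfl fun j _ => ?_
      simp only [Pi.add_apply]; ring)
    (fun c v w => by
      rw [smul_eq_mul, Finset.mul_sum]; refine Finset.sum_congr rfl fun j _ => ?_
      simp only [Pi.smul_apply, smul_eq_mul]; ring)
    (fun v w w' => by
      rw [← Finset.sum_add_distrib]; refine Finset.sum_congr rfl fun j _ => ?_
      simp only [Pi.add_apply]; ring)
    (fun c v w => by
      rw [smul_eq_mul, Finset.mul_sum]; refine Finset.sum_congr rfl fun j _ => ?_
      simp only [Pi.smul_apply, smul_eq_mul]; ring)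

/-- The sign conventions fit together: `ω₀(v, J₀ w) = ⟨v, w⟩`. -/
theorem omega0_J0 (n : ℕ) (v w : R2 n) : omega0 n v ((J0 n).mulVec w) = v ⬝ᵥ w := by
  simp [omega0, Matrix.J, Matrix.mulVec, dotProduct, Matrix.fromBlocks, Fintype.sum_sum_type,
    Matrix.one_apply]

/-- The symplectic form `(-ω₀) ⊕ ω₀` on `ℝ ^ (2n) × ℝ ^ (2n)`. -/
def omegaGraph (n : ℕ) : LinearMap.BilinForm ℝ (R2 n × R2 n) :=
  (omega0 n).compl₁₂ (LinearMap.snd ℝ _ _) (LinearMap.snd ℝ _ _)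
    - (omega0 n).compl₁₂ (LinearMap.fst ℝ _ _) (LinearMap.fst ℝ _ _)

/-- The graph `(1 × Φ)Δ = {(v, Φ v)}` of a matrix. -/
def matGraph {n : ℕ} (Φ : Mat2 n) : Submodule ℝ (R2 n × R2 n) :=
  (Matrix.mulVecLin Φ).graph

/-- The Conley–Zehnder index of a path `Φ : [0,1] → Sp(2n)` with `Φ(0) = 1`: the Maslov index of
the path of graphs of `Φ(t)` relative to the diagonal `Δ`. -/
def czIndex {n : ℕ} (Φ : ℝ → Mat2 n) : ℝ :=
  maslovIndex (R2 n) (omegaGraph n) (matGraph 1) (fun t => matGraph (Φ t))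

/-- `max CZ-ind Φ = CZ-ind Φ + (1/2) dim Ker(Φ(1) - 1)`. -/
def maxCZIndex {n : ℕ} (Φ : ℝ → Mat2 n) : ℝ :=
  czIndex Φ
    + (1 / 2) * (Module.finrank ℝ (LinearMap.ker (Matrix.mulVecLin (Φ 1 - 1))) : ℝ)

/-- A continuous path `[0,1] → {symmetric matrices}`. -/
def IsSymmetricPath {n : ℕ} (S : ℝ → Mat2 n) : Prop :=
  ContinuousOn S (Icc 0 1) ∧ ∀ t ∈ Icc (0 : ℝ) 1, (S t).IsSymm

/-- `Φ` is the fundamental solution of `ẋ = J₀ S(t) x` on `[0,1]`: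
`Φ' = J₀ S Φ` and `Φ(0) = 1`. -/
def IsFundamentalSolution {n : ℕ} (S Φ : ℝ → Mat2 n) : Prop :=
  Φ 0 = 1 ∧ ∀ t ∈ Icc (0 : ℝ) 1, ∀ i j,
    HasDerivWithinAt (fun τ => Φ τ i j) ((J0 n * S t * Φ t) i j) (Icc 0 1) t

/-! ### Further notation -/

/-- `[x]^<`: the largest integer less than `x`. -/
def intBelow (x : ℝ) : ℤ := ⌈x⌉ - 1

theorem intBelow_isGreatest (x : ℝ) : IsGreatest {m : ℤ | (m : ℝ) < x} (intBelow x) := by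
  refine ⟨?_, fun m hm => ?_⟩
  · have := Int.ceil_lt_add_one x
    change ((⌈x⌉ - 1 : ℤ) : ℝ) < x
    push_cast
    linarith
  · have h : m < ⌈x⌉ := Int.lt_ceil.2 hm
    change m ≤ ⌈x⌉ - 1
    omega

/-- The identification `ℝ ^ (2n) = ℂ ^ n`, `(x, y) ↦ x + i y`. -/
def toComplex {n : ℕ} (v : R2 n) : Fin n → ℂ :=
  fun j => (v (Sum.inl j) : ℂ) + (v (Sum.inr j) : ℂ) * Complex.I

/-- Under this identification `J₀` is multiplication by `i`. -/
theorem toComplex_J0 {n : ℕ} (v : R2 n) :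
    toComplex ((J0 n).mulVec v) = Complex.I • toComplex v := by
  funext j
  simp only [toComplex, Matrix.J, Matrix.mulVec, dotProduct, Matrix.fromBlocks,
    Fintype.sum_sum_type, Pi.smul_apply, smul_eq_mul]
  simp [Matrix.one_apply]
  linear_combination (-(v (Sum.inr j) : ℂ)) * Complex.I_mul_I

/-- The quadratic form inequality `S ≤ -C|_{V × V} ⊕ -ε|_{V^⊥ × V^⊥}` for a complex subspace
`V ⊆ ℂ ^ n = ℝ ^ (2n)` and its orthogonal complement in `ℝ ^ (2n)`. -/
def BoundedOnSplitting {n : ℕ} (S : Mat2 n) (V : Submodule ℂ (Fin n → ℂ)) (C ε : ℝ) : Prop :=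
  ∀ v w : R2 n, toComplex v ∈ V → (∀ u : R2 n, toComplex u ∈ V → u ⬝ᵥ w = 0) →
    (v + w) ⬝ᵥ (S.mulVec (v + w)) ≤ -C * (v ⬝ᵥ v) - ε * (w ⬝ᵥ w)

end

/-! The Conley–Zehnder index is expressed through a continuous phase and an eigenvalue correction,
after which monotonicity becomes a positivity statement.

On `ℝ^(2n) × ℝ^(2n)` use coordinates `X = a + b`, `Y = J₀ (a - b)`, in which the diagonal is `{Y =
0}`. A Lagrangian frame `(X, Y)` gives the unitary matrix `W = (X + iY)(X - iY)⁻¹` (`souriau`). It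
depends only on the subspace, and its eigenvalue `1` records the intersection with the diagonal.
Along a path let `φ` be a continuous argument of `det W`, and let `spectralPhase W` be the sum of
the eigenvalue arguments, normalized to jump only at the eigenvalue `1`, where the mean value is
taken. Then `φ - spectralPhase W` is locally constant off the crossings, and on either side of a
regular crossing it jumps by `π` times the signature of the crossing form
(`eventually_phase_sub_spectralPhase`). Summing the jumps shows that `2π` times the crossing sum is
the total increment of `φ - spectralPhase W`. This is invariant under homotopy with fixed endpoints,
so the index is computed from any phase (`IsHamiltonianPath.two_pi_mul_czIndex`).

For monotonicity consider the square `(t, s) ↦ Φ₀(t) Φ₀(s)⁻¹ Φ₁(s)`. Its edge `s = 0` is `Φ₀`, its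
diagonal is `Φ₁`, and its edge `t = 1` is a Hamiltonian path generated by a conjugate of `S₁ - S₀ ≥
0`. Rotating that edge to `exp(κJ₀) M exp(κJ₀)` with `κ' > 0` makes every crossing form positive
definite, so the crossing sum is nonnegative. Keeping `κ` positive, respectively negative, at both
ends changes the corrected phase there by `±π dim Ker(M - 1)`. Hence both `CZ + ½ dim Ker(Φ(1) - 1)`
and `CZ - ½ dim Ker(Φ(1) - 1)` are monotone, and so is their average `CZ` (`czIndex_add_le`).

For the bounds, compare with the flow rotating `V` at speed `-c` and its complement at speed `-e`,
where `0 < e < 2π` and `c` lies strictly between consecutive multiples of `2π`. There `W` and its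
eigenvalues are explicit, and the index is computed directly (`maxCZIndex_splitFlow`). -/

noncomputable section

open Filter Topology
open scoped Matrix

/-! ### First order perturbation of signatures -/

section Signature


variable {ι : Type*} [Fintype ι] [DecidableEq ι]

/-- The quadratic form `v ↦ ⟨v, B v⟩` of a matrix. -/
def diagForm (B : Matrix ι ι ℝ) : QuadraticForm ℝ (ι → ℝ) :=
  LinearMap.BilinMap.toQuadraticMap (Matrix.toLinearMap₂' ℝ B)

@[simp]
theorem diagForm_apply (B : Matrix ι ι ℝ) (v : ι → ℝ) : diagForm B v = v ⬝ᵥ B *ᵥ v := by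
  simp [diagForm, Matrix.toLinearMap₂'_apply']

theorem diagForm_neg (B : Matrix ι ι ℝ) : diagForm (-B) = -diagForm B := by
  ext v; simp [Matrix.neg_mulVec]

omit [DecidableEq ι] in
/-- The sum of the absolute values of the entries bounds the bilinear form of a matrix. -/
theorem abs_dotProduct_mulVec_le (D : Matrix ι ι ℝ) (u w : ι → ℝ) :
    |u ⬝ᵥ D *ᵥ w| ≤ (∑ i, ∑ j, |D i j|) * ‖u‖ * ‖w‖ := by
  simp only [dotProduct, Matrix.mulVec, Finset.mul_sum, Finset.sum_mul]
  refine (Finset.abs_sum_le_sum_abs _ _).trans (Finset.sum_le_sum fun i _ => ?_)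
  refine (Finset.abs_sum_le_sum_abs _ _).trans (Finset.sum_le_sum fun j _ => ?_)
  have h1 : |u i| ≤ ‖u‖ := norm_le_pi_norm u i
  have h2 : |w j| ≤ ‖w‖ := norm_le_pi_norm w j
  rw [abs_mul, abs_mul]
  calc |u i| * (|D i j| * |w j|) = |D i j| * |u i| * |w j| := by ring
    _ ≤ _ := by gcongr

/-- A form which is positive definite on a subspace is coercive there. -/
theorem exists_coercive_of_posDef (B : Matrix ι ι ℝ)
    {V : Submodule ℝ (ι → ℝ)} (hV : ((diagForm B).restrict V).PosDef) :
    ∃ c > 0, ∀ v ∈ V, c * ‖v‖ ^ 2 ≤ v ⬝ᵥ B *ᵥ v := by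
  have hpos : ∀ v ∈ V, v ≠ 0 → 0 < v ⬝ᵥ B *ᵥ v := fun v hv h0 => by
    have := hV ⟨v, hv⟩ (by simpa [Subtype.ext_iff] using h0)
    rwa [QuadraticMap.restrict_apply, diagForm_apply] at this
  have hc : IsCompact (Metric.sphere (0 : ι → ℝ) 1 ∩ V) :=
    (isCompact_sphere 0 1).inter_right V.closed_of_finiteDimensional
  have hscale : ∀ v ∈ V, v ≠ 0 → ‖v‖⁻¹ • v ∈ Metric.sphere (0 : ι → ℝ) 1 ∩ (V : Set (ι → ℝ)) :=
    fun v hv h0 => ⟨by simp [norm_smul, h0], V.smul_mem _ hv⟩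
  rcases (Metric.sphere (0 : ι → ℝ) 1 ∩ (V : Set (ι → ℝ))).eq_empty_or_nonempty with he | hne
  · refine ⟨1, one_pos, fun v hv => ?_⟩
    by_cases h0 : v = 0
    · simp [h0]
    · have := hscale v hv h0
      simp [he] at this
  · obtain ⟨u, hu, hmin⟩ := hc.exists_isMinOn hne (f := fun v => v ⬝ᵥ B *ᵥ v) (by fun_prop)
    have hu0 : u ≠ 0 := by rintro rfl; simp at hu
    refine ⟨u ⬝ᵥ B *ᵥ u, hpos u hu.2 hu0, fun v hv => ?_⟩
    by_cases h0 : v = 0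
    · simp [h0]
    · have h2 : u ⬝ᵥ B *ᵥ u ≤ (‖v‖⁻¹ • v) ⬝ᵥ B *ᵥ (‖v‖⁻¹ • v) := hmin (hscale v hv h0)
      have h3 : 0 < ‖v‖ := norm_pos_iff.2 h0
      simp only [Matrix.mulVec_smul, smul_dotProduct, dotProduct_smul, smul_eq_mul] at h2
      have h4 : v ⬝ᵥ B *ᵥ v = ‖v‖ ^ 2 * (‖v‖⁻¹ * (‖v‖⁻¹ * (v ⬝ᵥ B *ᵥ v))) := by field_simp
      rw [h4, mul_comm]
      gcongr

/-- The mixed terms `2Mrs` are absorbed into `b r² / 4` at the cost of a multiple of `s²`, which the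
unperturbed form dominates once `h` is small. Here `s` and `r` are the norms of the components in
the positive subspace and in the radical. -/
theorem perturbation_estimate {a b M h s r x₁ x₂ x₃ x₄ y : ℝ} (hb : 0 < b) (h0 : 0 < h)
    (hax : h * (M + 4 * M ^ 2 / b) < a) (e1 : -(M * s * s) ≤ x₁) (e2 : -(M * s * r) ≤ x₂)
    (e3 : -(M * r * s) ≤ x₃) (e4 : b / 2 * r ^ 2 ≤ x₄) (e5 : a * s ^ 2 ≤ y)
    (hsr : s ≠ 0 ∨ r ≠ 0) : 0 < y + h * (x₁ + x₂ + x₃ + x₄) := by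
  have key : b / 4 * r ^ 2 - (M + 4 * M ^ 2 / b) * s ^ 2 ≤ x₁ + x₂ + x₃ + x₄ := by
    have h1 : -(M * s * s) - M * s * r - M * r * s + b / 2 * r ^ 2
      - (b / 4 * r ^ 2 - (M + 4 * M ^ 2 / b) * s ^ 2) = (b * r - 4 * M * s) ^ 2 / (4 * b) := by
      field_simp
      ring
    have h2 : 0 ≤ (b * r - 4 * M * s) ^ 2 / (4 * b) := by positivity
    linarith
  have h3 := mul_le_mul_of_nonneg_left key h0.le
  have h4 : (a - h * (M + 4 * M ^ 2 / b)) * s ^ 2 + h * (b / 4) * r ^ 2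
      ≤ y + h * (x₁ + x₂ + x₃ + x₄) := by linarith
  refine lt_of_lt_of_le ?_ h4
  have h5 : 0 < a - h * (M + 4 * M ^ 2 / b) := by linarith
  rcases hsr with hs | hr
  · have : 0 < s ^ 2 := by positivity
    have : 0 ≤ h * (b / 4) * r ^ 2 := by positivity
    nlinarith
  · have : 0 < h * (b / 4) * r ^ 2 := by positivity
    nlinarith [sq_nonneg s]

/-- A positive definite subspace of `B` and a subspace of the radical of `B` on which `D₀` is
positive definite add up to a positive definite subspace of `B + h D` for small `h > 0` and `D`
close to `D₀`. -/
theorem eventually_posDef_sup {X : Type*} {l : Filter X}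
    {h : X → ℝ} {B D₀ : Matrix ι ι ℝ} {D : X → Matrix ι ι ℝ}
    (hh : Tendsto h l (𝓝 0)) (hpos : ∀ᶠ x in l, 0 < h x) (hD : Tendsto D l (𝓝 D₀))
    (hsymm : B.IsSymm) {P N : Submodule ℝ (ι → ℝ)} (hK : ∀ v ∈ N, B *ᵥ v = 0)
    (hP : ((diagForm B).restrict P).PosDef) (hN : ((diagForm D₀).restrict N).PosDef) :
    ∀ᶠ x in l, ((diagForm (B + h x • D x)).restrict (P ⊔ N)).PosDef := by
  obtain ⟨a, ha, haP⟩ := exists_coercive_of_posDef B hP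
  obtain ⟨b, hb, hbN⟩ := exists_coercive_of_posDef D₀ hN
  have hcont : Continuous fun D : Matrix ι ι ℝ => ∑ i, ∑ j, |D i j| := by fun_prop
  have h1 : ∀ᶠ x in l, ∑ i, ∑ j, |(D x - D₀) i j| < b / 2 := by
    refine Tendsto.eventually_lt_const (u := b / 2) (v := 0) (by positivity) ?_
    have := (hcont.tendsto 0).comp (by simpa using hD.sub_const D₀ : Tendsto (fun x => D x - D₀) l (𝓝 0))
    simpa [Function.comp_def] using this
  have h1' : ∀ᶠ x in l, ∑ i, ∑ j, |D x i j| < (∑ i, ∑ j, |D₀ i j|) + 1 :=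
    ((hcont.tendsto D₀).comp hD).eventually_lt_const (by simp)
  set M : ℝ := (∑ i, ∑ j, |D₀ i j|) + 1 with hM
  have h2 : ∀ᶠ x in l, h x * (M + 4 * M ^ 2 / b) < a := by
    have := hh.mul_const (M + 4 * M ^ 2 / b)
    rw [zero_mul] at this
    exact this.eventually_lt_const ha
  filter_upwards [hpos, h1, h1', h2] with x hx hDx hDn hax
  rintro ⟨v, hv⟩ h0
  obtain ⟨p, hp, k, hk, rfl⟩ := Submodule.mem_sup.1 hv
  have bnd : ∀ u w, |u ⬝ᵥ D x *ᵥ w| ≤ M * ‖u‖ * ‖w‖ := fun u w => by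
    refine (abs_dotProduct_mulVec_le _ u w).trans ?_
    gcongr
  have e5 : b / 2 * ‖k‖ ^ 2 ≤ k ⬝ᵥ D x *ᵥ k := by
    have h6 := abs_dotProduct_mulVec_le (D x - D₀) k k
    have h7 := (abs_le.1 h6).1
    rw [Matrix.sub_mulVec, dotProduct_sub] at h7
    have h8 := hbN k hk
    have h9 : (∑ i, ∑ j, |(D x - D₀) i j|) * ‖k‖ * ‖k‖ ≤ b / 2 * ‖k‖ * ‖k‖ := by gcongr
    nlinarith
  -- By symmetry a radical vector pairs to zero from the left as well, so `B` sees only `p`.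
  have e1 : k ⬝ᵥ B *ᵥ p = 0 := by
    rw [Matrix.dotProduct_mulVec, ← Matrix.mulVec_transpose, hsymm.eq, hK k hk, zero_dotProduct]
  have := perturbation_estimate hb hx hax (abs_le.1 (bnd p p)).1 (abs_le.1 (bnd p k)).1
    (abs_le.1 (bnd k p)).1 e5 (haP p hp) (by
      by_contra! h3
      apply h0
      simp only [norm_eq_zero] at h3
      simp [h3.1, h3.2])
  rw [QuadraticMap.restrict_apply, diagForm_apply]
  refine lt_of_lt_of_eq this ?_
  simp only [Matrix.add_mulVec, Matrix.smul_mulVec, Matrix.mulVec_add, dotProduct_add,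
    add_dotProduct, hK k hk, e1, dotProduct_zero, dotProduct_smul, smul_eq_mul]
  ring

/-- First order perturbation of the positive index of inertia. -/
theorem sigPos_add_le_of_perturbation {X : Type*} {l : Filter X}
    {h : X → ℝ} {B D₀ : Matrix ι ι ℝ} {D : X → Matrix ι ι ℝ}
    (hh : Tendsto h l (𝓝 0)) (hpos : ∀ᶠ x in l, 0 < h x) (hD : Tendsto D l (𝓝 D₀))
    (hsymm : B.IsSymm) {K : Submodule ℝ (ι → ℝ)} (hK : ∀ v ∈ K, B *ᵥ v = 0) :
    ∀ᶠ x in l, sigPos (diagForm B) + sigPos ((diagForm D₀).restrict K)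
      ≤ sigPos (diagForm (B + h x • D x)) := by
  obtain ⟨P, hPdim, hP⟩ := exists_finrank_eq_sigPos_and_posDef (diagForm B)
  obtain ⟨N', hNdim, hN'⟩ := exists_finrank_eq_sigPos_and_posDef ((diagForm D₀).restrict K)
  set N : Submodule ℝ (ι → ℝ) := N'.map K.subtype with hNdef
  have hNK : N ≤ K := Submodule.map_subtype_le _ _
  have hN : ((diagForm D₀).restrict N).PosDef := by
    rintro ⟨_, ⟨v, hv, rfl⟩⟩ h0
    have h2 := hN' ⟨v, hv⟩ (by
      intro h1
      apply h0
      have : v = 0 := by simpa using h1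
      simp [this])
    exact h2
  have hNdim' : Module.finrank ℝ N = sigPos ((diagForm D₀).restrict K) := by
    rw [← hNdim]
    exact (LinearEquiv.finrank_eq (Submodule.equivMapOfInjective _ K.subtype_injective N')).symm
  -- `B` is positive on nonzero vectors of `P` and vanishes on `N`.
  have hdisj : P ⊓ N = ⊥ := by
    rw [eq_bot_iff]
    rintro v ⟨hvP, hvN⟩
    by_contra h0
    have := hP ⟨v, hvP⟩ (by simpa [Subtype.ext_iff] using h0)
    rw [QuadraticMap.restrict_apply, diagForm_apply, hK v (hNK hvN)] at this
    simp at this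
  have hsum : Module.finrank ℝ ↥(P ⊔ N)
      = sigPos (diagForm B) + sigPos ((diagForm D₀).restrict K) := by
    have := Submodule.finrank_sup_add_finrank_inf_eq P N
    rw [hdisj, finrank_bot] at this
    omega
  filter_upwards [eventually_posDef_sup hh hpos hD hsymm (fun v hv => hK v (hNK hv)) hP hN] with x hx
  rw [← hsum]
  exact le_sigPos_of_posDef _ hx

/-- The signature of a quadratic form. -/
def signature {V : Type*} [AddCommGroup V] [Module ℝ V] (Q : QuadraticForm ℝ V) : ℤ :=
  (sigPos Q : ℤ) - (sigNeg Q : ℤ)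

theorem signature_neg {V : Type*} [AddCommGroup V] [Module ℝ V] (Q : QuadraticForm ℝ V) :
    signature (-Q) = -signature Q := by
  simp [signature]

theorem sigPos_add_sigNeg_le {V : Type*} [AddCommGroup V] [Module ℝ V] [FiniteDimensional ℝ V]
    (Q : QuadraticForm ℝ V) : sigPos Q + sigNeg Q ≤ Module.finrank ℝ V := by
  have := QuadraticForm.sigPos_add_sigNeg_add_radical (Q := Q)
  omega

/-- First order perturbation of the signature, when the perturbation is nondegenerate on the
radical. -/
theorem signature_of_perturbation {X : Type*} {l : Filter X}
    {h : X → ℝ} {B D₀ : Matrix ι ι ℝ} {D : X → Matrix ι ι ℝ}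
    (hh : Tendsto h l (𝓝 0)) (hpos : ∀ᶠ x in l, 0 < h x) (hD : Tendsto D l (𝓝 D₀))
    (hsymm : B.IsSymm) {K : Submodule ℝ (ι → ℝ)} (hK : ∀ v ∈ K, B *ᵥ v = 0)
    (hdim : sigPos (diagForm B) + sigNeg (diagForm B) + Module.finrank ℝ K = Module.finrank ℝ (ι → ℝ))
    (hreg : sigPos ((diagForm D₀).restrict K) + sigNeg ((diagForm D₀).restrict K)
      = Module.finrank ℝ K) :
    ∀ᶠ x in l, signature (diagForm (B + h x • D x))
        = signature (diagForm B) + signature ((diagForm D₀).restrict K) ∧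
      sigPos (diagForm (B + h x • D x)) + sigNeg (diagForm (B + h x • D x))
        = Module.finrank ℝ (ι → ℝ) := by
  have h1 := sigPos_add_le_of_perturbation hh hpos hD hsymm hK
  -- Semicontinuity for `-B` bounds the negative index from below. The two lower bounds already add
  -- up to the full dimension, so both are equalities.
  have h2 := sigPos_add_le_of_perturbation (B := -B) (K := K) hh hpos hD.neg
    hsymm.neg (fun v hv => by simp [Matrix.neg_mulVec, hK v hv])
  filter_upwards [h1, h2] with x hx1 hx2
  have e : -B + h x • -D x = -(B + h x • D x) := by rw [smul_neg, neg_add]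
  have e' : (diagForm (-D₀)).restrict K = -((diagForm D₀).restrict K) := by
    rw [diagForm_neg]; rfl
  rw [e, e', diagForm_neg, diagForm_neg, sigPos_neg, sigPos_neg, sigPos_neg] at hx2
  have h3 := sigPos_add_sigNeg_le (diagForm (B + h x • D x))
  simp only [signature]
  constructor <;> omega

end Signature

/-! ### Eigenvalue arguments and Möbius transforms of symmetric matrices -/

section SpectralPhase

variable {ι : Type*} [Fintype ι] [DecidableEq ι]

/-- The argument of `-w`, except that the value at `w = 1` is `0`. -/
def oppositeArg (w : ℂ) : ℝ := if w = 1 then 0 else Complex.arg (-w)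

/-- The sum of `oppositeArg` over the eigenvalues of `W`. -/
def spectralPhase (W : Matrix ι ι ℂ) : ℝ := (W.charpoly.roots.map oppositeArg).sum

/-- The characteristic polynomial of a product is invariant under cyclic permutation of the factors.
-/
theorem charpoly_roots_of_conj_diagonal {W V V' : Matrix ι ι ℂ} {d : ι → ℂ} (hV : V' * V = 1)
    (hW : W = V * Matrix.diagonal d * V') :
    W.charpoly.roots = Finset.univ.val.map d := by
  rw [hW, Matrix.charpoly_mul_comm, ← mul_assoc, hV, one_mul, Matrix.charpoly_diagonal,
    Polynomial.roots_prod]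
  · simp
  · simp [Finset.prod_ne_zero_iff, Polynomial.X_sub_C_ne_zero]

theorem det_of_conj_diagonal {W V V' : Matrix ι ι ℂ} {d : ι → ℂ} (hV : V' * V = 1)
    (hW : W = V * Matrix.diagonal d * V') : W.det = ∏ j, d j := by
  rw [hW, Matrix.det_mul_comm, ← mul_assoc, hV, one_mul, Matrix.det_diagonal]

theorem exists_orthogonal_diagonalization {C : Matrix ι ι ℝ} (hC : C.IsHermitian) :
    ∃ U : Matrix ι ι ℝ, star U * U = 1 ∧ U * star U = 1 ∧
      C = U * Matrix.diagonal hC.eigenvalues * star U := by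
  refine ⟨(hC.eigenvectorUnitary : Matrix.unitaryGroup ι ℝ),
    Unitary.coe_star_mul_self hC.eigenvectorUnitary,
    Unitary.coe_mul_star_self hC.eigenvectorUnitary, ?_⟩
  have := hC.spectral_theorem
  rw [Unitary.conjStarAlgAut_apply] at this
  simpa using! this

/-- A Möbius transform of a real symmetric matrix is diagonalized along with it. -/
theorem exists_conj_diagonal_of_moebius {C : Matrix ι ι ℝ} (hC : C.IsHermitian)
    {W : Matrix ι ι ℂ} {a b a' b' : ℂ} (hne : ∀ j, a' + b' * hC.eigenvalues j ≠ 0)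
    (hW : W * (a' • 1 + b' • C.map Complex.ofRealHom) = a • 1 + b • C.map Complex.ofRealHom) :
    ∃ V V' : Matrix ι ι ℂ, V' * V = 1 ∧ W = V * Matrix.diagonal
      (fun j => (a + b * hC.eigenvalues j) / (a' + b' * hC.eigenvalues j)) * V' := by
  obtain ⟨U, hUU, hUU', hspec⟩ := exists_orthogonal_diagonalization hC
  set V := U.map Complex.ofRealHom
  set V' := (star U).map Complex.ofRealHom
  have h1 : V' * V = 1 := by rw [← Matrix.map_mul, hUU]; simp
  have h2 : V * V' = 1 := by rw [← Matrix.map_mul, hUU']; simp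
  set Λ : Matrix ι ι ℂ := Matrix.diagonal (fun j => (hC.eigenvalues j : ℂ))
  have h3 : C.map Complex.ofRealHom = V * Λ * V' := by
    conv_lhs => rw [hspec]
    rw [Matrix.map_mul, Matrix.map_mul]
    congr 2
    simp [Λ, Matrix.diagonal_map]
  have h4 : ∀ x y : ℂ, x • (1 : Matrix ι ι ℂ) + y • C.map Complex.ofRealHom
      = V * Matrix.diagonal (fun j => x + y * hC.eigenvalues j) * V' := by
    intro x y
    have : Matrix.diagonal (fun j => x + y * hC.eigenvalues j) = x • (1 : Matrix ι ι ℂ) + y • Λ := by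
      ext i j
      by_cases hij : i = j
      · subst hij; simp [Λ]
      · simp [Λ, hij]
    rw [this, h3, mul_add, add_mul, mul_smul_comm, mul_one, smul_mul_assoc, h2, mul_smul_comm,
      smul_mul_assoc]
  refine ⟨V, V', h1, ?_⟩
  rw [h4, h4] at hW
  set p : ι → ℂ := fun j => a' + b' * hC.eigenvalues j with hp
  set q : ι → ℂ := fun j => a + b * hC.eigenvalues j with hq
  have h5 : Matrix.diagonal p * Matrix.diagonal (fun j => (p j)⁻¹) = (1 : Matrix ι ι ℂ) := by
    rw [Matrix.diagonal_mul_diagonal]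
    simp [hp, mul_inv_cancel₀ (hne _)]
  have h6 : Matrix.diagonal q * Matrix.diagonal (fun j => (p j)⁻¹)
      = Matrix.diagonal (fun j => q j / p j) := by
    rw [Matrix.diagonal_mul_diagonal]; rfl
  calc W = W * (V * (Matrix.diagonal p * Matrix.diagonal (fun j => (p j)⁻¹)) * V') := by
        rw [h5, mul_one, h2, mul_one]
    _ = W * (V * Matrix.diagonal p * V') * (V * Matrix.diagonal (fun j => (p j)⁻¹) * V') := by
        simp only [mul_assoc]
        rw [← mul_assoc V' V, h1, one_mul]
    _ = V * (Matrix.diagonal q * Matrix.diagonal (fun j => (p j)⁻¹)) * V' := by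
        rw [hW]
        simp only [mul_assoc]
        rw [← mul_assoc V' V, h1, one_mul]
    _ = _ := by rw [h6]

theorem spectralPhase_of_moebius {C : Matrix ι ι ℝ} (hC : C.IsHermitian)
    {W : Matrix ι ι ℂ} {a b a' b' : ℂ} (hne : ∀ j, a' + b' * hC.eigenvalues j ≠ 0)
    (hW : W * (a' • 1 + b' • C.map Complex.ofRealHom) = a • 1 + b • C.map Complex.ofRealHom) :
    spectralPhase W = ∑ j, oppositeArg
      ((a + b * hC.eigenvalues j) / (a' + b' * hC.eigenvalues j)) := by
  obtain ⟨V, V', h1, h2⟩ := exists_conj_diagonal_of_moebius hC hne hW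
  rw [spectralPhase, charpoly_roots_of_conj_diagonal h1 h2, Multiset.map_map]
  rfl

theorem det_of_moebius {C : Matrix ι ι ℝ} (hC : C.IsHermitian)
    {W : Matrix ι ι ℂ} {a b a' b' : ℂ} (hne : ∀ j, a' + b' * hC.eigenvalues j ≠ 0)
    (hW : W * (a' • 1 + b' • C.map Complex.ofRealHom) = a • 1 + b • C.map Complex.ofRealHom) :
    W.det = ∏ j, (a + b * hC.eigenvalues j) / (a' + b' * hC.eigenvalues j) := by
  obtain ⟨V, V', h1, h2⟩ := exists_conj_diagonal_of_moebius hC hne hW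
  exact det_of_conj_diagonal h1 h2

/-- The point `1 + (i - κ) c` of the plane. -/
def chartPoint (κ c : ℝ) : ℂ := 1 + (Complex.I - κ) * c

theorem chartPoint_re (κ c : ℝ) : (chartPoint κ c).re = 1 - κ * c := by simp [chartPoint]; ring

theorem chartPoint_im (κ c : ℝ) : (chartPoint κ c).im = c := by simp [chartPoint]

theorem chartPoint_mem_slitPlane (κ c : ℝ) : chartPoint κ c ∈ Complex.slitPlane := by
  rw [Complex.mem_slitPlane_iff, chartPoint_re, chartPoint_im]
  by_cases h : c = 0
  · left; simp [h]
  · right; exact h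

theorem conj_chartPoint (κ c : ℝ) :
    (starRingEnd ℂ) (chartPoint κ c) = 1 + (-Complex.I - κ) * c := by
  simp [chartPoint]

theorem continuous_arg_chartPoint (κ : ℝ) : Continuous fun c => (chartPoint κ c).arg := by
  rw [continuous_iff_continuousAt]
  intro c
  refine (Complex.continuousAt_arg (chartPoint_mem_slitPlane κ c)).comp ?_
  unfold chartPoint
  fun_prop

theorem div_conj_eq_exp {z : ℂ} (hz : z ≠ 0) :
    z / (starRingEnd ℂ) z = Complex.exp ((2 * z.arg : ℝ) * Complex.I) := by
  have h1 := Complex.norm_mul_exp_arg_mul_I z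
  have h2 : (starRingEnd ℂ) z = ‖z‖ * Complex.exp (-(z.arg * Complex.I)) := by
    conv_lhs => rw [← h1]
    rw [map_mul, Complex.conj_ofReal, ← Complex.exp_conj]
    simp
  have h3 : (‖z‖ : ℂ) ≠ 0 := by simpa using hz
  rw [h2]
  nth_rw 1 [← h1]
  rw [mul_div_mul_left _ _ h3, ← Complex.exp_sub]
  congr 1
  push_cast
  ring

theorem neg_exp_eq (θ : ℝ) : -Complex.exp (θ * Complex.I)
    = Complex.exp ((θ - Real.pi : ℝ) * Complex.I) := by
  push_cast
  rw [sub_mul, Complex.exp_sub_pi_mul_I]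

/-- On this interval `exp(iθ)` avoids `1` and `θ - π` lies in the principal branch. The limits at
the two ends are `-π` and `π`, whose mean is the value `0` assigned at `1`. -/
theorem oppositeArg_exp {θ : ℝ} (h0 : 0 < θ) (h1 : θ < 2 * Real.pi) :
    oppositeArg (Complex.exp (θ * Complex.I)) = θ - Real.pi := by
  have hne : Complex.exp (θ * Complex.I) ≠ 1 := by
    rw [Ne, Complex.exp_eq_one_iff]
    rintro ⟨k, hk⟩
    have h2 : θ = k * (2 * Real.pi) := by
      have := congrArg Complex.im hk
      simpa using this
    have hpi := Real.pi_pos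
    have h3 : (0 : ℝ) < k := by
      by_contra! h; nlinarith
    have h4 : (k : ℝ) < 1 := by
      by_contra! h; nlinarith
    norm_cast at h3 h4
    omega
  rw [oppositeArg, if_neg hne, neg_exp_eq, Complex.arg_exp_mul_I, toIocMod_eq_self]
  constructor <;> linarith

theorem oppositeArg_exp_add_int_mul_two_pi {θ : ℝ} (k : ℤ) :
    oppositeArg (Complex.exp ((θ + k * (2 * Real.pi) : ℝ) * Complex.I))
      = oppositeArg (Complex.exp (θ * Complex.I)) := by
  congr 1
  rw [Complex.exp_eq_exp_iff_exists_int]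
  exact ⟨k, by push_cast; ring⟩

/-- The quotient has argument `2 arg z`, and subtracting `π sign c` moves it into `(-π, π)`. As `z`
never meets the branch cut of `arg`, the whole discontinuity is carried by `sign c`. -/
theorem oppositeArg_chartPoint (κ c : ℝ) :
    oppositeArg (chartPoint κ c / (starRingEnd ℂ) (chartPoint κ c))
      = 2 * (chartPoint κ c).arg - Real.pi * (SignType.sign c : ℝ) := by
  have hz : chartPoint κ c ≠ 0 := Complex.slitPlane_ne_zero (chartPoint_mem_slitPlane κ c)
  rcases lt_trichotomy c 0 with hc | hc | hc
  · have h1 : (chartPoint κ c).arg < 0 := Complex.arg_neg_iff.2 (by rwa [chartPoint_im])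
    have h2 := Complex.neg_pi_lt_arg (chartPoint κ c)
    -- For `c < 0` the angle `2 arg z` lies in `(-2π, 0)`; one full turn brings it into `(0, 2π)`.
    rw [div_conj_eq_exp hz, ← oppositeArg_exp_add_int_mul_two_pi 1, oppositeArg_exp]
    · simp [hc]; ring
    · push_cast; linarith
    · push_cast; linarith
  · subst hc
    simp [chartPoint, oppositeArg]
  · have h1 : 0 < (chartPoint κ c).arg := by
      refine lt_of_le_of_ne (Complex.arg_nonneg_iff.2 (by rw [chartPoint_im]; exact hc.le)) ?_
      intro h
      have := (Complex.arg_eq_zero_iff.1 h.symm).2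
      rw [chartPoint_im] at this
      exact hc.ne' this
    have h2 : (chartPoint κ c).arg < Real.pi :=
      lt_of_le_of_ne (Complex.arg_le_pi _) (Complex.mem_slitPlane_iff_arg.1
        (chartPoint_mem_slitPlane κ c)).1
    rw [div_conj_eq_exp hz, oppositeArg_exp]
    · simp [hc]
    · linarith
    · linarith

end SpectralPhase

/-! ### Continuity of eigenvalue sums; signature as a sum of signs -/

section EigenvalueSums

variable {ι : Type*} [Fintype ι] [DecidableEq ι]

-- The spectra of all nearby matrices lie in one compact ball, where the functional calculus of a
-- continuous function depends continuously on the matrix.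
open scoped Matrix.Norms.L2Operator in
theorem tendsto_cfc_of_isHermitian {X : Type*} {l : Filter X} {C : X → Matrix ι ι ℂ} {C₀ : Matrix ι ι ℂ}
    (hC : ∀ᶠ x in l, (C x).IsHermitian) (hC₀ : C₀.IsHermitian) (h : Tendsto C l (𝓝 C₀))
    {f : ℝ → ℝ} (hf : Continuous f) :
    Tendsto (fun x => cfc f (C x)) l (𝓝 (cfc f C₀)) := by
  have h1 : ∀ᶠ x in l, ‖C x‖ ≤ ‖C₀‖ + 1 :=
    (h.norm.eventually_lt_const (lt_add_one _)).mono fun _ => le_of_lt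
  refine h.cfc (s := Metric.closedBall 0 ((‖C₀‖ + 1) * ‖(1 : Matrix ι ι ℂ)‖)) (isCompact_closedBall _ _) f ?_ ?_ ?_ ?_
    hf.continuousOn
  · filter_upwards [h1] with x hx
    refine (spectrum.subset_closedBall_norm_mul _).trans (Metric.closedBall_subset_closedBall ?_)
    gcongr
  · exact hC.mono fun x hx => hx
  · refine (spectrum.subset_closedBall_norm_mul _).trans (Metric.closedBall_subset_closedBall ?_)
    gcongr
    linarith
  · exact hC₀

theorem trace_cfc {C : Matrix ι ι ℂ} (hC : C.IsHermitian) (f : ℝ → ℝ) :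
    (cfc f C).trace = ∑ j, (f (hC.eigenvalues j) : ℂ) := by
  rw [hC.cfc_eq, Matrix.IsHermitian.cfc, Unitary.conjStarAlgAut_apply, Matrix.trace_mul_comm,
    ← mul_assoc, Unitary.coe_star_mul_self, one_mul, Matrix.trace_diagonal]
  rfl

omit [Fintype ι] [DecidableEq ι] in
theorem isHermitian_map_ofReal {C : Matrix ι ι ℝ} (hC : C.IsHermitian) :
    (C.map Complex.ofRealHom).IsHermitian := by
  ext i j
  simpa using congrFun (congrFun hC i) j

/-- A real matrix and its complexification have the same characteristic roots; this links the
functional calculus over `ℂ` to the real eigenvalues. -/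
theorem sum_eigenvalues_map_ofReal {C : Matrix ι ι ℝ} (hC : C.IsHermitian) (f : ℝ → ℝ) :
    ∑ j, f ((isHermitian_map_ofReal hC).eigenvalues j) = ∑ j, f (hC.eigenvalues j) := by
  have h1 := (isHermitian_map_ofReal hC).roots_charpoly_eq_eigenvalues
  have h2 : (C.map Complex.ofRealHom).charpoly.roots
      = Multiset.map (fun j => (hC.eigenvalues j : ℂ)) Finset.univ.val := by
    rw [Matrix.charpoly_map, hC.charpoly_eq, Polynomial.map_prod]
    simp only [Polynomial.map_sub, Polynomial.map_X, Polynomial.map_C]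
    rw [Polynomial.roots_prod]
    · simp
    · simp [Finset.prod_ne_zero_iff, Polynomial.X_sub_C_ne_zero]
  have h3 := congrArg (fun s => (s.map (fun z : ℂ => f z.re)).sum) (h1.symm.trans h2)
  simpa [Multiset.map_map, Function.comp_def] using h3

/-- The sum of a function over the eigenvalues of a real symmetric matrix. -/
def spectralSum (f : ℝ → ℝ) (C : Matrix ι ι ℝ) : ℝ := (cfc f (C.map Complex.ofRealHom)).trace.re

theorem spectralSum_eq {C : Matrix ι ι ℝ} (hC : C.IsHermitian) (f : ℝ → ℝ) :
    spectralSum f C = ∑ j, f (hC.eigenvalues j) := by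
  rw [spectralSum, trace_cfc (isHermitian_map_ofReal hC), ← sum_eigenvalues_map_ofReal hC]
  simp

/-- A symmetric function of the eigenvalues of a real symmetric matrix is continuous. -/
theorem tendsto_spectralSum {X : Type*} {l : Filter X} {C : X → Matrix ι ι ℝ}
    {C₀ : Matrix ι ι ℝ} (hC : ∀ᶠ x in l, (C x).IsHermitian) (hC₀ : C₀.IsHermitian)
    (h : Tendsto C l (𝓝 C₀)) {f : ℝ → ℝ} (hf : Continuous f) :
    Tendsto (fun x => spectralSum f (C x)) l (𝓝 (spectralSum f C₀)) := by
  have h1 : Tendsto (fun x => (C x).map Complex.ofRealHom) l (𝓝 (C₀.map Complex.ofRealHom)) := by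
    have : Continuous fun C : Matrix ι ι ℝ => C.map Complex.ofRealHom :=
      Continuous.matrix_map continuous_id Complex.continuous_ofReal
    exact (this.tendsto _).comp h
  have h2 := tendsto_cfc_of_isHermitian (hC.mono fun x => isHermitian_map_ofReal)
    (isHermitian_map_ofReal hC₀) h1 hf
  have h3 : Continuous fun A : Matrix ι ι ℂ => A.trace.re :=
    Complex.continuous_re.comp (Continuous.matrix_trace continuous_id)
  exact (h3.tendsto _).comp h2

/-- The signature is the sum of the signs of the eigenvalues. -/
theorem sum_sign_eigenvalues {C : Matrix ι ι ℝ} (hC : C.IsHermitian) :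
    ∑ j, (SignType.sign (hC.eigenvalues j) : ℝ) = (signature (diagForm C) : ℝ) := by
  obtain ⟨U, hUU, hUU', hspec⟩ := exists_orthogonal_diagonalization hC
  have heq : QuadraticMap.Equivalent (diagForm C)
      (QuadraticMap.weightedSumSquares ℝ hC.eigenvalues) := by
    refine ⟨⟨Matrix.toLin'OfInv (M := U) (M' := star U) hUU' hUU, fun v => ?_⟩⟩
    rw [diagForm_apply, QuadraticMap.weightedSumSquares_apply]
    conv_rhs => rw [hspec]
    have : v ⬝ᵥ (U * Matrix.diagonal hC.eigenvalues * star U) *ᵥ v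
        = (star U *ᵥ v) ⬝ᵥ Matrix.diagonal hC.eigenvalues *ᵥ (star U *ᵥ v) := by
      rw [← Matrix.mulVec_mulVec, ← Matrix.mulVec_mulVec, Matrix.dotProduct_mulVec,
        ← Matrix.mulVec_transpose]
      rfl
    rw [this]
    simp only [Matrix.mulVec_diagonal, dotProduct, smul_eq_mul]
    refine Finset.sum_congr rfl fun j _ => ?_
    simp [Matrix.toLin'OfInv]
    ring
  rw [signature, QuadraticForm.sigPos_of_equiv_weightedSumSquares heq,
    QuadraticForm.sigNeg_of_equiv_weightedSumSquares heq]
  have h1 : ∀ p : ι → Prop, ({i | p i}.ncard : ℝ) = ∑ j, (open scoped Classical in if p j then (1 : ℝ) else 0) := by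
    classical
    intro p
    rw [Set.ncard_eq_toFinset_card', Finset.sum_boole]
    simp
  push_cast
  rw [h1, h1, ← Finset.sum_sub_distrib]
  refine Finset.sum_congr rfl fun j _ => ?_
  rcases lt_trichotomy (hC.eigenvalues j) 0 with h | h | h
  · simp [h, h.not_gt]
  · simp [h]
  · simp [h, h.not_gt]

/-- The signature is invariant under congruence. -/
theorem signature_congruence {C N : Matrix ι ι ℝ} (hN : IsUnit N.det) :
    signature (diagForm (Nᵀ * C * N)) = signature (diagForm C) := by
  have heq : QuadraticMap.Equivalent (diagForm (Nᵀ * C * N)) (diagForm C) := by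
    refine ⟨⟨Matrix.toLin'OfInv (M := N⁻¹) (M' := N) (Matrix.nonsing_inv_mul _ hN)
      (Matrix.mul_nonsing_inv _ hN), fun v => ?_⟩⟩
    simp only [diagForm_apply]
    rw [← Matrix.mulVec_mulVec, ← Matrix.mulVec_mulVec, Matrix.dotProduct_mulVec v,
      Matrix.vecMul_transpose]
    simp [Matrix.toLin'OfInv]
  rw [signature, signature, heq.sigPos_eq, heq.sigNeg_eq]

end EigenvalueSums

/-! ### Entrywise calculus of matrix paths -/

section MatrixCalculus

variable {l m n : Type*}

/-- Entrywise differentiability of a path of matrices. -/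
def HasMatrixDerivWithinAt (M : ℝ → Matrix m n ℝ) (M' : Matrix m n ℝ) (s : Set ℝ) (t : ℝ) : Prop :=
  ∀ i j, HasDerivWithinAt (fun τ => M τ i j) (M' i j) s t

namespace HasMatrixDerivWithinAt

variable {M N : ℝ → Matrix m n ℝ} {M' N' : Matrix m n ℝ} {s : Set ℝ} {t : ℝ}

theorem continuousWithinAt (h : HasMatrixDerivWithinAt M M' s t) : ContinuousWithinAt M s t :=
  continuousWithinAt_pi.2 fun i => continuousWithinAt_pi.2 fun j => (h i j).continuousWithinAt

theorem const (A : Matrix m n ℝ) : HasMatrixDerivWithinAt (fun _ => A) 0 s t :=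
  fun i j => hasDerivWithinAt_const t s (A i j)

theorem add (h : HasMatrixDerivWithinAt M M' s t) (h' : HasMatrixDerivWithinAt N N' s t) :
    HasMatrixDerivWithinAt (fun τ => M τ + N τ) (M' + N') s t :=
  fun i j => (h i j).add (h' i j)

theorem sub (h : HasMatrixDerivWithinAt M M' s t) (h' : HasMatrixDerivWithinAt N N' s t) :
    HasMatrixDerivWithinAt (fun τ => M τ - N τ) (M' - N') s t :=
  fun i j => (h i j).sub (h' i j)

theorem smul {f : ℝ → ℝ} {f' : ℝ} (hf : HasDerivWithinAt f f' s t)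
    (h : HasMatrixDerivWithinAt M M' s t) :
    HasMatrixDerivWithinAt (fun τ => f τ • M τ) (f' • M t + f t • M') s t :=
  fun i j => by simpa using! hf.mul (h i j)

theorem const_smul (c : ℝ) (h : HasMatrixDerivWithinAt M M' s t) :
    HasMatrixDerivWithinAt (fun τ => c • M τ) (c • M') s t :=
  fun i j => (h i j).const_mul c

theorem transpose (h : HasMatrixDerivWithinAt M M' s t) :
    HasMatrixDerivWithinAt (fun τ => (M τ)ᵀ) M'ᵀ s t :=
  fun i j => h j i

theorem mul [Fintype m] {K : ℝ → Matrix l m ℝ} {K' : Matrix l m ℝ}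
    (hK : HasMatrixDerivWithinAt K K' s t) (h : HasMatrixDerivWithinAt M M' s t) :
    HasMatrixDerivWithinAt (fun τ => K τ * M τ) (K' * M t + K t * M') s t := by
  intro i j
  simp only [Matrix.mul_apply, Matrix.add_apply, ← Finset.sum_add_distrib]
  exact HasDerivWithinAt.fun_sum fun k _ => (hK i k).mul (h k j)

theorem const_mul [Fintype m] (K : Matrix l m ℝ) (h : HasMatrixDerivWithinAt M M' s t) :
    HasMatrixDerivWithinAt (fun τ => K * M τ) (K * M') s t := by
  simpa using (const K).mul h

theorem scomp {f : ℝ → ℝ} {f' : ℝ} {s' : Set ℝ} (h : HasMatrixDerivWithinAt M M' s (f t))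
    (hf : HasDerivWithinAt f f' s' t) (hs : MapsTo f s' s) :
    HasMatrixDerivWithinAt (fun τ => M (f τ)) (f' • M') s' t := by
  intro i j
  have := (h i j).comp t hf hs
  simpa [mul_comm, Function.comp_def] using this

theorem congr (h : HasMatrixDerivWithinAt M M' s t) (hs : ∀ τ ∈ s, N τ = M τ) (ht : N t = M t) :
    HasMatrixDerivWithinAt N M' s t := fun i j =>
  (h i j).congr (fun τ hτ => by rw [hs τ hτ]) (by rw [ht])

/-- The difference quotients converge. -/
theorem exists_tendsto (h : HasMatrixDerivWithinAt M M' s t) :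
    ∃ D : ℝ → Matrix m n ℝ, Tendsto D (𝓝[s \ {t}] t) (𝓝 M') ∧
      ∀ τ, M τ = M t + (τ - t) • D τ := by
  refine ⟨fun τ => Matrix.of fun i j => slope (fun τ => M τ i j) t τ, ?_, fun τ => ?_⟩
  · exact tendsto_pi_nhds.2 fun i => tendsto_pi_nhds.2 fun j =>
      hasDerivWithinAt_iff_tendsto_slope.1 (h i j)
  · ext i j
    have := sub_smul_slope (fun τ => M τ i j) t τ
    simp only [smul_eq_mul] at this
    simp only [Matrix.add_apply, Matrix.smul_apply, Matrix.of_apply, smul_eq_mul, this]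
    simp

theorem unique (h : HasMatrixDerivWithinAt M M' s t) (h' : HasMatrixDerivWithinAt M N' s t)
    (hs : UniqueDiffWithinAt ℝ s t) : M' = N' := by
  ext i j
  exact hs.eq_deriv _ (h i j) (h' i j)

end HasMatrixDerivWithinAt

end MatrixCalculus

/-! ### The Souriau matrix of a Lagrangian frame and its charts -/

section LagrangianPairs

variable {ι : Type*} [Fintype ι] [DecidableEq ι]

/-- `v ↦ (X v, Y v)` is a frame of a Lagrangian subspace of `ℝ ^ ι × ℝ ^ ι`. -/
structure IsLagrangianPair (X Y : Matrix ι ι ℝ) : Prop where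
  isotropic : Xᵀ * Y = Yᵀ * X
  injective : ∀ v, X *ᵥ v = 0 → Y *ᵥ v = 0 → v = 0

/-- The complex matrix `X + i Y`. -/
def complexFrame (X Y : Matrix ι ι ℝ) : Matrix ι ι ℂ :=
  X.map Complex.ofRealHom + Complex.I • Y.map Complex.ofRealHom

/-- The unitary matrix `(X + i Y) (X - i Y)⁻¹` attached to a Lagrangian frame. -/
def souriau (X Y : Matrix ι ι ℝ) : Matrix ι ι ℂ :=
  complexFrame X Y * (complexFrame X (-Y))⁻¹

theorem det_complexFrame_neg (X Y : Matrix ι ι ℝ) :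
    (complexFrame X (-Y)).det = (starRingEnd ℂ) (complexFrame X Y).det := by
  rw [RingHom.map_det]
  congr 1
  ext i j
  simp [complexFrame]

theorem continuous_det_complexFrame :
    Continuous fun p : Matrix ι ι ℝ × Matrix ι ι ℝ => (complexFrame p.1 p.2).det := by
  refine Continuous.matrix_det ?_
  exact ((continuous_fst.matrix_map Complex.continuous_ofReal).add
    ((continuous_snd.matrix_map Complex.continuous_ofReal).const_smul Complex.I))

theorem complexFrame_mul (X Y G : Matrix ι ι ℝ) :
    complexFrame (X * G) (Y * G) = complexFrame X Y * G.map Complex.ofRealHom := by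
  simp only [complexFrame, Matrix.map_mul, add_mul, smul_mul_assoc]

theorem isUnit_det_of_mulVec_eq_zero {K : Type*} [Field K] {A : Matrix ι ι K}
    (h : ∀ v, A *ᵥ v = 0 → v = 0) : IsUnit A.det := by
  rw [isUnit_iff_ne_zero]
  intro h0
  obtain ⟨v, hv, h1⟩ := Matrix.exists_mulVec_eq_zero_iff.2 h0
  exact hv (h v h1)

theorem mulVec_eq_zero_of_isUnit_det {K : Type*} [Field K] {A : Matrix ι ι K}
    (h : IsUnit A.det) {v : ι → K} (hv : A *ᵥ v = 0) : v = 0 := by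
  by_contra h0
  exact h.ne_zero (Matrix.exists_mulVec_eq_zero_iff.1 ⟨v, h0, hv⟩)

theorem det_souriau (X Y : Matrix ι ι ℝ) : (souriau X Y).det
    = (complexFrame X Y).det / (starRingEnd ℂ) (complexFrame X Y).det := by
  rw [souriau, Matrix.det_mul, Matrix.det_nonsing_inv, det_complexFrame_neg,
    Ring.inverse_eq_inv', div_eq_mul_inv]

namespace IsLagrangianPair

variable {X Y : Matrix ι ι ℝ}

/-- By isotropy the cross terms in `(Xᵀ - iYᵀ)(X + iY)` cancel, leaving `XᵀX + YᵀY`, which is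
invertible because the frame is injective. -/
theorem det_complexFrame_ne_zero (h : IsLagrangianPair X Y) : (complexFrame X Y).det ≠ 0 := by
  have h1 : complexFrame Xᵀ (-Yᵀ) * complexFrame X Y
      = (Xᵀ * X + Yᵀ * Y).map Complex.ofRealHom := by
    have h2 := congrArg (fun A => A.map Complex.ofRealHom) h.isotropic
    simp only [Matrix.map_mul] at h2
    have h3 : (-Yᵀ).map Complex.ofRealHom = -(Yᵀ.map Complex.ofRealHom) := by
      ext i j; simp
    rw [complexFrame, complexFrame, Matrix.map_add _ (by simp), Matrix.map_mul, Matrix.map_mul, h3]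
    simp only [add_mul, mul_add, smul_mul_assoc, mul_smul_comm, smul_neg, neg_mul, h2, smul_add]
    rw [smul_smul, Complex.I_mul_I, neg_smul, one_smul]
    abel
  have h4 : IsUnit (Xᵀ * X + Yᵀ * Y).det := by
    refine isUnit_det_of_mulVec_eq_zero fun v hv => ?_
    have h5 : (X *ᵥ v) ⬝ᵥ (X *ᵥ v) + (Y *ᵥ v) ⬝ᵥ (Y *ᵥ v) = 0 := by
      have := congrArg (fun w => v ⬝ᵥ w) hv
      simpa only [Matrix.add_mulVec, ← Matrix.mulVec_mulVec, dotProduct_add,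
        Matrix.dotProduct_mulVec v, Matrix.vecMul_transpose, dotProduct_zero] using this
    have h6 : 0 ≤ (X *ᵥ v) ⬝ᵥ (X *ᵥ v) := Finset.sum_nonneg fun i _ => mul_self_nonneg _
    have h7 : 0 ≤ (Y *ᵥ v) ⬝ᵥ (Y *ᵥ v) := Finset.sum_nonneg fun i _ => mul_self_nonneg _
    exact h.injective v (dotProduct_self_eq_zero.1 (by linarith))
      (dotProduct_self_eq_zero.1 (by linarith))
  intro h0
  have h8 := congrArg Matrix.det h1
  rw [Matrix.det_mul, h0, mul_zero] at h8
  have h9 : ((Xᵀ * X + Yᵀ * Y).map Complex.ofRealHom).det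
      = Complex.ofRealHom (Xᵀ * X + Yᵀ * Y).det := (RingHom.map_det _ _).symm
  rw [h9] at h8
  exact h4.ne_zero (by simpa using h8.symm)

theorem isUnit_det_complexFrame_neg (h : IsLagrangianPair X Y) :
    IsUnit (complexFrame X (-Y)).det := by
  rw [det_complexFrame_neg, isUnit_iff_ne_zero]
  simpa using h.det_complexFrame_ne_zero

theorem souriau_mul_complexFrame (h : IsLagrangianPair X Y) :
    souriau X Y * complexFrame X (-Y) = complexFrame X Y := by
  rw [souriau, mul_assoc, Matrix.nonsing_inv_mul _ h.isUnit_det_complexFrame_neg, mul_one]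

/-- A change of frame multiplies `X + iY` and `X - iY` on the right by the same real matrix, which
cancels. -/
theorem souriau_eq_of_mul (h : IsLagrangianPair X Y) {G : Matrix ι ι ℝ}
    (hG : IsLagrangianPair (X * G) (Y * G)) : souriau (X * G) (Y * G) = souriau X Y := by
  have h1 := hG.souriau_mul_complexFrame
  have h2 : IsUnit (complexFrame (X * G) (-(Y * G))).det := hG.isUnit_det_complexFrame_neg
  have h3 : souriau X Y * complexFrame (X * G) (-(Y * G)) = complexFrame (X * G) (Y * G) := by
    rw [← neg_mul, complexFrame_mul, complexFrame_mul, ← mul_assoc, h.souriau_mul_complexFrame]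
  have h4 := congrArg (fun A => A * (complexFrame (X * G) (-(Y * G)))⁻¹) (h1.trans h3.symm)
  simpa only [mul_assoc, Matrix.mul_nonsing_inv _ h2, mul_one] using h4

/-- Almost every real shear makes the first component of a Lagrangian frame invertible. -/
theorem exists_isUnit_shear (h : IsLagrangianPair X Y) : ∃ κ : ℝ, IsUnit (X + κ • Y).det := by
  set p : Polynomial ℝ := (X.map Polynomial.C + (Polynomial.X : Polynomial ℝ) • Y.map Polynomial.C).det
  have hp : ∀ κ : ℝ, p.eval κ = (X + κ • Y).det := by
    intro κ
    change Polynomial.evalRingHom κ _ = _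
    rw [RingHom.map_det]
    congr 1
    ext i j
    simp
    ring
  -- The polynomial `det(X + κY)` does not vanish at `κ = i`, so it is nonzero and has a real
  -- non-root.
  have hI : p.eval₂ Complex.ofRealHom Complex.I = (complexFrame X Y).det := by
    change Polynomial.eval₂RingHom Complex.ofRealHom Complex.I _ = _
    rw [RingHom.map_det]
    congr 1
    ext i j
    simp [complexFrame]
    ring
  have hp0 : p ≠ 0 := by
    intro h0
    rw [h0, Polynomial.eval₂_zero] at hI
    exact h.det_complexFrame_ne_zero hI.symm
  obtain ⟨κ, hκ⟩ : ∃ κ, p.eval κ ≠ 0 := by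
    by_contra! h0
    exact hp0 (Polynomial.funext (by simpa using h0))
  exact ⟨κ, by rw [← hp]; exact isUnit_iff_ne_zero.2 hκ⟩

theorem isSymm_shear (h : IsLagrangianPair X Y) (κ : ℝ) : ((X + κ • Y)ᵀ * Y).IsSymm := by
  rw [Matrix.IsSymm]
  simp only [Matrix.transpose_mul, Matrix.transpose_transpose, Matrix.transpose_add,
    Matrix.transpose_smul, add_mul, h.isotropic, smul_mul_assoc]

theorem isHermitian_chart (h : IsLagrangianPair X Y) {κ : ℝ} (hκ : IsUnit (X + κ • Y).det) :
    (Y * (X + κ • Y)⁻¹).IsHermitian := by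
  set N := X + κ • Y with hN
  have h1 : Nᵀ * Y = Yᵀ * N := by
    have := (h.isSymm_shear κ).eq
    rw [Matrix.transpose_mul, Matrix.transpose_transpose] at this
    exact this.symm
  have h2 : IsUnit Nᵀ.det := by rwa [Matrix.det_transpose]
  change (Y * N⁻¹)ᵀ = Y * N⁻¹
  rw [Matrix.transpose_mul, Matrix.transpose_nonsing_inv]
  calc Nᵀ⁻¹ * Yᵀ = Nᵀ⁻¹ * (Yᵀ * N) * N⁻¹ := by
        rw [mul_assoc, mul_assoc, Matrix.mul_nonsing_inv _ hκ, mul_one]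
    _ = Y * N⁻¹ := by
        rw [← h1, ← mul_assoc, Matrix.nonsing_inv_mul _ h2, one_mul]

/-- With `N = X + κY` one has `X ± iY = N + (±i - κ)Y`; dividing by `N` exhibits the Souriau matrix
as a Möbius transform of the symmetric matrix `Y N⁻¹`. -/
theorem souriau_chart (h : IsLagrangianPair X Y) {κ : ℝ} (hκ : IsUnit (X + κ • Y).det) :
    souriau X Y * ((1 : ℂ) • 1 + (-Complex.I - κ) • (Y * (X + κ • Y)⁻¹).map Complex.ofRealHom)
      = (1 : ℂ) • 1 + (Complex.I - κ) • (Y * (X + κ • Y)⁻¹).map Complex.ofRealHom := by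
  set N := X + κ • Y with hN
  have h1 : N.map Complex.ofRealHom * N⁻¹.map Complex.ofRealHom = 1 := by
    rw [← Matrix.map_mul, Matrix.mul_nonsing_inv _ hκ]
    simp
  have h2 : ∀ x : ℂ, (1 : ℂ) • (1 : Matrix ι ι ℂ) + (x - κ) • (Y * N⁻¹).map Complex.ofRealHom
      = (X.map Complex.ofRealHom + x • Y.map Complex.ofRealHom) * N⁻¹.map Complex.ofRealHom := by
    intro x
    have h3 : X.map Complex.ofRealHom + x • Y.map Complex.ofRealHom
        = N.map Complex.ofRealHom + (x - κ) • Y.map Complex.ofRealHom := by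
      ext i j
      simp [hN]
      ring
    rw [h3, add_mul, h1, Matrix.map_mul, smul_mul_assoc, one_smul]
  rw [h2, h2, ← mul_assoc]
  congr 1
  rw [← complexFrame.eq_1]
  conv_rhs => rw [← h.souriau_mul_complexFrame]
  congr 1
  ext i j
  simp [complexFrame]

/-- The continuous part of the spectral phase in the chart given by a shear. -/
theorem spectralPhase_chart (h : IsLagrangianPair X Y) {κ : ℝ} (hκ : IsUnit (X + κ • Y).det) :
    spectralPhase (souriau X Y) = spectralSum (fun c => 2 * (chartPoint κ c).arg)
      (Y * (X + κ • Y)⁻¹) - Real.pi * (signature (diagForm ((X + κ • Y)ᵀ * Y)) : ℝ) := by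
  have hC := h.isHermitian_chart hκ
  -- With `C = Y N⁻¹`, congruence by `N` gives `Nᵀ C N = Nᵀ Y`, which involves no inverse and is
  -- easy to differentiate.
  have h1 : signature (diagForm ((X + κ • Y)ᵀ * Y))
      = signature (diagForm (Y * (X + κ • Y)⁻¹)) := by
    rw [← signature_congruence (C := Y * (X + κ • Y)⁻¹) hκ, mul_assoc (X + κ • Y)ᵀ, mul_assoc Y,
      Matrix.nonsing_inv_mul _ hκ, mul_one]
  rw [spectralPhase_of_moebius hC ?_ (h.souriau_chart hκ), h1, ← sum_sign_eigenvalues hC,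
    spectralSum_eq hC, Finset.mul_sum, ← Finset.sum_sub_distrib]
  · refine Finset.sum_congr rfl fun j _ => ?_
    rw [← conj_chartPoint, ← oppositeArg_chartPoint]
    rfl
  · intro j
    rw [← conj_chartPoint]
    simpa using Complex.slitPlane_ne_zero (chartPoint_mem_slitPlane κ _)

/-- The continuous part of `spectralPhase_chart` is itself an argument of the determinant. Hence a
phase minus the spectral phase is, locally, a constant plus `π` times a signature. -/
theorem det_souriau_chart (h : IsLagrangianPair X Y) {κ : ℝ} (hκ : IsUnit (X + κ • Y).det) :
    (souriau X Y).det = Complex.exp ((spectralSum (fun c => 2 * (chartPoint κ c).arg)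
      (Y * (X + κ • Y)⁻¹) : ℝ) * Complex.I) := by
  have hC := h.isHermitian_chart hκ
  rw [det_of_moebius hC ?_ (h.souriau_chart hκ), spectralSum_eq hC]
  · rw [Complex.ofReal_sum, Finset.sum_mul, Complex.exp_sum]
    refine Finset.prod_congr rfl fun j _ => ?_
    rw [← conj_chartPoint, ← div_conj_eq_exp (Complex.slitPlane_ne_zero
      (chartPoint_mem_slitPlane κ _))]
    rfl
  · intro j
    rw [← conj_chartPoint]
    simpa using Complex.slitPlane_ne_zero (chartPoint_mem_slitPlane κ _)

end IsLagrangianPair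

end LagrangianPairs

/-! ### Jump of the corrected phase at a regular crossing -/

section Jump

theorem mem_radical_toQuadraticMap_iff {V : Type*} [AddCommGroup V] [Module ℝ V]
    {B : LinearMap.BilinForm ℝ V} (hB : ∀ v w, B v w = B w v) (v : V) :
    v ∈ (LinearMap.BilinMap.toQuadraticMap B).radical ↔ ∀ w, B v w = 0 := by
  rw [QuadraticMap.mem_radical_iff']
  simp only [LinearMap.BilinMap.toQuadraticMap_apply, map_add, LinearMap.add_apply]
  constructor
  · rintro ⟨h1, h2⟩ w
    have := h2 w
    have := hB v w
    linarith
  · intro h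
    refine ⟨h v, fun w => ?_⟩
    rw [h v, h w, hB w v, h w]
    ring

theorem sigPos_add_sigNeg_of_nondegenerate {V : Type*} [AddCommGroup V] [Module ℝ V]
    [FiniteDimensional ℝ V] {B : LinearMap.BilinForm ℝ V} (hB : ∀ v w, B v w = B w v)
    (hn : B.Nondegenerate) : sigPos (LinearMap.BilinMap.toQuadraticMap B)
      + sigNeg (LinearMap.BilinMap.toQuadraticMap B) = Module.finrank ℝ V := by
  have h1 : (LinearMap.BilinMap.toQuadraticMap B).radical = ⊥ := by
    rw [eq_bot_iff]
    intro v hv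
    exact hn.1 v ((mem_radical_toQuadraticMap_iff hB v).1 hv)
  have := QuadraticForm.sigPos_add_sigNeg_add_radical (Q := LinearMap.BilinMap.toQuadraticMap B)
  rwa [h1, finrank_bot, add_zero] at this

variable {ι : Type*} [Fintype ι] [DecidableEq ι]

theorem sigPos_add_sigNeg_add_finrank_ker {B : Matrix ι ι ℝ} (hB : B.IsSymm) :
    sigPos (diagForm B) + sigNeg (diagForm B) + Module.finrank ℝ (LinearMap.ker B.mulVecLin)
      = Module.finrank ℝ (ι → ℝ) := by
  have hsymm : ∀ v w : ι → ℝ, Matrix.toLinearMap₂' ℝ B v w = Matrix.toLinearMap₂' ℝ B w v := by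
    intro v w
    rw [Matrix.toLinearMap₂'_apply', Matrix.toLinearMap₂'_apply', Matrix.dotProduct_mulVec,
      ← Matrix.mulVec_transpose, hB.eq, dotProduct_comm]
  have h1 : (diagForm B).radical = LinearMap.ker B.mulVecLin := by
    ext v
    rw [diagForm, mem_radical_toQuadraticMap_iff hsymm, LinearMap.mem_ker, Matrix.mulVecLin_apply]
    constructor
    · intro h
      refine dotProduct_self_eq_zero.1 ?_
      have := h (B *ᵥ v)
      rwa [hsymm, Matrix.toLinearMap₂'_apply'] at this
    · intro h w
      rw [hsymm, Matrix.toLinearMap₂'_apply', h, dotProduct_zero]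
  rw [← h1]
  exact QuadraticForm.sigPos_add_sigNeg_add_radical

theorem mulVec_eq_zero_of_sigPos_add_sigNeg {B : Matrix ι ι ℝ} (hB : B.IsSymm)
    (h : sigPos (diagForm B) + sigNeg (diagForm B) = Module.finrank ℝ (ι → ℝ)) {v : ι → ℝ}
    (hv : B *ᵥ v = 0) : v = 0 := by
  have h1 := sigPos_add_sigNeg_add_finrank_ker hB
  rw [h] at h1
  have h2 : LinearMap.ker B.mulVecLin = ⊥ := Submodule.finrank_eq_zero.1 (by omega)
  have h3 : v ∈ LinearMap.ker B.mulVecLin := hv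
  rwa [h2, Submodule.mem_bot] at h3

/-- Two lifts of the same continuous path to the circle differ by a locally constant function. -/
theorem eventually_sub_eq_of_exp_eq {X : Type*} {l : Filter X} {f g : X → ℝ} {a b : ℝ}
    (hf : Tendsto f l (𝓝 a)) (hg : Tendsto g l (𝓝 b))
    (h : ∀ᶠ x in l, Complex.exp (f x * Complex.I) = Complex.exp (g x * Complex.I))
    (hab : Complex.exp (a * Complex.I) = Complex.exp (b * Complex.I)) :
    ∀ᶠ x in l, f x - g x = a - b := by
  have key : ∀ {x y : ℝ}, Complex.exp (x * Complex.I) = Complex.exp (y * Complex.I) →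
      ∃ k : ℤ, x - y = k * (2 * Real.pi) := by
    intro x y hxy
    obtain ⟨k, hk⟩ := Complex.exp_eq_exp_iff_exists_int.1 hxy
    refine ⟨k, ?_⟩
    have := congrArg Complex.im hk
    simp at this
    linarith
  obtain ⟨k₀, hk₀⟩ := key hab
  have h1 := ((hf.sub hg).sub_const (a - b)).abs
  rw [sub_self, abs_zero] at h1
  filter_upwards [h, h1.eventually_lt_const (by positivity : (0:ℝ) < 2 * Real.pi)] with x hx hx1
  obtain ⟨k, hk⟩ := key hx
  rw [hk, hk₀, ← sub_mul, abs_mul, abs_of_pos (by positivity : (0:ℝ) < 2 * Real.pi)] at hx1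
  have h2 : |(k : ℝ) - k₀| < 1 := by
    have := Real.two_pi_pos
    by_contra! h3
    nlinarith
  have h3 : k = k₀ := by
    rw [← Int.cast_sub, ← Int.cast_abs] at h2
    have : |k - k₀| < 1 := by exact_mod_cast h2
    have := Int.abs_lt_one_iff.1 this
    omega
  rw [hk, hk₀, h3]

/-- Two bilinear forms given by matrices whose quadratic forms agree on a subspace. -/
theorem restrict_diagForm_congr {B B' : Matrix ι ι ℝ} {K : Submodule ℝ (ι → ℝ)}
    (h : ∀ v ∈ K, v ⬝ᵥ B *ᵥ v = v ⬝ᵥ B' *ᵥ v) :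
    (diagForm B).restrict K = (diagForm B').restrict K := by
  ext ⟨v, hv⟩
  simpa [QuadraticMap.restrict_apply] using h v hv

/-- The signature of a path of symmetric matrices near a time at which the derivative is
nondegenerate on the kernel. -/
theorem eventually_signature_eq {G : ℝ → Matrix ι ι ℝ} {G' : Matrix ι ι ℝ} {s : Set ℝ} {t₀ : ℝ}
    (hG : HasMatrixDerivWithinAt G G' s t₀) (hsymm : (G t₀).IsSymm) {K : Submodule ℝ (ι → ℝ)}
    (hK : K = LinearMap.ker (G t₀).mulVecLin)
    (hreg : sigPos ((diagForm G').restrict K) + sigNeg ((diagForm G').restrict K)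
      = Module.finrank ℝ K) :
    ∀ᶠ t in 𝓝[s \ {t₀}] t₀, signature (diagForm (G t)) = signature (diagForm (G t₀))
        + SignType.sign (t - t₀) * signature ((diagForm G').restrict K) ∧
      sigPos (diagForm (G t)) + sigNeg (diagForm (G t)) = Module.finrank ℝ (ι → ℝ) := by
  obtain ⟨D, hD, hGD⟩ := hG.exists_tendsto
  have hdim := sigPos_add_sigNeg_add_finrank_ker hsymm
  have hKer : ∀ v ∈ K, G t₀ *ᵥ v = 0 := fun v hv => by rw [hK] at hv; exact hv
  rw [← hK] at hdim
  have hsplit : s \ {t₀} = (s ∩ Ioi t₀) ∪ (s ∩ Iio t₀) := by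
    ext t
    simp only [Set.mem_sdiff, mem_singleton_iff, mem_union, mem_inter_iff, mem_Ioi, mem_Iio]
    constructor
    · rintro ⟨h1, h2⟩
      rcases lt_or_gt_of_ne h2 with h | h
      · exact Or.inr ⟨h1, h⟩
      · exact Or.inl ⟨h1, h⟩
    · rintro (⟨h1, h2⟩ | ⟨h1, h2⟩)
      · exact ⟨h1, h2.ne'⟩
      · exact ⟨h1, h2.ne⟩
  have hsub : ∀ {u : Set ℝ}, Tendsto (fun t => t - t₀) (𝓝[u] t₀) (𝓝 0) := by
    intro u
    have : Continuous fun t : ℝ => t - t₀ := by fun_prop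
    simpa using (this.tendsto t₀).mono_left nhdsWithin_le_nhds
  rw [hsplit, nhdsWithin_union, eventually_sup]
  constructor
  · have h1 : Tendsto D (𝓝[s ∩ Ioi t₀] t₀) (𝓝 G') :=
      hD.mono_left (nhdsWithin_mono _ (by rw [hsplit]; exact subset_union_left))
    have hpos : ∀ᶠ t in 𝓝[s ∩ Ioi t₀] t₀, 0 < t - t₀ := by
      filter_upwards [self_mem_nhdsWithin] with t ht
      exact sub_pos.2 ht.2
    filter_upwards [signature_of_perturbation hsub hpos h1 hsymm hKer hdim hreg, hpos] with t ht h2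
    rw [← hGD t] at ht
    simpa [sign_pos h2] using ht
  · have h1 : Tendsto (fun t => -D t) (𝓝[s ∩ Iio t₀] t₀) (𝓝 (-G')) :=
      (hD.mono_left (nhdsWithin_mono _ (by rw [hsplit]; exact subset_union_right))).neg
    have hpos : ∀ᶠ t in 𝓝[s ∩ Iio t₀] t₀, 0 < -(t - t₀) := by
      filter_upwards [self_mem_nhdsWithin] with t ht
      exact neg_pos.2 (sub_neg.2 ht.2)
    have e' : (diagForm (-G')).restrict K = -((diagForm G').restrict K) := by
      rw [diagForm_neg]; rfl
    have hreg' : sigPos ((diagForm (-G')).restrict K) + sigNeg ((diagForm (-G')).restrict K)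
        = Module.finrank ℝ K := by
      rw [e', sigPos_neg, sigNeg_neg, add_comm, hreg]
    have h0 : Tendsto (fun t => -(t - t₀)) (𝓝[s ∩ Iio t₀] t₀) (𝓝 0) := by
      simpa using (hsub (u := s ∩ Iio t₀)).neg
    filter_upwards [signature_of_perturbation h0 hpos h1 hsymm hKer hdim hreg', hpos] with t ht h2
    -- To the left of `t₀` the positive parameter is `t₀ - t` and the effective derivative is `-G'`,
    -- which reverses the jump.
    have e : G t₀ + (-(t - t₀)) • -D t = G t := by
      rw [hGD t, smul_neg, neg_smul, neg_neg]
    rw [e, e', signature_neg] at ht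
    have h3 : t - t₀ < 0 := by linarith
    simpa [sign_neg h3] using ht

theorem tendsto_matrix_inv {A : Matrix ι ι ℝ} (hA : IsUnit A.det) :
    Tendsto (fun M : Matrix ι ι ℝ => M⁻¹) (𝓝 A) (𝓝 A⁻¹) := by
  simp only [Matrix.inv_def, Ring.inverse_eq_inv']
  exact ((continuous_id.matrix_det.tendsto A).inv₀ hA.ne_zero).smul
    (continuous_id.matrix_adjugate.tendsto A)

/-- The phase of a path of Lagrangian subspaces, corrected by the spectral phase, jumps by `π` times
the signature of the crossing form on either side of a regular crossing. -/
theorem eventually_phase_sub_spectralPhase {X Y : ℝ → Matrix ι ι ℝ} {X' Y' : Matrix ι ι ℝ}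
    {s : Set ℝ} {t₀ : ℝ} (ht₀ : t₀ ∈ s) (hL : ∀ t ∈ s, IsLagrangianPair (X t) (Y t))
    (hX : HasMatrixDerivWithinAt X X' s t₀) (hY : HasMatrixDerivWithinAt Y Y' s t₀)
    {φ : ℝ → ℝ} (hφ : ContinuousWithinAt φ s t₀)
    (hφW : ∀ t ∈ s, Complex.exp (φ t * Complex.I) = (souriau (X t) (Y t)).det)
    {K : Submodule ℝ (ι → ℝ)} (hK : K = LinearMap.ker (Y t₀).mulVecLin)
    (hreg : sigPos ((diagForm ((X t₀)ᵀ * Y')).restrict K)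
      + sigNeg ((diagForm ((X t₀)ᵀ * Y')).restrict K) = Module.finrank ℝ K) :
    ∀ᶠ t in 𝓝[s] t₀, φ t - spectralPhase (souriau (X t) (Y t))
        = φ t₀ - spectralPhase (souriau (X t₀) (Y t₀)) + Real.pi * ((SignType.sign (t - t₀) : ℝ)
          * (signature ((diagForm ((X t₀)ᵀ * Y')).restrict K) : ℝ)) ∧
      (t ≠ t₀ → ∀ v, Y t *ᵥ v = 0 → v = 0) := by
  obtain ⟨κ, hκ⟩ := (hL t₀ ht₀).exists_isUnit_shear
  have hN := hX.add (hY.const_smul κ)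
  have hNc : Tendsto (fun t => X t + κ • Y t) (𝓝[s] t₀) (𝓝 (X t₀ + κ • Y t₀)) :=
    hN.continuousWithinAt
  have hκ' : ∀ᶠ t in 𝓝[s] t₀, IsUnit (X t + κ • Y t).det := by
    have h1 : Tendsto (fun t => (X t + κ • Y t).det) (𝓝[s] t₀) (𝓝 (X t₀ + κ • Y t₀).det) :=
      (continuous_id.matrix_det.tendsto _).comp hNc
    exact (h1.eventually_ne hκ.ne_zero).mono fun t ht => isUnit_iff_ne_zero.2 ht
  -- the continuous part
  set θ : ℝ → ℝ := fun t => spectralSum (fun c => 2 * (chartPoint κ c).arg)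
    (Y t * (X t + κ • Y t)⁻¹) with hθ
  have hC : ContinuousWithinAt (fun t => Y t * (X t + κ • Y t)⁻¹) s t₀ := by
    have h3 : Tendsto (fun t => (X t + κ • Y t)⁻¹) (𝓝[s] t₀) (𝓝 (X t₀ + κ • Y t₀)⁻¹) :=
      (tendsto_matrix_inv hκ).comp hNc
    exact ((continuous_fst.matrix_mul continuous_snd).tendsto (Y t₀, (X t₀ + κ • Y t₀)⁻¹)).comp
      (hY.continuousWithinAt.tendsto.prodMk_nhds h3)
  have hθt : Tendsto θ (𝓝[s] t₀) (𝓝 (θ t₀)) := by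
    refine tendsto_spectralSum ?_ ((hL t₀ ht₀).isHermitian_chart hκ) hC
      (continuous_const.mul (continuous_arg_chartPoint κ))
    filter_upwards [hκ', self_mem_nhdsWithin] with t ht hts
    exact (hL t hts).isHermitian_chart ht
  -- Both `φ` and `θ` are continuous arguments of the same determinant.
  have hφθ : ∀ᶠ t in 𝓝[s] t₀, φ t - θ t = φ t₀ - θ t₀ := by
    refine eventually_sub_eq_of_exp_eq hφ hθt ?_ ?_
    · filter_upwards [hκ', self_mem_nhdsWithin] with t ht hts
      rw [hφW t hts, (hL t hts).det_souriau_chart ht]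
    · rw [hφW t₀ ht₀, (hL t₀ ht₀).det_souriau_chart hκ]
  -- the signature
  have hG := hN.transpose.mul hY
  set G : ℝ → Matrix ι ι ℝ := fun t => (X t + κ • Y t)ᵀ * Y t with hGdef
  set G' := (X' + κ • Y')ᵀ * Y t₀ + (X t₀ + κ • Y t₀)ᵀ * Y' with hG'
  have hKer : K = LinearMap.ker (G t₀).mulVecLin := by
    rw [hK]
    ext v
    simp only [LinearMap.mem_ker, Matrix.mulVecLin_apply, hGdef, ← Matrix.mulVec_mulVec]
    constructor
    · intro h; rw [h, Matrix.mulVec_zero]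
    · intro h
      exact mulVec_eq_zero_of_isUnit_det (by rwa [Matrix.det_transpose]) h
  -- On `Ker Y(t₀)` the terms containing `Y(t₀)` drop out, including the one with the shear
  -- parameter, so the result does not depend on the chart.
  have hform : (diagForm G').restrict K = (diagForm ((X t₀)ᵀ * Y')).restrict K := by
    refine restrict_diagForm_congr fun v hv => ?_
    have hv' : Y t₀ *ᵥ v = 0 := by rw [hK] at hv; exact hv
    have h1 : v ⬝ᵥ (Y t₀)ᵀ *ᵥ (Y' *ᵥ v) = 0 := by
      rw [Matrix.dotProduct_mulVec, Matrix.vecMul_transpose, hv', zero_dotProduct]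
    simp only [hG', Matrix.add_mulVec, ← Matrix.mulVec_mulVec, hv', Matrix.mulVec_zero, zero_add,
      Matrix.transpose_add, Matrix.transpose_smul, Matrix.smul_mulVec, dotProduct_add,
      dotProduct_smul, h1, smul_zero, add_zero]
  have hsig := eventually_signature_eq hG ((hL t₀ ht₀).isSymm_shear κ) hKer
    (by rw [hform]; exact hreg)
  rw [hform, eventually_nhdsWithin_iff] at hsig
  filter_upwards [nhdsWithin_le_nhds hsig, hφθ, hκ', self_mem_nhdsWithin] with t ht' h1 h2 hts
  have ht := fun hne : t ≠ t₀ => ht' ⟨hts, hne⟩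
  constructor
  · rw [(hL t hts).spectralPhase_chart h2, (hL t₀ ht₀).spectralPhase_chart hκ]
    by_cases hne : t = t₀
    · subst hne; simp
    · have h3 : (signature (diagForm (G t)) : ℝ) = signature (diagForm (G t₀))
        + (SignType.sign (t - t₀) : ℝ) * signature ((diagForm ((X t₀)ᵀ * Y')).restrict K) := by
        rw [(ht hne).1]
        push_cast
        rcases lt_trichotomy (t - t₀) 0 with h | h | h
        · simp [sign_neg h]
        · simp [h]
        · simp [sign_pos h]
      change φ t - (θ t - Real.pi * (signature (diagForm (G t)) : ℝ))
        = φ t₀ - (θ t₀ - Real.pi * (signature (diagForm (G t₀)) : ℝ)) + _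
      rw [h3]
      linear_combination h1
  · intro hne v hv
    refine mulVec_eq_zero_of_sigPos_add_sigNeg ((hL t hts).isSymm_shear κ) (ht hne).2 ?_
    rw [← Matrix.mulVec_mulVec, hv, Matrix.mulVec_zero]

end Jump

/-! ### Step functions on the interval and continuous arguments -/

section UnitInterval

theorem eq_of_eventually_eq_nhdsWithin {h : ℝ → ℝ}
    (hh : ∀ t₀ ∈ Icc (0 : ℝ) 1, ∀ᶠ t in 𝓝[Icc 0 1] t₀, h t = h t₀) :
    ∀ t ∈ Icc (0 : ℝ) 1, h t = h 0 := by
  have hd : ∀ t₀ ∈ Icc (0 : ℝ) 1, HasDerivWithinAt h 0 (Icc 0 1) t₀ := fun t₀ ht₀ =>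
    (hasDerivWithinAt_const t₀ (Icc 0 1) (h t₀)).congr_of_eventuallyEq (hh t₀ ht₀) rfl
  refine constant_of_derivWithin_zero (fun t ht => (hd t ht).differentiableWithinAt) ?_
  intro t ht
  have ht' : t ∈ Icc (0 : ℝ) 1 := Ico_subset_Icc_self ht
  exact (hd t ht').derivWithin (uniqueDiffOn_Icc zero_lt_one t ht')

/-- The increment of a function which is locally constant except for symmetric jumps. -/
theorem sub_eq_sum_of_jumps {f σ : ℝ → ℝ}
    (h : ∀ t₀ ∈ Icc (0 : ℝ) 1, ∀ᶠ t in 𝓝[Icc 0 1] t₀,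
      f t = f t₀ + (SignType.sign (t - t₀) : ℝ) * σ t₀ ∧ (t ≠ t₀ → σ t = 0)) :
    f 1 - f 0 = σ 0 + 2 * ∑ᶠ t ∈ Ioo (0 : ℝ) 1, σ t + σ 1 := by
  classical
  have hfin : {t ∈ Icc (0 : ℝ) 1 | σ t ≠ 0}.Finite := by
    -- Each point has a neighbourhood containing no other jump; compactness makes the number of
    -- jumps finite.
    have : (Icc (0 : ℝ) 1 ∩ {t | σ t ≠ 0}).Finite := by
      refine isCompact_Icc.induction_on (p := fun A => (A ∩ {t | σ t ≠ 0}).Finite) (by simp)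
        (fun A B hAB hB => hB.subset (inter_subset_inter_left _ hAB))
        (fun A B hA hB => by rw [union_inter_distrib_right]; exact hA.union hB) ?_
      intro x hx
      refine ⟨_, h x hx, (finite_singleton x).subset ?_⟩
      rintro t ⟨⟨-, ht1⟩, ht2⟩
      by_contra hne
      exact ht2 (ht1 hne)
    exact this
  set S := hfin.toFinset with hS
  have hmem : ∀ t, t ∈ S ↔ (0 ≤ t ∧ t ≤ 1) ∧ σ t ≠ 0 := fun t => by simp [hS]
  -- Subtracting a combination of sign functions, one per jump, leaves a locally constant function.
  -- Between `0` and `1` an interior sign function grows by `2` and one centred at an endpoint by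
  -- `1`, whence the weights.
  have hconst := eq_of_eventually_eq_nhdsWithin
    (h := fun t => f t - ∑ x ∈ S, σ x * (SignType.sign (t - x) : ℝ)) (by
      intro t₀ ht₀
      have h1 : ∀ᶠ t in 𝓝[Icc 0 1] t₀, ∀ x ∈ S, x ≠ t₀ →
          SignType.sign (t - x) = SignType.sign (t₀ - x) := by
        rw [Finset.eventually_all]
        intro x _
        by_cases hx : x = t₀
        · simp [hx]
        · have h2 : ContinuousAt (fun t : ℝ => t - x) t₀ := by fun_prop
          refine nhdsWithin_le_nhds ?_
          rcases lt_or_gt_of_ne (sub_ne_zero.2 (Ne.symm hx)) with h3 | h3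
          · filter_upwards [h2.eventually_lt_const h3] with t ht _
            rw [sign_neg ht, sign_neg h3]
          · filter_upwards [h2.eventually_const_lt h3] with t ht _
            rw [sign_pos ht, sign_pos h3]
      filter_upwards [h t₀ ht₀, h1] with t ht ht1
      have h2 : ∑ x ∈ S, σ x * (SignType.sign (t - x) : ℝ)
          = ∑ x ∈ S, σ x * (SignType.sign (t₀ - x) : ℝ)
            + (SignType.sign (t - t₀) : ℝ) * σ t₀ := by
        rw [← sub_eq_iff_eq_add', ← Finset.sum_sub_distrib]
        rw [Finset.sum_eq_single t₀]
        · simp [mul_comm]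
        · intro x hx hne
          rw [ht1 x hx hne, sub_self]
        · intro hx
          have : σ t₀ = 0 := by
            by_contra h3
            exact hx ((hmem t₀).2 ⟨ht₀, h3⟩)
          simp [this]
      simp only [h2, ht.1]
      ring) 1 (by simp)
  have e1 : f 1 - f 0 = ∑ x ∈ S, (σ x * (SignType.sign (1 - x) : ℝ)
      - σ x * (SignType.sign (0 - x) : ℝ)) := by
    rw [Finset.sum_sub_distrib]; linarith
  have e2 : ∑ᶠ t ∈ Ioo (0 : ℝ) 1, σ t = ∑ x ∈ S, (Ioo (0 : ℝ) 1).indicator σ x := by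
    rw [finsum_mem_def]
    refine finsum_eq_sum_of_support_subset _ fun t ht => ?_
    rw [Function.mem_support, indicator_apply_ne_zero] at ht
    exact (hmem t).2 ⟨⟨ht.1.1.le, ht.1.2.le⟩, ht.2⟩
  have e3 : ∀ a ∈ Icc (0 : ℝ) 1, σ a = ∑ x ∈ S, if x = a then σ x else 0 := by
    intro a ha
    rw [Finset.sum_ite_eq' S a σ]
    split_ifs with h1
    · rfl
    · by_contra h3
      exact h1 ((hmem a).2 ⟨ha, h3⟩)
  rw [e1, e2, e3 0 (by simp), e3 1 (by simp), Finset.mul_sum, ← Finset.sum_add_distrib,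
    ← Finset.sum_add_distrib]
  refine Finset.sum_congr rfl fun x hx => ?_
  obtain ⟨⟨h0, h1⟩, -⟩ := (hmem x).1 hx
  rcases h0.eq_or_lt with rfl | h0
  · simp
  rcases h1.eq_or_lt with rfl | h1
  · simp
  have h2 : x ∈ Ioo (0 : ℝ) 1 := ⟨h0, h1⟩
  rw [indicator_of_mem h2, if_neg h0.ne', if_neg h1.ne, sign_pos (by linarith),
    sign_neg (by linarith)]
  simp
  ring

/-- `φ` is a continuous choice of the argument of `u` on the set `s`. -/
structure IsPhase {X : Type*} [TopologicalSpace X] (u : X → ℂ) (s : Set X) (φ : X → ℝ) : Prop where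
  continuousOn : ContinuousOn φ s
  exp_eq : ∀ x ∈ s, Complex.exp (φ x * Complex.I) = u x

/-- Two lifts differ locally by a constant multiple of `2π`, hence globally by a constant. -/
theorem IsPhase.sub_eq {u : ℝ → ℂ} {φ ψ : ℝ → ℝ} (hφ : IsPhase u (Icc 0 1) φ)
    (hψ : IsPhase u (Icc 0 1) ψ) : φ 1 - φ 0 = ψ 1 - ψ 0 := by
  have := eq_of_eventually_eq_nhdsWithin (h := fun t => φ t - ψ t) (fun t₀ ht₀ => by
    refine eventually_sub_eq_of_exp_eq (hφ.continuousOn t₀ ht₀) (hψ.continuousOn t₀ ht₀) ?_ ?_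
    · filter_upwards [self_mem_nhdsWithin] with t ht
      rw [hφ.exp_eq t ht, hψ.exp_eq t ht]
    · rw [hφ.exp_eq _ ht₀, hψ.exp_eq _ ht₀]) 1 (by simp)
  linarith

theorem IsPhase.comp {X Z : Type*} [TopologicalSpace X] [TopologicalSpace Z] {u : X → ℂ}
    {s : Set X} {φ : X → ℝ} (h : IsPhase u s φ) {g : Z → X} {r : Set Z} (hg : ContinuousOn g r)
    (hs : MapsTo g r s) : IsPhase (fun z => u (g z)) r (fun z => φ (g z)) :=
  ⟨h.continuousOn.comp hg hs, fun _ hz => h.exp_eq _ (hs hz)⟩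

theorem IsPhase.congr {X : Type*} [TopologicalSpace X] {u v : X → ℂ} {s : Set X} {φ : X → ℝ}
    (h : IsPhase u s φ) (huv : ∀ x ∈ s, u x = v x) : IsPhase v s φ :=
  ⟨h.continuousOn, fun x hx => by rw [h.exp_eq x hx, huv x hx]⟩

/-- A nowhere vanishing function on the square has a continuous argument. -/
theorem exists_isPhase_square {u : ℝ × ℝ → ℂ} (hu : ContinuousOn u (Icc 0 1 ×ˢ Icc 0 1))
    (h0 : ∀ p ∈ Icc (0 : ℝ) 1 ×ˢ Icc (0 : ℝ) 1, u p ≠ 0) :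
    ∃ φ, IsPhase (fun p => u p / (starRingEnd ℂ) (u p)) (Icc (0 : ℝ) 1 ×ˢ Icc (0 : ℝ) 1) φ := by
  -- Clamping both coordinates extends the function to the simply connected plane, where lifting
  -- through the covering `Circle.exp` applies.
  set c : ℝ × ℝ → ℝ × ℝ := fun p => (projIcc (0:ℝ) 1 zero_le_one p.1, projIcc (0:ℝ) 1 zero_le_one p.2)
  have hc : Continuous c := by
    refine Continuous.prodMk ?_ ?_
    · exact continuous_subtype_val.comp (continuous_projIcc.comp continuous_fst)
    · exact continuous_subtype_val.comp (continuous_projIcc.comp continuous_snd)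
  have hcm : ∀ p, c p ∈ Icc (0 : ℝ) 1 ×ˢ Icc (0 : ℝ) 1 := fun p =>
    ⟨Subtype.prop _, Subtype.prop _⟩
  have hcid : ∀ p ∈ Icc (0 : ℝ) 1 ×ˢ Icc (0 : ℝ) 1, c p = p := fun p hp => by
    simp only [c, projIcc_of_mem zero_le_one hp.1, projIcc_of_mem zero_le_one hp.2]
  have hv : Continuous fun p => u (c p) :=
    hu.comp_continuous hc hcm
  have hne : ∀ p, (starRingEnd ℂ) (u (c p)) ≠ 0 := fun p => by simpa using h0 _ (hcm p)
  have hval : ∀ p, (Circle.ofConjDivSelf _ (hne p) : ℂ) = u (c p) / (starRingEnd ℂ) (u (c p)) :=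
    fun p => by simp [Circle.ofConjDivSelf]
  have hf : Continuous fun p => Circle.ofConjDivSelf _ (hne p) := by
    refine continuous_induced_rng.2 ?_
    have h1 : Continuous fun p => u (c p) / (starRingEnd ℂ) (u (c p)) :=
      hv.div (Complex.continuous_conj.comp hv) hne
    exact h1.congr fun p => (hval p).symm
  obtain ⟨e₀, he₀⟩ := Circle.exp_surjective (Circle.ofConjDivSelf _ (hne 0))
  obtain ⟨φ, ⟨-, hφ⟩, -⟩ :=
    Circle.isCoveringMap_exp.existsUnique_continuousMap_lifts ⟨_, hf⟩ 0 e₀ he₀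
  refine ⟨φ, φ.continuous.continuousOn, fun p hp => ?_⟩
  have h1 := congrArg (fun z : Circle => (z : ℂ)) (congrFun hφ p)
  simp only [Function.comp_apply, Circle.coe_exp] at h1
  rw [h1]
  exact (hval p).trans (by rw [hcid p hp])

end UnitInterval

/-! ### Coordinates adapted to the diagonal -/

section Frames

variable {n : ℕ}

/-- The component `a + b` of a frame `v ↦ (a v, b v)`. -/
def frameX (A : R2 n →L[ℝ] R2 n × R2 n) : Mat2 n :=
  Matrix.of fun i j => (A (Pi.single j 1)).1 i + (A (Pi.single j 1)).2 i

/-- The component `J₀ (a - b)` of a frame `v ↦ (a v, b v)`. -/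
def frameY (A : R2 n →L[ℝ] R2 n × R2 n) : Mat2 n :=
  J0 n * Matrix.of fun i j => (A (Pi.single j 1)).1 i - (A (Pi.single j 1)).2 i

theorem frameX_mulVec (A : R2 n →L[ℝ] R2 n × R2 n) (v : R2 n) :
    frameX A *ᵥ v = (A v).1 + (A v).2 := by
  have h : frameX A = LinearMap.toMatrix' ((LinearMap.fst ℝ _ _ + LinearMap.snd ℝ _ _) ∘ₗ
      (A : R2 n →ₗ[ℝ] R2 n × R2 n)) := by
    ext i j
    simp [frameX, LinearMap.toMatrix'_apply]
  rw [h, LinearMap.toMatrix'_mulVec]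
  rfl

theorem frameY_mulVec (A : R2 n →L[ℝ] R2 n × R2 n) (v : R2 n) :
    frameY A *ᵥ v = J0 n *ᵥ ((A v).1 - (A v).2) := by
  have h : Matrix.of (fun i j => (A (Pi.single j 1)).1 i - (A (Pi.single j 1)).2 i)
      = LinearMap.toMatrix' ((LinearMap.fst ℝ _ _ - LinearMap.snd ℝ _ _) ∘ₗ
      (A : R2 n →ₗ[ℝ] R2 n × R2 n)) := by
    ext i j
    simp [LinearMap.toMatrix'_apply]
  rw [frameY, ← Matrix.mulVec_mulVec, h, LinearMap.toMatrix'_mulVec]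
  rfl

theorem J0_mul_J0 : J0 n * J0 n = -1 := by
  simpa using Matrix.J_squared (Fin n) ℝ

theorem J0_transpose : (J0 n)ᵀ = -J0 n := Matrix.J_transpose _ _

theorem J0_mulVec_J0_mulVec (v : R2 n) : J0 n *ᵥ (J0 n *ᵥ v) = -v := by
  rw [Matrix.mulVec_mulVec, J0_mul_J0, Matrix.neg_mulVec, Matrix.one_mulVec]

theorem J0_mulVec_eq_zero {v : R2 n} (h : J0 n *ᵥ v = 0) : v = 0 := by
  have := J0_mulVec_J0_mulVec v
  rw [h, Matrix.mulVec_zero] at this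
  exact neg_eq_zero.1 this.symm

theorem omega0_eq (v w : R2 n) : omega0 n v w = -(v ⬝ᵥ J0 n *ᵥ w) := by
  have h := omega0_J0 n v (-(J0 n *ᵥ w))
  rwa [Matrix.mulVec_neg, J0_mulVec_J0_mulVec, neg_neg, dotProduct_neg] at h

theorem J0_dotProduct (v w : R2 n) : (J0 n *ᵥ v) ⬝ᵥ w = -(v ⬝ᵥ J0 n *ᵥ w) := by
  rw [Matrix.dotProduct_mulVec, ← Matrix.mulVec_transpose, J0_transpose, Matrix.neg_mulVec,
    neg_dotProduct, neg_neg]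

/-- In the coordinates `(a + b, J₀ (a - b))` the graph form is half the standard symplectic form, so
Lagrangian frames become Lagrangian pairs. -/
theorem omegaGraph_eq (z w : R2 n × R2 n) : omegaGraph n z w
    = 1 / 2 * ((z.1 + z.2) ⬝ᵥ (J0 n *ᵥ (w.1 - w.2))
      - (J0 n *ᵥ (z.1 - z.2)) ⬝ᵥ (w.1 + w.2)) := by
  have h : omegaGraph n z w = omega0 n z.2 w.2 - omega0 n z.1 w.1 := rfl
  rw [h, omega0_eq, omega0_eq, J0_dotProduct]
  simp only [Matrix.mulVec_sub, Matrix.mulVec_add, dotProduct_sub, dotProduct_add,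
    add_dotProduct, sub_dotProduct]
  ring

theorem omegaGraph_frame (A B : R2 n →L[ℝ] R2 n × R2 n) (v w : R2 n) :
    omegaGraph n (A v) (B w)
      = 1 / 2 * ((frameX A *ᵥ v) ⬝ᵥ (frameY B *ᵥ w) - (frameY A *ᵥ v) ⬝ᵥ (frameX B *ᵥ w)) := by
  rw [omegaGraph_eq, frameX_mulVec, frameX_mulVec, frameY_mulVec, frameY_mulVec]

theorem matrix_ext_dotProduct {ι : Type*} [Fintype ι] [DecidableEq ι] {A B : Matrix ι ι ℝ}
    (h : ∀ v w : ι → ℝ, v ⬝ᵥ A *ᵥ w = v ⬝ᵥ B *ᵥ w) : A = B := by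
  ext i j
  simpa using h (Pi.single i 1) (Pi.single j 1)

theorem mulVec_dotProduct_mulVec {ι : Type*} [Fintype ι] (A B : Matrix ι ι ℝ) (v w : ι → ℝ) :
    (A *ᵥ v) ⬝ᵥ (B *ᵥ w) = v ⬝ᵥ (Aᵀ * B) *ᵥ w := by
  rw [← Matrix.mulVec_mulVec, Matrix.dotProduct_mulVec v, Matrix.vecMul_transpose]

theorem IsLagrangianFrame.isLagrangianPair {A : R2 n →L[ℝ] R2 n × R2 n}
    (h : IsLagrangianFrame (omegaGraph n) A) : IsLagrangianPair (frameX A) (frameY A) := by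
  refine ⟨matrix_ext_dotProduct fun v w => ?_, fun v hX hY => ?_⟩
  · have h1 := (h.2 (A v)).1 ⟨v, rfl⟩ (A w) ⟨w, rfl⟩
    rw [omegaGraph_frame, mulVec_dotProduct_mulVec, mulVec_dotProduct_mulVec] at h1
    linarith
  · rw [frameX_mulVec] at hX
    rw [frameY_mulVec] at hY
    have h2 := J0_mulVec_eq_zero hY
    have h3 : (A v).2 = -(A v).1 := (neg_eq_of_add_eq_zero_right hX).symm
    have h4 : (A v).1 = 0 := by
      rw [h3, sub_neg_eq_add, ← two_smul ℝ] at h2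
      exact (smul_eq_zero.1 h2).resolve_left two_ne_zero
    apply h.1
    rw [map_zero]
    exact Prod.ext h4 (by rw [h3, h4, neg_zero]; rfl)

/-- The unitary matrix attached to a Lagrangian frame. -/
def frameSouriau (A : R2 n →L[ℝ] R2 n × R2 n) : Matrix (Fin n ⊕ Fin n) (Fin n ⊕ Fin n) ℂ :=
  souriau (frameX A) (frameY A)

/-- Two injective frames with the same image differ by a linear map of the model space, and the
Souriau matrix ignores such a change. -/
theorem frameSouriau_eq_of_range_eq {A B : R2 n →L[ℝ] R2 n × R2 n}
    (hA : IsLagrangianFrame (omegaGraph n) A) (hB : IsLagrangianFrame (omegaGraph n) B)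
    (h : A.range = B.range) : frameSouriau A = frameSouriau B := by
  let e := LinearEquiv.ofInjective (A : R2 n →ₗ[ℝ] R2 n × R2 n) hA.1
  have hmem : ∀ v, B v ∈ LinearMap.range (A : R2 n →ₗ[ℝ] R2 n × R2 n) := fun v => by
    have : B v ∈ B.range := ⟨v, rfl⟩
    rwa [← h] at this
  let g : R2 n →ₗ[ℝ] R2 n :=
    e.symm.toLinearMap ∘ₗ (B : R2 n →ₗ[ℝ] R2 n × R2 n).codRestrict _ hmem
  have hg : ∀ v, A (g v) = B v := fun v => by
    have := LinearEquiv.apply_symm_apply e ⟨B v, hmem v⟩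
    exact congrArg Subtype.val this
  have hX : frameX A * LinearMap.toMatrix' g = frameX B := by
    refine matrix_ext_dotProduct fun v w => ?_
    rw [← Matrix.mulVec_mulVec, LinearMap.toMatrix'_mulVec, frameX_mulVec, frameX_mulVec, hg]
  have hY : frameY A * LinearMap.toMatrix' g = frameY B := by
    refine matrix_ext_dotProduct fun v w => ?_
    rw [← Matrix.mulVec_mulVec, LinearMap.toMatrix'_mulVec, frameY_mulVec, frameY_mulVec, hg]
  have h1 := hA.isLagrangianPair.souriau_eq_of_mul (G := LinearMap.toMatrix' g)
    (by rw [hX, hY]; exact hB.isLagrangianPair)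
  rw [hX, hY] at h1
  exact h1.symm

theorem continuous_frameX : Continuous (frameX (n := n)) := by
  refine continuous_pi fun i => continuous_pi fun j => ?_
  have h : Continuous fun A : R2 n →L[ℝ] R2 n × R2 n => A (Pi.single j 1) := by fun_prop
  exact ((continuous_apply i).comp (continuous_fst.comp h)).add
    ((continuous_apply i).comp (continuous_snd.comp h))

theorem continuous_frameY : Continuous (frameY (n := n)) := by
  refine continuous_const.matrix_mul ?_
  refine continuous_pi fun i => continuous_pi fun j => ?_
  have h : Continuous fun A : R2 n →L[ℝ] R2 n × R2 n => A (Pi.single j 1) := by fun_prop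
  exact ((continuous_apply i).comp (continuous_fst.comp h)).sub
    ((continuous_apply i).comp (continuous_snd.comp h))

theorem hasDerivWithinAt_frame_entry {A : ℝ → (R2 n →L[ℝ] R2 n × R2 n)}
    {A' : R2 n →L[ℝ] R2 n × R2 n} {s : Set ℝ} {t : ℝ} (h : HasDerivWithinAt A A' s t) (v : R2 n)
    (i : Fin n ⊕ Fin n) : HasDerivWithinAt (fun τ => (A τ v).1 i) ((A' v).1 i) s t ∧
      HasDerivWithinAt (fun τ => (A τ v).2 i) ((A' v).2 i) s t := by
  have h1 : HasDerivWithinAt (fun τ => A τ v) (A' v) s t := by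
    simpa using h.clm_apply (hasDerivWithinAt_const t s v)
  exact ⟨(((ContinuousLinearMap.proj (R := ℝ) i).comp
      (ContinuousLinearMap.fst ℝ (R2 n) (R2 n))).hasFDerivAt).comp_hasDerivWithinAt t h1,
    (((ContinuousLinearMap.proj (R := ℝ) i).comp
      (ContinuousLinearMap.snd ℝ (R2 n) (R2 n))).hasFDerivAt).comp_hasDerivWithinAt t h1⟩

theorem hasMatrixDerivWithinAt_frameX {A : ℝ → (R2 n →L[ℝ] R2 n × R2 n)}
    {A' : R2 n →L[ℝ] R2 n × R2 n} {s : Set ℝ} {t : ℝ} (h : HasDerivWithinAt A A' s t) :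
    HasMatrixDerivWithinAt (fun τ => frameX (A τ)) (frameX A') s t := fun i _ =>
  (hasDerivWithinAt_frame_entry h _ i).1.add (hasDerivWithinAt_frame_entry h _ i).2

theorem hasMatrixDerivWithinAt_frameY {A : ℝ → (R2 n →L[ℝ] R2 n × R2 n)}
    {A' : R2 n →L[ℝ] R2 n × R2 n} {s : Set ℝ} {t : ℝ} (h : HasDerivWithinAt A A' s t) :
    HasMatrixDerivWithinAt (fun τ => frameY (A τ)) (frameY A') s t :=
  HasMatrixDerivWithinAt.const_mul _ fun i _ =>
    (hasDerivWithinAt_frame_entry h _ i).1.sub (hasDerivWithinAt_frame_entry h _ i).2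

theorem crossingSpace_matGraph_one (A : R2 n →L[ℝ] R2 n × R2 n) :
    crossingSpace (matGraph 1) A = LinearMap.ker (frameY A).mulVecLin := by
  ext v
  have h : v ∈ crossingSpace (matGraph 1) A ↔ (A v).2 = (1 : Mat2 n) *ᵥ (A v).1 := Iff.rfl
  rw [h, LinearMap.mem_ker, Matrix.mulVecLin_apply, frameY_mulVec, Matrix.one_mulVec]
  constructor
  · intro h; rw [h, sub_self, Matrix.mulVec_zero]
  · intro h; exact (sub_eq_zero.1 (J0_mulVec_eq_zero h)).symm

theorem sigPos_smul {V : Type*} [AddCommGroup V] [Module ℝ V] (Q : QuadraticForm ℝ V) {c : ℝ}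
    (hc : 0 < c) : sigPos (c • Q) = sigPos Q ∧ sigNeg (c • Q) = sigNeg Q := by
  have h : QuadraticMap.Equivalent (c • Q) Q := by
    refine ⟨⟨LinearEquiv.smulOfNeZero ℝ V (Real.sqrt c) (Real.sqrt_pos.2 hc).ne', fun v => ?_⟩⟩
    change Q (Real.sqrt c • v) = _
    rw [QuadraticMap.map_smul, Real.mul_self_sqrt hc.le]
    rfl
  exact ⟨h.sigPos_eq, h.sigNeg_eq⟩

end Frames

/-! ### The crossing sum as a phase increment; homotopy invariance -/

section CrossingForms

variable {n : ℕ} {A : ℝ → (R2 n →L[ℝ] R2 n × R2 n)}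

/-- The quadratic crossing form in coordinates. -/
theorem crossingForm_toQuadraticMap (t : ℝ) :
    (crossingForm (omegaGraph n) (matGraph 1) A t).toQuadraticMap = (1 / 2 : ℝ) •
      (diagForm ((frameX (A t))ᵀ * frameY (derivWithin A (Icc 0 1) t))).restrict
        (crossingSpace (matGraph 1) (A t)) := by
  ext ⟨v, hv⟩
  have h1 : frameY (A t) *ᵥ v = 0 := by rw [crossingSpace_matGraph_one] at hv; exact hv
  change omegaGraph n (A t v) (derivWithin A (Icc 0 1) t v) = 1 / 2 * diagForm _ v
  rw [omegaGraph_frame, h1, zero_dotProduct, sub_zero, mulVec_dotProduct_mulVec, diagForm_apply]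

theorem crossingSign_eq (t : ℝ) : crossingSign (omegaGraph n) (matGraph 1) A t
    = signature ((diagForm ((frameX (A t))ᵀ * frameY (derivWithin A (Icc 0 1) t))).restrict
        (crossingSpace (matGraph 1) (A t))) := by
  rw [crossingSign, crossingForm_toQuadraticMap, (sigPos_smul _ one_half_pos).1,
    (sigPos_smul _ one_half_pos).2, signature]

/-- Differentiating the isotropy relation `XᵀY = YᵀX` gives symmetry on `Ker Y`. It is needed to
turn nondegeneracy of the bilinear form into a count of squares. -/
theorem crossingForm_symm (hf : ∀ t ∈ Icc (0 : ℝ) 1, IsLagrangianFrame (omegaGraph n) (A t))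
    {t : ℝ} (ht : t ∈ Icc (0 : ℝ) 1) (hd : DifferentiableWithinAt ℝ A (Icc 0 1) t)
    (v w : crossingSpace (matGraph 1) (A t)) :
    crossingForm (omegaGraph n) (matGraph 1) A t v w
      = crossingForm (omegaGraph n) (matGraph 1) A t w v := by
  have hX := hasMatrixDerivWithinAt_frameX hd.hasDerivWithinAt
  have hY := hasMatrixDerivWithinAt_frameY hd.hasDerivWithinAt
  set X := frameX (A t)
  set Y := frameY (A t)
  set X' := frameX (derivWithin A (Icc 0 1) t)
  set Y' := frameY (derivWithin A (Icc 0 1) t)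
  have h1 : X'ᵀ * Y + Xᵀ * Y' = Y'ᵀ * X + Yᵀ * X' :=
    (hX.transpose.mul hY).unique
      ((hY.transpose.mul hX).congr (fun τ hτ => (hf τ hτ).isLagrangianPair.isotropic)
        (hf t ht).isLagrangianPair.isotropic) (uniqueDiffOn_Icc zero_lt_one t ht)
  have hv : Y *ᵥ v = 0 := by
    have : (v : R2 n) ∈ LinearMap.ker Y.mulVecLin := crossingSpace_matGraph_one (A t) ▸ v.2
    exact this
  have hw : Y *ᵥ w = 0 := by
    have : (w : R2 n) ∈ LinearMap.ker Y.mulVecLin := crossingSpace_matGraph_one (A t) ▸ w.2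
    exact this
  have h2 : ∀ a b : crossingSpace (matGraph 1) (A t),
      crossingForm (omegaGraph n) (matGraph 1) A t a b
        = 1 / 2 * ((X *ᵥ a) ⬝ᵥ (Y' *ᵥ b) - (Y *ᵥ a) ⬝ᵥ (X' *ᵥ b)) := fun a b =>
    omegaGraph_frame _ _ _ _
  rw [h2, h2, hv, hw, zero_dotProduct, zero_dotProduct, sub_zero, sub_zero]
  have h3 := congrArg (fun M => (v : R2 n) ⬝ᵥ M *ᵥ (w : R2 n)) h1
  simp only [Matrix.add_mulVec, dotProduct_add, ← mulVec_dotProduct_mulVec, hv, hw,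
    dotProduct_zero, zero_dotProduct, zero_add, add_zero] at h3
  rw [h3, dotProduct_comm]

/-- The phase of a frame path, corrected by the spectral phase, near a regular crossing. -/
theorem IsRegularFramePath.eventually_phase
    (hA : IsRegularFramePath (omegaGraph n) (matGraph 1) A) {φ : ℝ → ℝ}
    (hφ : IsPhase (fun t => (frameSouriau (A t)).det) (Icc 0 1) φ)
    {t₀ : ℝ} (ht₀ : t₀ ∈ Icc (0 : ℝ) 1) :
    ∀ᶠ t in 𝓝[Icc 0 1] t₀, φ t - spectralPhase (frameSouriau (A t))
        = φ t₀ - spectralPhase (frameSouriau (A t₀)) + Real.pi * ((SignType.sign (t - t₀) : ℝ)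
          * (crossingSign (omegaGraph n) (matGraph 1) A t₀ : ℝ)) ∧
      (t ≠ t₀ → crossingSpace (matGraph 1) (A t) = ⊥) := by
  have hd := (hA.contDiffOn.differentiableOn one_ne_zero t₀ ht₀)
  have hreg := sigPos_add_sigNeg_of_nondegenerate (crossingForm_symm hA.frame ht₀ hd)
    (hA.regular t₀ ht₀)
  rw [crossingForm_toQuadraticMap, (sigPos_smul _ one_half_pos).1,
    (sigPos_smul _ one_half_pos).2] at hreg
  rw [crossingSign_eq]
  filter_upwards [eventually_phase_sub_spectralPhase ht₀
    (fun t ht => (hA.frame t ht).isLagrangianPair)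
    (hasMatrixDerivWithinAt_frameX hd.hasDerivWithinAt)
    (hasMatrixDerivWithinAt_frameY hd.hasDerivWithinAt)
    (hφ.continuousOn t₀ ht₀) hφ.exp_eq (crossingSpace_matGraph_one _) hreg] with t ht
  refine ⟨ht.1, fun hne => ?_⟩
  rw [crossingSpace_matGraph_one, eq_bot_iff]
  exact fun v hv => ht.2 hne v hv

theorem crossingSign_of_crossingSpace_eq_bot {t : ℝ}
    (h : crossingSpace (matGraph 1) (A t) = ⊥) :
    crossingSign (omegaGraph n) (matGraph 1) A t = 0 := by
  have h1 := sigPos_add_sigNeg_le (crossingForm (omegaGraph n) (matGraph 1) A t).toQuadraticMap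
  have h2 : Module.finrank ℝ (crossingSpace (matGraph 1) (A t)) = 0 :=
    Submodule.finrank_eq_zero.2 h
  rw [crossingSign]
  omega

/-- The sum over the crossings is the total increment of the phase corrected by the spectral
phase. -/
theorem IsRegularFramePath.two_pi_mul_crossingSum
    (hA : IsRegularFramePath (omegaGraph n) (matGraph 1) A) {φ : ℝ → ℝ}
    (hφ : IsPhase (fun t => (frameSouriau (A t)).det) (Icc 0 1) φ) :
    2 * Real.pi * crossingSum (omegaGraph n) (matGraph 1) A
      = (φ 1 - spectralPhase (frameSouriau (A 1))) - (φ 0 - spectralPhase (frameSouriau (A 0))) := by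
  have h := sub_eq_sum_of_jumps
    (f := fun t => (φ t - spectralPhase (frameSouriau (A t))) / Real.pi)
    (σ := fun t => (crossingSign (omegaGraph n) (matGraph 1) A t : ℝ)) (fun t₀ ht₀ => by
      filter_upwards [hA.eventually_phase hφ ht₀] with t ht
      refine ⟨?_, fun hne => ?_⟩
      · rw [ht.1]
        have := Real.pi_ne_zero
        field_simp
      · rw [crossingSign_of_crossingSpace_eq_bot (ht.2 hne)]; simp)
  have hpi := Real.pi_ne_zero
  rw [crossingSum]
  have h2 : (φ 1 - spectralPhase (frameSouriau (A 1))) - (φ 0 - spectralPhase (frameSouriau (A 0)))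
      = Real.pi * ((φ 1 - spectralPhase (frameSouriau (A 1))) / Real.pi
        - (φ 0 - spectralPhase (frameSouriau (A 0))) / Real.pi) := by
    field_simp
  rw [h2, h]
  ring

theorem det_frameSouriau (B : R2 n →L[ℝ] R2 n × R2 n) : (frameSouriau B).det
    = (complexFrame (frameX B) (frameY B)).det
      / (starRingEnd ℂ) (complexFrame (frameX B) (frameY B)).det := det_souriau _ _

theorem continuous_det_frame : Continuous fun B : R2 n →L[ℝ] R2 n × R2 n =>
    (complexFrame (frameX B) (frameY B)).det :=
  continuous_det_complexFrame.comp (continuous_frameX.prodMk continuous_frameY)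

theorem exists_isPhase_frames {F : ℝ × ℝ → (R2 n →L[ℝ] R2 n × R2 n)}
    (hF : ContinuousOn F (Icc 0 1 ×ˢ Icc 0 1))
    (hL : ∀ p ∈ Icc (0 : ℝ) 1 ×ˢ Icc (0 : ℝ) 1, IsLagrangianFrame (omegaGraph n) (F p)) :
    ∃ φ, IsPhase (fun p => (frameSouriau (F p)).det) (Icc (0 : ℝ) 1 ×ˢ Icc (0 : ℝ) 1) φ := by
  obtain ⟨φ, hφ⟩ := exists_isPhase_square
    (u := fun p => (complexFrame (frameX (F p)) (frameY (F p))).det)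
    (continuous_det_frame.comp_continuousOn hF)
    (fun p hp => (hL p hp).isLagrangianPair.det_complexFrame_ne_zero)
  exact ⟨φ, hφ.congr fun p _ => (det_frameSouriau _).symm⟩

/-- Homotopic paths of Lagrangian subspaces have the same phase increment. -/
theorem LagrangianHomotopic.phase_sub_eq {α β : ℝ → Submodule ℝ (R2 n × R2 n)}
    (h : LagrangianHomotopic (R2 n) (omegaGraph n) α β)
    {A B : ℝ → (R2 n →L[ℝ] R2 n × R2 n)}
    (hA : ∀ t ∈ Icc (0 : ℝ) 1, IsLagrangianFrame (omegaGraph n) (A t))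
    (hB : ∀ t ∈ Icc (0 : ℝ) 1, IsLagrangianFrame (omegaGraph n) (B t))
    (hAα : ∀ t ∈ Icc (0 : ℝ) 1, (A t).range = α t) (hBβ : ∀ t ∈ Icc (0 : ℝ) 1, (B t).range = β t)
    {φ ψ : ℝ → ℝ} (hφ : IsPhase (fun t => (frameSouriau (A t)).det) (Icc 0 1) φ)
    (hψ : IsPhase (fun t => (frameSouriau (B t)).det) (Icc 0 1) ψ) :
    φ 1 - φ 0 = ψ 1 - ψ 0 := by
  obtain ⟨F, hFc, hFL, hF0, hF1, hFa, hFb⟩ := h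
  obtain ⟨θ, hθ⟩ := exists_isPhase_frames hFc fun p hp => hFL p.1 hp.1 p.2 hp.2
  have m0 : (0 : ℝ) ∈ Icc (0 : ℝ) 1 := by simp
  have m1 : (1 : ℝ) ∈ Icc (0 : ℝ) 1 := by simp
  have e1 : φ 1 - φ 0 = θ (0, 1) - θ (0, 0) :=
    hφ.sub_eq ((hθ.comp (g := fun t => ((0 : ℝ), t)) (by fun_prop) fun t ht => ⟨m0, ht⟩).congr
      fun t ht => by
        rw [frameSouriau_eq_of_range_eq (hFL 0 m0 t ht) (hA t ht) (by rw [hF0 t ht, hAα t ht])])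
  have e2 : ψ 1 - ψ 0 = θ (1, 1) - θ (1, 0) :=
    hψ.sub_eq ((hθ.comp (g := fun t => ((1 : ℝ), t)) (by fun_prop) fun t ht => ⟨m1, ht⟩).congr
      fun t ht => by
        rw [frameSouriau_eq_of_range_eq (hFL 1 m1 t ht) (hB t ht) (by rw [hF1 t ht, hBβ t ht])])
  -- On these two edges of the square the frame may move but its image does not, so the Souriau
  -- matrix, and with it the phase, is constant.
  have e3 : ∀ t ∈ Icc (0 : ℝ) 1, (∀ s ∈ Icc (0 : ℝ) 1, (F (s, t)).range = α t) →
      θ (1, t) - θ (0, t) = 0 := by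
    intro t ht hconst
    have h1 : IsPhase (fun _ => (frameSouriau (F (0, t))).det) (Icc 0 1) (fun s => θ (s, t)) :=
      (hθ.comp (g := fun s : ℝ => (s, t)) (by fun_prop) fun s hs => ⟨hs, ht⟩).congr fun s hs => by
        rw [frameSouriau_eq_of_range_eq (hFL s hs t ht) (hFL 0 m0 t ht)
          (by rw [hconst s hs, hconst 0 m0])]
    have h2 : IsPhase (fun _ : ℝ => (frameSouriau (F (0, t))).det) (Icc 0 1)
        (fun _ => θ (0, t)) := ⟨continuousOn_const, fun _ _ => hθ.exp_eq (0, t) ⟨m0, ht⟩⟩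
    simpa using h1.sub_eq h2
  have e4 := e3 0 m0 hFa
  have e5 := e3 1 m1 hFb
  linarith

end CrossingForms

/-! ### Graphs of symplectic matrices and their rotation -/

section Graphs

variable {n : ℕ}

/-- The frame `v ↦ (v, M v)` of the graph of a matrix. -/
def graphFrame (M : Mat2 n) : R2 n →L[ℝ] R2 n × R2 n :=
  ContinuousLinearMap.inl ℝ (R2 n) (R2 n) + ∑ i, ∑ j, M i j •
    (ContinuousLinearMap.inr ℝ (R2 n) (R2 n)).comp
      ((ContinuousLinearMap.single ℝ (fun _ => ℝ) i).comp (ContinuousLinearMap.proj j))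

theorem sum_smul_single_mulVec (M : Mat2 n) (v : R2 n) :
    (∑ i, ∑ j, M i j • (ContinuousLinearMap.inr ℝ (R2 n) (R2 n)).comp
      ((ContinuousLinearMap.single ℝ (fun _ => ℝ) i).comp (ContinuousLinearMap.proj j))) v
      = ((0 : R2 n), M *ᵥ v) := by
  refine Prod.ext ?_ (funext fun k => ?_)
  · simp [Prod.fst_sum, -Fintype.sum_sum_type]
  · simp only [Prod.snd_sum, Finset.sum_apply, sum_apply, smul_apply,
      Prod.smul_snd, Pi.smul_apply, ContinuousLinearMap.comp_apply, ContinuousLinearMap.inr_apply,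
      ContinuousLinearMap.single_apply, ContinuousLinearMap.proj_apply, Pi.single_apply,
      smul_eq_mul, mul_ite, mul_zero]
    rw [Finset.sum_comm]
    simp only [Finset.sum_ite_eq, Finset.mem_univ, if_true]
    rfl

theorem graphFrame_apply (M : Mat2 n) (v : R2 n) : graphFrame M v = (v, M *ᵥ v) := by
  rw [graphFrame, add_apply, sum_smul_single_mulVec]
  simp

theorem range_graphFrame (M : Mat2 n) : (graphFrame M).range = matGraph M := by
  ext ⟨a, b⟩
  have h : (a, b) ∈ matGraph M ↔ b = M *ᵥ a := Iff.rfl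
  rw [h]
  constructor
  · rintro ⟨v, hv⟩
    have hv' : graphFrame M v = (a, b) := hv
    rw [graphFrame_apply, Prod.mk.injEq] at hv'
    rw [← hv'.1, ← hv'.2]
  · rintro rfl
    exact ⟨a, graphFrame_apply M a⟩

theorem hasDerivWithinAt_graphFrame {M : ℝ → Mat2 n} {M' : Mat2 n} {s : Set ℝ} {t : ℝ}
    (h : HasMatrixDerivWithinAt M M' s t) :
    ∃ A' : R2 n →L[ℝ] R2 n × R2 n, HasDerivWithinAt (fun τ => graphFrame (M τ)) A' s t ∧
      ∀ v, A' v = ((0 : R2 n), M' *ᵥ v) := by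
  refine ⟨_, (HasDerivWithinAt.fun_sum fun i _ => HasDerivWithinAt.fun_sum fun j _ =>
    (h i j).smul_const _).const_add _, fun v => sum_smul_single_mulVec M' v⟩

theorem contDiffOn_graphFrame {M : ℝ → Mat2 n} {s : Set ℝ}
    (h : ∀ i j, ContDiffOn ℝ 1 (fun t => M t i j) s) :
    ContDiffOn ℝ 1 (fun t => graphFrame (M t)) s :=
  contDiffOn_const.add (ContDiffOn.sum fun i _ => ContDiffOn.sum fun j _ =>
    (h i j).smul contDiffOn_const)

theorem continuous_graphFrame : Continuous (graphFrame (n := n)) := by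
  refine continuous_const.add (continuous_finsetSum _ fun i _ => continuous_finsetSum _ fun j _ => ?_)
  exact (continuous_id.matrix_elem i j).smul continuous_const

theorem frameX_graphFrame (M : Mat2 n) : frameX (graphFrame M) = 1 + M := by
  refine matrix_ext_dotProduct fun v w => ?_
  rw [frameX_mulVec, graphFrame_apply, Matrix.add_mulVec, Matrix.one_mulVec]

theorem frameY_graphFrame (M : Mat2 n) : frameY (graphFrame M) = J0 n * (1 - M) := by
  refine matrix_ext_dotProduct fun v w => ?_
  rw [frameY_mulVec, graphFrame_apply, ← Matrix.mulVec_mulVec, Matrix.sub_mulVec, Matrix.one_mulVec]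

/-- The unitary matrix attached to the graph of a matrix. -/
def graphSouriau (M : Mat2 n) : Matrix (Fin n ⊕ Fin n) (Fin n ⊕ Fin n) ℂ :=
  frameSouriau (graphFrame M)

/-- The eigenspace of a matrix for the eigenvalue `1`. -/
def fixedSpace (M : Mat2 n) : Submodule ℝ (R2 n) := LinearMap.ker (Matrix.mulVecLin (M - 1))

theorem mem_fixedSpace {M : Mat2 n} {v : R2 n} : v ∈ fixedSpace M ↔ M *ᵥ v = v := by
  rw [fixedSpace, LinearMap.mem_ker, Matrix.mulVecLin_apply, Matrix.sub_mulVec, Matrix.one_mulVec,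
    sub_eq_zero]

theorem crossingSpace_graphFrame (M : Mat2 n) :
    crossingSpace (matGraph 1) (graphFrame M) = fixedSpace M := by
  ext v
  have h : v ∈ crossingSpace (matGraph 1) (graphFrame M)
      ↔ (graphFrame M v).2 = (1 : Mat2 n) *ᵥ (graphFrame M v).1 := Iff.rfl
  rw [h, graphFrame_apply, Matrix.one_mulVec, mem_fixedSpace]

theorem symplectic_transpose_mul {M : Mat2 n} (hM : M ∈ Matrix.symplecticGroup (Fin n) ℝ) :
    Mᵀ * J0 n * M = J0 n := SymplecticGroup.mem_iff'.1 hM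

theorem symplectic_dotProduct {M : Mat2 n} (hM : M ∈ Matrix.symplecticGroup (Fin n) ℝ)
    (v w : R2 n) : (M *ᵥ v) ⬝ᵥ J0 n *ᵥ (M *ᵥ w) = v ⬝ᵥ J0 n *ᵥ w := by
  rw [Matrix.mulVec_mulVec, mulVec_dotProduct_mulVec, ← mul_assoc, symplectic_transpose_mul hM]

theorem omegaGraph_apply (z w : R2 n × R2 n) :
    omegaGraph n z w = z.1 ⬝ᵥ J0 n *ᵥ w.1 - z.2 ⬝ᵥ J0 n *ᵥ w.2 := by
  have h : omegaGraph n z w = omega0 n z.2 w.2 - omega0 n z.1 w.1 := rfl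
  rw [h, omega0_eq, omega0_eq]
  ring

theorem isLagrangianFrame_graphFrame {M : Mat2 n} (hM : M ∈ Matrix.symplecticGroup (Fin n) ℝ) :
    IsLagrangianFrame (omegaGraph n) (graphFrame M) := by
  refine ⟨fun v w h => ?_, ?_⟩
  · rw [graphFrame_apply, graphFrame_apply, Prod.mk.injEq] at h
    exact h.1
  · rw [range_graphFrame]
    rintro ⟨a, b⟩
    have hmem : ∀ a b : R2 n, (a, b) ∈ matGraph M ↔ b = M *ᵥ a := fun _ _ => Iff.rfl
    rw [hmem]
    constructor
    · rintro rfl ⟨c, d⟩ hcd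
      rw [hmem] at hcd
      rw [omegaGraph_apply, hcd, symplectic_dotProduct hM, sub_self]
    · intro h
      have h1 : ∀ c, (b - M *ᵥ a) ⬝ᵥ J0 n *ᵥ (M *ᵥ c) = 0 := fun c => by
        have h2 := h (c, M *ᵥ c) rfl
        rw [omegaGraph_apply] at h2
        rw [sub_dotProduct, symplectic_dotProduct hM]
        linarith
      -- This supplies the test vector whose image under `J₀ M` is minus the defect `b - M a`, so
      -- pairing gives the square norm of the defect.
      have h3 : ∀ x, J0 n *ᵥ (M *ᵥ (J0 n *ᵥ (Mᵀ *ᵥ x))) = -x := fun x => by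
        have h4 := SymplecticGroup.mem_iff.1 hM
        rw [Matrix.mulVec_mulVec, Matrix.mulVec_mulVec, Matrix.mulVec_mulVec,
          show J0 n * M * J0 n * Mᵀ = -1 by
            rw [mul_assoc (J0 n) M, mul_assoc, h4, J0_mul_J0],
          Matrix.neg_mulVec, Matrix.one_mulVec]
      have h5 := h1 (J0 n *ᵥ (Mᵀ *ᵥ (b - M *ᵥ a)))
      rw [h3, dotProduct_neg, neg_eq_zero, dotProduct_self_eq_zero, sub_eq_zero] at h5
      exact h5

/-- The crossing form of a path of graphs. -/
theorem crossingForm_graphFrame {M : ℝ → Mat2 n} {M' : Mat2 n} {t : ℝ}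
    (ht : t ∈ Icc (0 : ℝ) 1) (h : HasMatrixDerivWithinAt M M' (Icc 0 1) t)
    (v w : crossingSpace (matGraph 1) (graphFrame (M t))) :
    crossingForm (omegaGraph n) (matGraph 1) (fun τ => graphFrame (M τ)) t v w
      = -((v : R2 n) ⬝ᵥ J0 n *ᵥ (M' *ᵥ (w : R2 n))) := by
  obtain ⟨A', hA', hA'v⟩ := hasDerivWithinAt_graphFrame h
  have h1 : crossingForm (omegaGraph n) (matGraph 1) (fun τ => graphFrame (M τ)) t v w
      = omegaGraph n (graphFrame (M t) v)
        (derivWithin (fun τ => graphFrame (M τ)) (Icc 0 1) t w) := rfl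
  have h2 : M t *ᵥ (v : R2 n) = v := by
    have : (v : R2 n) ∈ fixedSpace (M t) := crossingSpace_graphFrame (M t) ▸ v.2
    exact mem_fixedSpace.1 this
  rw [h1, hA'.derivWithin (uniqueDiffOn_Icc zero_lt_one t ht), hA'v, graphFrame_apply, h2,
    omegaGraph_apply]
  simp

/-- The rotation `exp (θ J₀)`. -/
def rot (n : ℕ) (θ : ℝ) : Mat2 n := Real.cos θ • 1 + Real.sin θ • J0 n

theorem rot_zero : rot n 0 = 1 := by simp [rot]

theorem rot_transpose (θ : ℝ) : (rot n θ)ᵀ = Real.cos θ • 1 - Real.sin θ • J0 n := by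
  simp [rot, sub_eq_add_neg]

theorem rot_mul_transpose (θ : ℝ) : rot n θ * (rot n θ)ᵀ = 1 := by
  rw [rot_transpose, rot]
  simp only [add_mul, mul_sub, smul_mul_smul_comm, mul_one, one_mul, J0_mul_J0, smul_neg]
  calc _ = (Real.cos θ ^ 2 + Real.sin θ ^ 2) • (1 : Mat2 n) := by module
    _ = 1 := by rw [Real.cos_sq_add_sin_sq, one_smul]

theorem rot_transpose_mul (θ : ℝ) : (rot n θ)ᵀ * rot n θ = 1 :=
  mul_eq_one_comm.1 (rot_mul_transpose θ)

theorem J0_mul_rot (θ : ℝ) : J0 n * rot n θ = rot n θ * J0 n := by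
  simp [rot, mul_add, add_mul]

theorem rot_mem_symplecticGroup (θ : ℝ) : rot n θ ∈ Matrix.symplecticGroup (Fin n) ℝ := by
  rw [SymplecticGroup.mem_iff]
  change rot n θ * J0 n * (rot n θ)ᵀ = J0 n
  rw [← J0_mul_rot, mul_assoc, rot_mul_transpose, mul_one]

theorem hasMatrixDerivWithinAt_rot {κ : ℝ → ℝ} {κ' : ℝ} {s : Set ℝ} {t : ℝ}
    (h : HasDerivWithinAt κ κ' s t) :
    HasMatrixDerivWithinAt (fun τ => rot n (κ τ)) (κ' • (J0 n * rot n (κ t))) s t := by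
  have h1 := (HasMatrixDerivWithinAt.smul h.cos (.const (1 : Mat2 n))).add
    (HasMatrixDerivWithinAt.smul h.sin (.const (J0 n)))
  have e : κ' • (J0 n * rot n (κ t)) = (-Real.sin (κ t) * κ') • (1 : Mat2 n) + Real.cos (κ t) • 0
      + ((Real.cos (κ t) * κ') • J0 n + Real.sin (κ t) • 0) := by
    simp only [rot, mul_add, mul_smul_comm, mul_one, J0_mul_J0, smul_zero]
    module
  rw [e]
  exact h1

/-- The path of graphs rotated by `exp (κ J₀)` on both sides. -/
def rotated (M : Mat2 n) (θ : ℝ) : Mat2 n := rot n θ * M * rot n θ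

theorem rotated_zero (M : Mat2 n) : rotated M 0 = M := by simp [rotated, rot_zero]

theorem rotated_mem_symplecticGroup {M : Mat2 n} (hM : M ∈ Matrix.symplecticGroup (Fin n) ℝ)
    (θ : ℝ) : rotated M θ ∈ Matrix.symplecticGroup (Fin n) ℝ :=
  mul_mem (mul_mem (rot_mem_symplecticGroup θ) hM) (rot_mem_symplecticGroup θ)

theorem hasMatrixDerivWithinAt_rotated {M : ℝ → Mat2 n} {M' : Mat2 n} {κ : ℝ → ℝ} {κ' : ℝ}
    {s : Set ℝ} {t : ℝ} (hM : HasMatrixDerivWithinAt M M' s t) (hκ : HasDerivWithinAt κ κ' s t) :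
    HasMatrixDerivWithinAt (fun τ => rotated (M τ) (κ τ))
      (κ' • (J0 n * rotated (M t) (κ t) + rotated (M t) (κ t) * J0 n)
        + rotated M' (κ t)) s t := by
  have hr := hasMatrixDerivWithinAt_rot (n := n) hκ
  have h := (hr.mul hM).mul hr
  have e : κ' • (J0 n * rotated (M t) (κ t) + rotated (M t) (κ t) * J0 n) + rotated M' (κ t)
      = (κ' • (J0 n * rot n (κ t)) * M t + rot n (κ t) * M') * rot n (κ t)
        + rot n (κ t) * M t * κ' • (J0 n * rot n (κ t)) := by
    simp only [rotated, J0_mul_rot, smul_mul_assoc, mul_smul_comm, add_mul, smul_add, mul_assoc]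
    simp only [← mul_assoc, J0_mul_rot]
    abel
  rw [e]
  exact h

/-- The crossing form of a rotated path `exp (κ J₀) M exp (κ J₀)`, where `M' = J₀ S M`. -/
theorem rotated_crossing {M S : Mat2 n} (hM : M ∈ Matrix.symplecticGroup (Fin n) ℝ) (θ κ' σ' : ℝ)
    {v w : R2 n} (hv : v ∈ fixedSpace (rotated M θ)) (hw : w ∈ fixedSpace (rotated M θ)) :
    -(v ⬝ᵥ J0 n *ᵥ ((κ' • (J0 n * rotated M θ + rotated M θ * J0 n)
        + rotated (σ' • (J0 n * S * M)) θ) *ᵥ w))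
      = 2 * κ' * (v ⬝ᵥ w) + σ' * (((rot n θ)ᵀ *ᵥ v) ⬝ᵥ (S *ᵥ ((rot n θ)ᵀ *ᵥ w))) := by
  rw [mem_fixedSpace] at hv hw
  have h1 : v ⬝ᵥ J0 n *ᵥ (J0 n *ᵥ (rotated M θ *ᵥ w)) = -(v ⬝ᵥ w) := by
    rw [J0_mulVec_J0_mulVec, hw, dotProduct_neg]
  have h2 : v ⬝ᵥ J0 n *ᵥ (rotated M θ *ᵥ (J0 n *ᵥ w)) = -(v ⬝ᵥ w) := by
    nth_rw 1 [← hv]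
    rw [symplectic_dotProduct (rotated_mem_symplecticGroup hM θ), J0_mulVec_J0_mulVec,
      dotProduct_neg]
  -- Since `w` is fixed by `R M R` and `R` is orthogonal, `M R w = Rᵀ w`.
  have h3 : M *ᵥ (rot n θ *ᵥ w) = (rot n θ)ᵀ *ᵥ w := by
    nth_rw 2 [← hw]
    rw [rotated, Matrix.mulVec_mulVec, Matrix.mulVec_mulVec, mul_assoc, ← mul_assoc (rot n θ)ᵀ,
      rot_transpose_mul, one_mul]
  have h4 : v ⬝ᵥ J0 n *ᵥ (rotated (J0 n * S * M) θ *ᵥ w)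
      = -(((rot n θ)ᵀ *ᵥ v) ⬝ᵥ (S *ᵥ ((rot n θ)ᵀ *ᵥ w))) := by
    have e : J0 n *ᵥ (rotated (J0 n * S * M) θ *ᵥ w) = -(rot n θ *ᵥ (S *ᵥ ((rot n θ)ᵀ *ᵥ w))) := by
      rw [← h3]
      simp only [rotated, Matrix.mulVec_mulVec, ← mul_assoc, J0_mul_rot]
      simp only [mul_assoc (rot n θ) (J0 n) (J0 n), J0_mul_J0]
      simp [Matrix.neg_mulVec]
    rw [e, dotProduct_neg, Matrix.dotProduct_mulVec, ← Matrix.mulVec_transpose]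
  have e1 : rotated (σ' • (J0 n * S * M)) θ = σ' • rotated (J0 n * S * M) θ := by
    simp [rotated]
  rw [e1]
  simp only [Matrix.add_mulVec, Matrix.smul_mulVec, Matrix.mulVec_add, Matrix.mulVec_smul,
    dotProduct_add, dotProduct_smul, smul_eq_mul, ← Matrix.mulVec_mulVec _ (J0 n) (rotated M θ),
    ← Matrix.mulVec_mulVec _ (rotated M θ) (J0 n), h1, h2, h4]
  ring

theorem rot_transpose_dotProduct (θ : ℝ) (v : R2 n) :
    ((rot n θ)ᵀ *ᵥ v) ⬝ᵥ ((rot n θ)ᵀ *ᵥ v) = v ⬝ᵥ v := by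
  rw [mulVec_dotProduct_mulVec, Matrix.transpose_transpose, rot_mul_transpose, Matrix.one_mulVec]

theorem complexFrame_rotate {ι : Type*} (X Y : Matrix ι ι ℝ) (θ : ℝ) :
    complexFrame (Real.cos θ • X - Real.sin θ • Y) (Real.sin θ • X + Real.cos θ • Y)
      = Complex.exp (θ * Complex.I) • complexFrame X Y := by
  ext i j
  simp only [complexFrame, Complex.exp_mul_I, Matrix.add_apply, Matrix.smul_apply, Matrix.map_apply,
    Matrix.sub_apply, smul_eq_mul]
  simp only [Complex.ofRealHom_eq_coe]
  push_cast
  linear_combination (-Complex.sin θ * (Y i j : ℂ)) * Complex.I_mul_I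

/-- Up to a real factor on the right, which cancels in the Souriau matrix, rotation on both sides
multiplies the complex frame by `exp(iθ)`. The determinant has size `2n` and is divided by its
conjugate, giving the exponent `2 · 2n · θ`. -/
theorem det_graphSouriau_rotated {M : Mat2 n} (hM : M ∈ Matrix.symplecticGroup (Fin n) ℝ) (θ : ℝ) :
    (graphSouriau (rotated M θ)).det
      = Complex.exp ((2 * (2 * n) * θ : ℝ) * Complex.I) * (graphSouriau M).det := by
  have h1 : complexFrame (frameX (graphFrame (rotated M θ))) (frameY (graphFrame (rotated M θ)))
      = (Complex.exp (θ * Complex.I) • complexFrame (frameX (graphFrame M))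
        (frameY (graphFrame M))) * (rot n θ).map Complex.ofRealHom := by
    rw [← complexFrame_rotate, ← complexFrame_mul]
    simp only [frameX_graphFrame, frameY_graphFrame]
    have e1 : (1 : Mat2 n) + rotated M θ = ((rot n θ)ᵀ + rot n θ * M) * rot n θ := by
      rw [rotated, add_mul, rot_transpose_mul]
    have e2 : (1 : Mat2 n) - rotated M θ = ((rot n θ)ᵀ - rot n θ * M) * rot n θ := by
      rw [rotated, sub_mul, rot_transpose_mul]
    rw [e1, e2, ← mul_assoc (J0 n), rot_transpose]
    congr 2
    · simp only [rot, add_mul, smul_mul_assoc, one_mul, mul_sub, mul_one]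
      module
    · simp only [rot, add_mul, smul_mul_assoc, one_mul, mul_sub, mul_one, mul_add, mul_smul_comm,
        ← mul_assoc, J0_mul_J0, neg_mul]
      module
  have h2 : ((rot n θ).map Complex.ofRealHom).det = ((rot n θ).det : ℂ) :=
    (RingHom.map_det _ _).symm
  have h3 : (rot n θ).det ≠ 0 := by
    intro h
    have := congrArg Matrix.det (rot_mul_transpose (n := n) θ)
    simp [h] at this
  have h4 : ((rot n θ).det : ℂ) ≠ 0 := by exact_mod_cast h3
  have h5 : (starRingEnd ℂ) (Complex.exp (θ * Complex.I)) = (Complex.exp (θ * Complex.I))⁻¹ := by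
    rw [← Complex.exp_neg, ← Complex.exp_conj]
    simp
  have h6 := (isLagrangianFrame_graphFrame hM).isLagrangianPair.det_complexFrame_ne_zero
  rw [graphSouriau, graphSouriau, det_frameSouriau, det_frameSouriau, h1, Matrix.det_mul,
    Matrix.det_smul, h2]
  simp only [map_mul, map_pow, Complex.conj_ofReal, h5]
  have h7 : Complex.exp ((2 * (2 * n) * θ : ℝ) * Complex.I)
      = Complex.exp (θ * Complex.I) ^ Fintype.card (Fin n ⊕ Fin n)
        * Complex.exp (θ * Complex.I) ^ Fintype.card (Fin n ⊕ Fin n) := by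
    rw [← pow_add, ← Complex.exp_nat_mul]
    congr 1
    simp
    ring
  rw [h7, inv_pow]
  have h8 : Complex.exp (θ * Complex.I) ≠ 0 := Complex.exp_ne_zero _
  have h9 : (starRingEnd ℂ) (complexFrame (frameX (graphFrame M)) (frameY (graphFrame M))).det ≠ 0 :=
    by simpa using h6
  field_simp

end Graphs

/-! ### Pushing Hamiltonian paths off the diagonal by rotation -/

section RotatedPaths

variable {n : ℕ}

theorem sigPos_eq_finrank_of_posDef {V : Type*} [AddCommGroup V] [Module ℝ V]
    [FiniteDimensional ℝ V] {Q : QuadraticForm ℝ V} (hQ : Q.PosDef) :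
    sigPos Q = Module.finrank ℝ V := by
  refine le_antisymm (sigPos_le_finrank Q) ?_
  have h : (Q.restrict ⊤).PosDef := fun v hv => hQ v (by simpa using hv)
  simpa using le_sigPos_of_posDef Q h

theorem sigNeg_eq_zero_of_nonneg {V : Type*} [AddCommGroup V] [Module ℝ V]
    [FiniteDimensional ℝ V] {Q : QuadraticForm ℝ V} (hQ : ∀ v, 0 ≤ Q v) : sigNeg Q = 0 := by
  obtain ⟨P, hP, hpos⟩ := exists_finrank_eq_sigPos_and_posDef (-Q)
  rw [sigPos_neg] at hP
  rw [← hP, Submodule.finrank_eq_zero, eq_bot_iff]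
  intro v hv
  by_contra h0
  have h1 := hpos ⟨v, hv⟩ (fun h => h0 (congrArg Subtype.val h))
  have h2 : 0 < -Q v := h1
  linarith [hQ v]

theorem nondegenerate_of_ne_zero {V : Type*} [AddCommGroup V] [Module ℝ V]
    {B : LinearMap.BilinForm ℝ V} (hB : ∀ v, v ≠ 0 → B v v ≠ 0) : B.Nondegenerate := by
  constructor
  · intro v hv
    by_contra h0
    exact hB v h0 (hv v)
  · intro v hv
    by_contra h0
    exact hB v h0 (hv v)

theorem dotProduct_self_pos {ι : Type*} [Fintype ι] {v : ι → ℝ} (hv : v ≠ 0) : 0 < v ⬝ᵥ v := by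
  refine lt_of_le_of_ne (Finset.sum_nonneg fun i _ => mul_self_nonneg (v i)) fun h => ?_
  exact hv (dotProduct_self_eq_zero.1 h.symm)

/-- The phase of a rotated symplectic matrix, corrected by the spectral phase, jumps by `π` times
the dimension of the fixed space. -/
theorem rotation_jump {M : Mat2 n} (hM : M ∈ Matrix.symplecticGroup (Fin n) ℝ) {a : ℝ}
    (ha : Complex.exp (a * Complex.I) = (graphSouriau M).det) (θ₀ : ℝ) :
    ∀ᶠ θ in 𝓝 θ₀, a + 2 * (2 * n) * θ - spectralPhase (graphSouriau (rotated M θ))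
        = a + 2 * (2 * n) * θ₀ - spectralPhase (graphSouriau (rotated M θ₀))
          + Real.pi * ((SignType.sign (θ - θ₀) : ℝ)
            * (Module.finrank ℝ (fixedSpace (rotated M θ₀)) : ℝ)) ∧
      (θ ≠ θ₀ → fixedSpace (rotated M θ) = ⊥) := by
  have hN : ∀ θ, rotated M θ ∈ Matrix.symplecticGroup (Fin n) ℝ := rotated_mem_symplecticGroup hM
  -- The redundant zero summand puts the derivative in the shape of `rotated_crossing` with `S = 0`
  -- and unit speed, where the crossing form is `2 |v|²`.
  set N' : Mat2 n := (1 : ℝ) • (J0 n * rotated M θ₀ + rotated M θ₀ * J0 n)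
    + rotated ((0 : ℝ) • (J0 n * (0 : Mat2 n) * M)) θ₀ with hN'
  have hd : HasMatrixDerivWithinAt (fun θ => rotated M θ) N' univ θ₀ := by
    have := hasMatrixDerivWithinAt_rotated (.const M) (hasDerivWithinAt_id θ₀ univ)
    simpa [N'] using this
  have hX : HasMatrixDerivWithinAt (fun θ => (1 : Mat2 n) + rotated M θ) (0 + N') univ θ₀ :=
    (HasMatrixDerivWithinAt.const 1).add hd
  have hY : HasMatrixDerivWithinAt (fun θ => J0 n * (1 - rotated M θ)) (J0 n * (0 - N')) univ θ₀ :=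
    ((HasMatrixDerivWithinAt.const 1).sub hd).const_mul _
  have hK : fixedSpace (rotated M θ₀) = LinearMap.ker (J0 n * (1 - rotated M θ₀)).mulVecLin := by
    rw [← crossingSpace_graphFrame, crossingSpace_matGraph_one, frameY_graphFrame]
  have hpos : ((diagForm (((1 : Mat2 n) + rotated M θ₀)ᵀ * (J0 n * (0 - N')))).restrict
      (fixedSpace (rotated M θ₀))).PosDef := by
    rintro ⟨v, hv⟩ h0
    have hv0 : v ≠ 0 := fun h => h0 (Subtype.ext h)
    have h1 := rotated_crossing (S := 0) hM θ₀ 1 0 hv hv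
    rw [← hN'] at h1
    rw [QuadraticMap.restrict_apply, diagForm_apply, ← mulVec_dotProduct_mulVec, Matrix.add_mulVec,
      Matrix.one_mulVec, mem_fixedSpace.1 hv, zero_sub, mul_neg, Matrix.neg_mulVec,
      ← Matrix.mulVec_mulVec, add_dotProduct, dotProduct_neg, h1]
    have := dotProduct_self_pos hv0
    linarith
  have h1 := sigPos_eq_finrank_of_posDef hpos
  have h2 := sigNeg_eq_zero_of_nonneg fun v => hpos.nonneg v
  have hmain := eventually_phase_sub_spectralPhase (mem_univ θ₀)
    (X := fun θ => (1 : Mat2 n) + rotated M θ) (Y := fun θ => J0 n * (1 - rotated M θ))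
    (fun θ _ => by
      rw [← frameX_graphFrame, ← frameY_graphFrame]
      exact (isLagrangianFrame_graphFrame (hN θ)).isLagrangianPair) hX hY
    (φ := fun θ => a + 2 * (2 * n) * θ) (by fun_prop)
    (fun θ _ => by
      rw [← frameX_graphFrame, ← frameY_graphFrame]
      refine Eq.trans ?_ (det_graphSouriau_rotated hM θ).symm
      rw [← ha, ← Complex.exp_add]
      congr 1
      push_cast
      ring) hK (by rw [h1, h2, add_zero])
  rw [nhdsWithin_univ] at hmain
  filter_upwards [hmain] with θ hθ
  simp only [← frameX_graphFrame, ← frameY_graphFrame] at hθ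
  refine ⟨?_, fun hne => ?_⟩
  · have h3 := hθ.1
    simp only [frameX_graphFrame, frameY_graphFrame, signature, h1, h2] at h3
    simp only [graphSouriau, frameSouriau, frameX_graphFrame, frameY_graphFrame]
    simpa using h3
  · rw [← crossingSpace_graphFrame, crossingSpace_matGraph_one, eq_bot_iff]
    exact fun v hv => hθ.2 hne v hv

theorem contDiffOn_entry {N N' : ℝ → Mat2 n}
    (h : ∀ t ∈ Icc (0 : ℝ) 1, HasMatrixDerivWithinAt N (N' t) (Icc 0 1) t)
    (hc : ContinuousOn N' (Icc 0 1)) (i j : Fin n ⊕ Fin n) :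
    ContDiffOn ℝ 1 (fun t => N t i j) (Icc 0 1) := by
  have hu := uniqueDiffOn_Icc (zero_lt_one (α := ℝ))
  rw [contDiffOn_one_iff_derivWithin hu]
  refine ⟨fun t ht => (h t ht i j).differentiableWithinAt, ?_⟩
  have : ContinuousOn (fun t => N' t i j) (Icc 0 1) :=
    (continuous_id.matrix_elem i j).comp_continuousOn hc
  exact this.congr fun t ht => (h t ht i j).derivWithin (hu t ht)

/-- A path of symplectic matrices with `M' = J₀ S M`. -/
structure IsHamiltonianPath (S M : ℝ → Mat2 n) : Prop where
  continuousOn : ContinuousOn S (Icc 0 1)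
  mem : ∀ t ∈ Icc (0 : ℝ) 1, M t ∈ Matrix.symplecticGroup (Fin n) ℝ
  deriv : ∀ t ∈ Icc (0 : ℝ) 1, HasMatrixDerivWithinAt M (J0 n * S t * M t) (Icc 0 1) t

theorem continuous_rot : Continuous (rot n) := by
  unfold rot
  fun_prop

theorem continuousOn_rotated {X : Type*} [TopologicalSpace X] {N : X → Mat2 n} {κ : X → ℝ}
    {s : Set X} (hN : ContinuousOn N s) (hκ : ContinuousOn κ s) :
    ContinuousOn (fun x => rotated (N x) (κ x)) s := by
  have h1 : ContinuousOn (fun x => rot n (κ x)) s := continuous_rot.comp_continuousOn hκ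
  exact (h1.mul hN).mul h1

theorem IsHamiltonianPath.continuousOn_path {S M : ℝ → Mat2 n} (h : IsHamiltonianPath S M) :
    ContinuousOn M (Icc 0 1) := fun t ht => (h.deriv t ht).continuousWithinAt

section

variable {S M : ℝ → Mat2 n} {σ σ' κ κ' : ℝ → ℝ}

theorem IsHamiltonianPath.hasMatrixDerivWithinAt_rotated (h : IsHamiltonianPath S M)
    (hσ : ∀ t ∈ Icc (0 : ℝ) 1, HasDerivWithinAt σ (σ' t) (Icc 0 1) t)
    (hκ : ∀ t ∈ Icc (0 : ℝ) 1, HasDerivWithinAt κ (κ' t) (Icc 0 1) t)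
    (hmaps : MapsTo σ (Icc 0 1) (Icc 0 1)) {t : ℝ} (ht : t ∈ Icc (0 : ℝ) 1) :
    HasMatrixDerivWithinAt (fun t => rotated (M (σ t)) (κ t))
      (κ' t • (J0 n * rotated (M (σ t)) (κ t) + rotated (M (σ t)) (κ t) * J0 n)
        + rotated (σ' t • (J0 n * S (σ t) * M (σ t))) (κ t)) (Icc 0 1) t :=
  _root_.hasMatrixDerivWithinAt_rotated
    ((h.deriv (σ t) (hmaps ht)).scomp (hσ t ht) hmaps) (hκ t ht)

theorem IsHamiltonianPath.crossingForm_rotated (h : IsHamiltonianPath S M)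
    (hσ : ∀ t ∈ Icc (0 : ℝ) 1, HasDerivWithinAt σ (σ' t) (Icc 0 1) t)
    (hκ : ∀ t ∈ Icc (0 : ℝ) 1, HasDerivWithinAt κ (κ' t) (Icc 0 1) t)
    (hmaps : MapsTo σ (Icc 0 1) (Icc 0 1)) {t : ℝ} (ht : t ∈ Icc (0 : ℝ) 1)
    (v : crossingSpace (matGraph 1) (graphFrame (rotated (M (σ t)) (κ t)))) :
    crossingForm (omegaGraph n) (matGraph 1) (fun t => graphFrame (rotated (M (σ t)) (κ t))) t v v
      = 2 * κ' t * ((v : R2 n) ⬝ᵥ v) + σ' t * (((rot n (κ t))ᵀ *ᵥ (v : R2 n)) ⬝ᵥ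
        (S (σ t) *ᵥ ((rot n (κ t))ᵀ *ᵥ (v : R2 n)))) := by
  have hv : (v : R2 n) ∈ fixedSpace (rotated (M (σ t)) (κ t)) :=
    crossingSpace_graphFrame (rotated (M (σ t)) (κ t)) ▸ v.2
  rw [crossingForm_graphFrame (M := fun t => rotated (M (σ t)) (κ t)) ht
    (h.hasMatrixDerivWithinAt_rotated hσ hκ hmaps ht),
    rotated_crossing (h.mem _ (hmaps ht)) (κ t) (κ' t) (σ' t) hv hv]

/-- It suffices that the crossing form has no isotropic vector. The reparametrization `σ` and the
rotation angle `κ` are kept independent, to serve both the existence of the index and its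
monotonicity. -/
theorem IsHamiltonianPath.isRegularFramePath (h : IsHamiltonianPath S M)
    (hσ : ∀ t ∈ Icc (0 : ℝ) 1, HasDerivWithinAt σ (σ' t) (Icc 0 1) t)
    (hσ' : ContinuousOn σ' (Icc 0 1))
    (hκ : ∀ t ∈ Icc (0 : ℝ) 1, HasDerivWithinAt κ (κ' t) (Icc 0 1) t)
    (hκ' : ContinuousOn κ' (Icc 0 1)) (hmaps : MapsTo σ (Icc 0 1) (Icc 0 1))
    (hne : ∀ t ∈ Icc (0 : ℝ) 1, ∀ v ∈ fixedSpace (rotated (M (σ t)) (κ t)), v ≠ 0 →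
      2 * κ' t * (v ⬝ᵥ v) + σ' t * (((rot n (κ t))ᵀ *ᵥ v) ⬝ᵥ
        (S (σ t) *ᵥ ((rot n (κ t))ᵀ *ᵥ v))) ≠ 0) :
    IsRegularFramePath (omegaGraph n) (matGraph 1)
      (fun t => graphFrame (rotated (M (σ t)) (κ t))) := by
  have hσc : ContinuousOn σ (Icc 0 1) := fun t ht => (hσ t ht).continuousWithinAt
  have hκc : ContinuousOn κ (Icc 0 1) := fun t ht => (hκ t ht).continuousWithinAt
  have hMc : ContinuousOn (fun t => M (σ t)) (Icc 0 1) := h.continuousOn_path.comp hσc hmaps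
  have hSc : ContinuousOn (fun t => S (σ t)) (Icc 0 1) := h.continuousOn.comp hσc hmaps
  refine ⟨?_, fun t ht => ?_, fun t ht => ?_⟩
  · have h1 := continuousOn_rotated hMc hκc
    refine contDiffOn_graphFrame (M := fun t => rotated (M (σ t)) (κ t)) fun i j => contDiffOn_entry
      (fun t ht => h.hasMatrixDerivWithinAt_rotated hσ hκ hmaps ht) ?_ i j
    refine ContinuousOn.add (hκ'.smul (ContinuousOn.add ?_ ?_)) (continuousOn_rotated (hσ'.smul ?_) hκc)
    · exact continuousOn_const.mul h1
    · exact h1.mul continuousOn_const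
    · exact (continuousOn_const.mul hSc).mul hMc
  · exact isLagrangianFrame_graphFrame (rotated_mem_symplecticGroup (h.mem _ (hmaps ht)) _)
  · refine nondegenerate_of_ne_zero fun v hv => ?_
    rw [h.crossingForm_rotated hσ hκ hmaps ht]
    refine hne t ht v ?_ fun h0 => hv (Subtype.ext h0)
    exact crossingSpace_graphFrame (rotated (M (σ t)) (κ t)) ▸ v.2

theorem isPhase_rotated (h : ∀ t ∈ Icc (0 : ℝ) 1, M t ∈ Matrix.symplecticGroup (Fin n) ℝ)
    {φ : ℝ → ℝ} (hφ : IsPhase (fun t => (graphSouriau (M t)).det) (Icc 0 1) φ)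
    (hκ : ContinuousOn κ (Icc 0 1)) :
    IsPhase (fun t => (frameSouriau (graphFrame (rotated (M t) (κ t)))).det) (Icc 0 1)
      (fun t => φ t + 2 * (2 * n) * κ t) := by
  refine ⟨hφ.continuousOn.add (continuousOn_const.mul hκ), fun t ht => ?_⟩
  refine Eq.trans ?_ (det_graphSouriau_rotated (h t ht) (κ t)).symm
  rw [← hφ.exp_eq t ht, ← Complex.exp_add]
  congr 1
  push_cast
  ring

theorem crossingSum_nonneg {A : ℝ → (R2 n →L[ℝ] R2 n × R2 n)}
    (hA : ∀ t ∈ Icc (0 : ℝ) 1, ∀ v, 0 ≤ crossingForm (omegaGraph n) (matGraph 1) A t v v) :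
    0 ≤ crossingSum (omegaGraph n) (matGraph 1) A := by
  have h1 : ∀ t ∈ Icc (0 : ℝ) 1, (0 : ℝ) ≤ crossingSign (omegaGraph n) (matGraph 1) A t := by
    intro t ht
    have h2 := sigNeg_eq_zero_of_nonneg
      (Q := (crossingForm (omegaGraph n) (matGraph 1) A t).toQuadraticMap) (hA t ht)
    rw [crossingSign, h2]
    simp
  have h2 : 0 ≤ ∑ᶠ t ∈ Ioo (0 : ℝ) 1, (crossingSign (omegaGraph n) (matGraph 1) A t : ℝ) :=
    finsum_nonneg fun t => finsum_nonneg fun ht => h1 t (Ioo_subset_Icc_self ht)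
  have h3 := h1 0 (by simp)
  have h4 := h1 1 (by simp)
  rw [crossingSum]
  linarith

/-- Along a path with `M' = J₀ S M` and `S ≥ 0` the phase corrected by the spectral phase
increases, whichever way the endpoints are pushed off the crossing. -/
theorem IsHamiltonianPath.corrected_phase_le (h : IsHamiltonianPath S M)
    (hS : ∀ t ∈ Icc (0 : ℝ) 1, ∀ v, 0 ≤ v ⬝ᵥ S t *ᵥ v) {φ : ℝ → ℝ}
    (hφ : IsPhase (fun t => (graphSouriau (M t)).det) (Icc 0 1) φ) {e c : ℝ} (he : |e| ≤ 2)
    (he' : |1 + e| ≤ 2) (hc : (SignType.sign e : ℝ) = c) (hc' : (SignType.sign (1 + e) : ℝ) = c) :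
    φ 0 - spectralPhase (graphSouriau (M 0))
        + Real.pi * (c * (Module.finrank ℝ (fixedSpace (M 0)) : ℝ))
      ≤ φ 1 - spectralPhase (graphSouriau (M 1))
        + Real.pi * (c * (Module.finrank ℝ (fixedSpace (M 1)) : ℝ)) := by
  have m0 : (0 : ℝ) ∈ Icc (0 : ℝ) 1 := by simp
  have m1 : (1 : ℝ) ∈ Icc (0 : ℝ) 1 := by simp
  obtain ⟨δ, hδ, hδ'⟩ := Metric.eventually_nhds_iff.1
    ((rotation_jump (h.mem 0 m0) (hφ.exp_eq 0 m0) 0).and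
      (rotation_jump (h.mem 1 m1) (hφ.exp_eq 1 m1) 0))
  -- The slope is positive, and the end values `δe/3` and `δ(1 + e)/3` have the same sign and size
  -- at most `2δ/3 < δ`, so `rotation_jump` applies at both ends.
  set κ : ℝ → ℝ := fun t => δ / 3 * (t + e) with hκdef
  have hd3 : 0 < δ / 3 := by positivity
  have hκ : ∀ t ∈ Icc (0 : ℝ) 1, HasDerivWithinAt κ ((fun _ => δ / 3) t) (Icc 0 1) t :=
    fun t _ => by simpa using ((hasDerivWithinAt_id t (Icc 0 1)).add_const e).const_mul (δ / 3)
  have hσ : ∀ t ∈ Icc (0 : ℝ) 1, HasDerivWithinAt (fun t : ℝ => t) ((fun _ => 1) t) (Icc 0 1) t :=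
    fun t _ => hasDerivWithinAt_id t _
  have hid : MapsTo (fun t : ℝ => t) (Icc (0 : ℝ) 1) (Icc 0 1) := fun _ h => h
  have hR := h.isRegularFramePath hσ continuousOn_const hκ continuousOn_const hid
    fun t ht v _ hv0 => by
      have h1 := dotProduct_self_pos hv0
      have h2 := hS t ht ((rot n (κ t))ᵀ *ᵥ v)
      have h3 := mul_pos hd3 h1
      apply ne_of_gt
      linarith
  have h1 := hR.two_pi_mul_crossingSum
    (isPhase_rotated h.mem hφ fun t ht => (hκ t ht).continuousWithinAt)
  have h2 := crossingSum_nonneg (n := n) (A := fun t => graphFrame (rotated (M t) (κ t)))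
    fun t ht v => by
      rw [h.crossingForm_rotated hσ hκ hid ht]
      have h1 : 0 ≤ (v : R2 n) ⬝ᵥ v := Finset.sum_nonneg fun i _ => mul_self_nonneg _
      have h2 := hS t ht ((rot n (κ t))ᵀ *ᵥ v)
      have h3 := mul_nonneg hd3.le h1
      linarith
  have habs : ∀ x : ℝ, |x| ≤ 2 → dist (δ / 3 * x) 0 < δ := fun x hx => by
    rw [dist_zero_right, norm_mul, Real.norm_eq_abs, Real.norm_eq_abs, abs_of_pos hd3]
    nlinarith
  have hsign : ∀ x : ℝ, SignType.sign (δ / 3 * x - 0) = SignType.sign x := fun x => by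
    rw [sub_zero, sign_mul, sign_pos hd3, one_mul]
  have j0 := (hδ' (habs e he)).1.1
  have j1 := (hδ' (habs (1 + e) he')).2.1
  rw [hsign, hc] at j0
  rw [hsign, hc'] at j1
  rw [rotated_zero] at j0 j1
  have h3 := mul_nonneg Real.two_pi_pos.le h2
  rw [h1] at h3
  simp only [hκdef, zero_add] at h3
  simp only [graphSouriau] at j0 j1 ⊢
  linarith

end

end RotatedPaths

/-! ### Existence of the index and its phase formula -/

section Index

variable {n : ℕ} {S M : ℝ → Mat2 n}

theorem sq_norm_le_dotProduct {ι : Type*} [Fintype ι] (v : ι → ℝ) : ‖v‖ ^ 2 ≤ v ⬝ᵥ v := by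
  have h0 : 0 ≤ v ⬝ᵥ v := Finset.sum_nonneg fun i _ => mul_self_nonneg _
  have h1 : ‖v‖ ≤ Real.sqrt (v ⬝ᵥ v) := by
    refine (pi_norm_le_iff_of_nonneg (Real.sqrt_nonneg _)).2 fun i => ?_
    rw [Real.norm_eq_abs]
    refine Real.abs_le_sqrt ?_
    rw [sq]
    exact Finset.single_le_sum (f := fun i => v i * v i) (fun i _ => mul_self_nonneg _)
      (Finset.mem_univ i)
  calc ‖v‖ ^ 2 ≤ Real.sqrt (v ⬝ᵥ v) ^ 2 := by gcongr
    _ = v ⬝ᵥ v := Real.sq_sqrt h0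

theorem exists_form_bound (hS : ContinuousOn S (Icc 0 1)) :
    ∃ B : ℝ, 0 ≤ B ∧ ∀ t ∈ Icc (0 : ℝ) 1, ∀ v, |v ⬝ᵥ S t *ᵥ v| ≤ B * (v ⬝ᵥ v) := by
  have h1 : ContinuousOn (fun t => ∑ i, ∑ j, |S t i j|) (Icc 0 1) :=
    Continuous.comp_continuousOn (g := fun D : Mat2 n => ∑ i, ∑ j, |D i j|) (by fun_prop) hS
  obtain ⟨B, hB⟩ := isCompact_Icc.bddAbove_image h1
  have hB' : ∀ t ∈ Icc (0 : ℝ) 1, ∑ i, ∑ j, |S t i j| ≤ B := fun t ht => hB ⟨t, ht, rfl⟩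
  refine ⟨B, le_trans (Finset.sum_nonneg fun i _ => Finset.sum_nonneg fun j _ => abs_nonneg _)
    (hB' 0 (by simp)), fun t ht v => ?_⟩
  refine (abs_dotProduct_mulVec_le (S t) v v).trans ?_
  rw [mul_assoc, ← sq]
  exact mul_le_mul (hB' t ht) (sq_norm_le_dotProduct v) (sq_nonneg _)
    (le_trans (Finset.sum_nonneg fun i _ => Finset.sum_nonneg fun j _ => abs_nonneg _) (hB' t ht))

theorem exists_isPhase_path {A : ℝ → (R2 n →L[ℝ] R2 n × R2 n)} (hA : ContinuousOn A (Icc 0 1))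
    (hL : ∀ t ∈ Icc (0 : ℝ) 1, IsLagrangianFrame (omegaGraph n) (A t)) :
    ∃ φ, IsPhase (fun t => (frameSouriau (A t)).det) (Icc 0 1) φ := by
  obtain ⟨φ, hφ⟩ := exists_isPhase_frames (F := fun p => A p.2)
    (hA.comp continuousOn_snd fun p hp => hp.2) fun p hp => hL _ hp.2
  exact ⟨_, hφ.comp (g := fun t : ℝ => ((0 : ℝ), t)) (by fun_prop) fun t ht => ⟨by simp, ht⟩⟩

theorem IsHamiltonianPath.continuousOn_graphFrame (h : IsHamiltonianPath S M) :
    ContinuousOn (fun t => graphFrame (M t)) (Icc 0 1) :=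
  continuous_graphFrame.comp_continuousOn h.continuousOn_path

theorem IsHamiltonianPath.exists_isPhase (h : IsHamiltonianPath S M) :
    ∃ φ, IsPhase (fun t => (graphSouriau (M t)).det) (Icc 0 1) φ :=
  exists_isPhase_path h.continuousOn_graphFrame
    fun t ht => isLagrangianFrame_graphFrame (h.mem t ht)

/-- The path of graphs of a Hamiltonian path can be deformed to a path with regular crossings. -/
theorem IsHamiltonianPath.exists_isMaslovIndex (h : IsHamiltonianPath S M) :
    ∃ μ, IsMaslovIndex (R2 n) (omegaGraph n) (matGraph 1) (fun t => matGraph (M t)) μ := by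
  obtain ⟨B, hB0, hB⟩ := exists_form_bound h.continuousOn
  obtain ⟨φ, hφ⟩ := h.exists_isPhase
  have mh : (1 / 2 : ℝ) ∈ Icc (0 : ℝ) 1 := by constructor <;> norm_num
  -- Crossing angles are isolated, so just above `B + 1` there is a large angle `K` at which the
  -- midpoint matrix, once rotated, has no crossing.
  obtain ⟨K, hKfix, hKB⟩ : ∃ K, fixedSpace (rotated (M (1 / 2)) K) = ⊥ ∧ B + 1 < K := by
    have h1 := nhdsWithin_le_nhds (s := Ioi (B + 1))
      (rotation_jump (h.mem _ mh) (hφ.exp_eq _ mh) (B + 1))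
    obtain ⟨K, hK, hK'⟩ := (Filter.Eventually.and h1 (self_mem_nhdsWithin)).exists
    exact ⟨K, hK.2 (ne_of_gt hK'), hK'⟩
  -- The rotation angle must vanish at both ends, so its speed `4K(1 - 2t)` vanishes at the
  -- midpoint. The time change makes `σ' = 3(1 - 2t)²` vanish there to higher order, so for large
  -- `K` the rotation dominates at every other time.
  set σ : ℝ → ℝ := fun t => 1 / 2 - (1 - 2 * t) ^ 3 / 2 with hσdef
  set κ : ℝ → ℝ := fun t => 4 * K * (t * (1 - t)) with hκdef
  have hσ : ∀ t ∈ Icc (0 : ℝ) 1,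
      HasDerivWithinAt σ ((fun t => 3 * (1 - 2 * t) ^ 2) t) (Icc 0 1) t := fun t _ => by
    have h1 := (((hasDerivAt_id t).const_mul 2).const_sub 1).pow 3
    have h2 := (h1.div_const 2).const_sub (1 / 2)
    refine (h2.congr_deriv ?_).hasDerivWithinAt
    simp
    ring
  have hκ : ∀ t ∈ Icc (0 : ℝ) 1,
      HasDerivWithinAt κ ((fun t => 4 * K * (1 - 2 * t)) t) (Icc 0 1) t := fun t _ => by
    have h1 := ((hasDerivAt_id' t).mul ((hasDerivAt_id' t).const_sub 1)).const_mul (4 * K)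
    exact (h1.congr_deriv (by ring)).hasDerivWithinAt
  have hmaps : MapsTo σ (Icc 0 1) (Icc 0 1) := fun t ht => by
    have h1 : |1 - 2 * t| ≤ 1 := abs_le.2 ⟨by linarith [ht.2], by linarith [ht.1]⟩
    have h2 : |(1 - 2 * t) ^ 3| ≤ 1 := by rw [abs_pow]; exact pow_le_one₀ (abs_nonneg _) h1
    have h3 := abs_le.1 h2
    constructor <;> simp only [hσdef] <;> linarith [h3.1, h3.2]
  have hR := h.isRegularFramePath hσ (by fun_prop) hκ (by fun_prop) hmaps fun t ht v hv hv0 => by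
    have hpos := dotProduct_self_pos hv0
    have h1 := hB (σ t) (hmaps ht) ((rot n (κ t))ᵀ *ᵥ v)
    rw [rot_transpose_dotProduct] at h1
    set x := ((rot n (κ t))ᵀ *ᵥ v) ⬝ᵥ (S (σ t) *ᵥ ((rot n (κ t))ᵀ *ᵥ v))
    set u := 1 - 2 * t with hu
    have hu1 : |u| ≤ 1 := abs_le.2 ⟨by linarith [ht.2], by linarith [ht.1]⟩
    have hu0 : u ≠ 0 := by
      intro h0
      have ht2 : t = 1 / 2 := by linarith
      have e1 : σ t = 1 / 2 := by rw [ht2]; norm_num [hσdef]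
      have e2 : κ t = K := by rw [ht2]; simp only [hκdef]; ring
      rw [e1, e2, hKfix] at hv
      exact hv0 hv
    have e : 2 * (4 * K * u) * (v ⬝ᵥ v) + 3 * u ^ 2 * x
        = u * (8 * K * (v ⬝ᵥ v) + 3 * (u * x)) := by ring
    change 2 * (4 * K * u) * (v ⬝ᵥ v) + 3 * u ^ 2 * x ≠ 0
    rw [e]
    refine mul_ne_zero hu0 (ne_of_gt ?_)
    have h2 : |u * x| ≤ B * (v ⬝ᵥ v) := by
      rw [abs_mul]
      calc |u| * |x| ≤ 1 * |x| := by gcongr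
        _ ≤ _ := by rw [one_mul]; exact h1
    have h3 := (abs_le.1 h2).1
    nlinarith
  have hσc : ContinuousOn σ (Icc 0 1) := fun t ht => (hσ t ht).continuousWithinAt
  have hκc : ContinuousOn κ (Icc 0 1) := fun t ht => (hκ t ht).continuousWithinAt
  -- The homotopy interpolates linearly between `t` and `σ t` and scales the rotation angle; both
  -- deformations are trivial at the endpoints.
  have hg : MapsTo (fun p : ℝ × ℝ => (1 - p.1) * p.2 + p.1 * σ p.2) (Icc 0 1 ×ˢ Icc 0 1)
      (Icc 0 1) := fun p hp => by
    have h1 := hmaps hp.2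
    have h2 := convex_Icc (0 : ℝ) 1 hp.2 h1 (sub_nonneg.2 hp.1.2) hp.1.1 (by ring)
    simpa using h2
  refine ⟨_, _, hR, ⟨fun p => graphFrame (rotated (M ((1 - p.1) * p.2 + p.1 * σ p.2))
    (p.1 * κ p.2)), ?_, ?_, ?_, ?_, ?_, ?_⟩, rfl⟩
  · refine continuous_graphFrame.comp_continuousOn (continuousOn_rotated
      (h.continuousOn_path.comp (Continuous.continuousOn ?_) hg) (Continuous.continuousOn ?_))
    · simp only [hσdef]
      fun_prop
    · simp only [hκdef]
      fun_prop
  · intro s hs t ht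
    exact isLagrangianFrame_graphFrame (rotated_mem_symplecticGroup (h.mem _ (hg ⟨hs, ht⟩)) _)
  · intro t _
    rw [range_graphFrame]
    simp [rotated_zero]
  · intro t _
    simp
  · intro s _
    rw [range_graphFrame]
    have e1 : (1 - s) * 0 + s * σ 0 = 0 := by simp [hσdef]
    have e2 : s * κ 0 = 0 := by simp [hκdef]
    simp only [e1, e2, rotated_zero]
  · intro s _
    rw [range_graphFrame]
    have e1 : (1 - s) * 1 + s * σ 1 = 1 := by simp only [hσdef]; ring
    have e2 : s * κ 1 = 0 := by simp [hκdef]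
    simp only [e1, e2, rotated_zero]

/-- The Conley–Zehnder index is the increment of the phase corrected by the spectral phase. -/
theorem IsHamiltonianPath.two_pi_mul_czIndex (h : IsHamiltonianPath S M) {φ : ℝ → ℝ}
    (hφ : IsPhase (fun t => (graphSouriau (M t)).det) (Icc 0 1) φ) :
    2 * Real.pi * czIndex M = (φ 1 - spectralPhase (graphSouriau (M 1)))
      - (φ 0 - spectralPhase (graphSouriau (M 0))) := by
  have m0 : (0 : ℝ) ∈ Icc (0 : ℝ) 1 := by simp
  have m1 : (1 : ℝ) ∈ Icc (0 : ℝ) 1 := by simp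
  have hex := h.exists_isMaslovIndex
  rw [czIndex, maslovIndex, dif_pos hex]
  obtain ⟨A, hA, hhom, hμ⟩ := hex.choose_spec
  obtain ⟨ψ, hψ⟩ := exists_isPhase_path hA.contDiffOn.continuousOn hA.frame
  have hL : ∀ t ∈ Icc (0 : ℝ) 1, IsLagrangianFrame (omegaGraph n) (graphFrame (M t)) :=
    fun t ht => isLagrangianFrame_graphFrame (h.mem t ht)
  have h1 := hhom.phase_sub_eq hL hA.frame (fun t _ => range_graphFrame (M t)) (fun _ _ => rfl) hφ hψ
  obtain ⟨F, -, -, -, hF1, hFa, hFb⟩ := hhom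
  have e0 : frameSouriau (A 0) = graphSouriau (M 0) :=
    frameSouriau_eq_of_range_eq (hA.frame 0 m0) (hL 0 m0)
      (by rw [range_graphFrame]; exact (hF1 0 m0).symm.trans (hFa 1 m1))
  have e1 : frameSouriau (A 1) = graphSouriau (M 1) :=
    frameSouriau_eq_of_range_eq (hA.frame 1 m1) (hL 1 m1)
      (by rw [range_graphFrame]; exact (hF1 1 m1).symm.trans (hFb 1 m1))
  rw [hμ, hA.two_pi_mul_crossingSum hψ, e0, e1]
  linarith

theorem HasMatrixDerivWithinAt.eq_of_zero {N : ℝ → Mat2 n}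
    (h : ∀ t ∈ Icc (0 : ℝ) 1, HasMatrixDerivWithinAt N 0 (Icc 0 1) t) {t : ℝ}
    (ht : t ∈ Icc (0 : ℝ) 1) : N t = N 0 := by
  ext i j
  refine constant_of_derivWithin_zero (f := fun τ => N τ i j)
    (fun t ht => (h t ht i j).differentiableWithinAt) (fun t ht => ?_) t ht
  have ht' : t ∈ Icc (0 : ℝ) 1 := Ico_subset_Icc_self ht
  exact (h t ht' i j).derivWithin (uniqueDiffOn_Icc zero_lt_one t ht')

/-- A linear Hamiltonian flow is symplectic. -/
theorem isHamiltonianPath_of_symm (hS : IsSymmetricPath S) (h0 : M 0 ∈ Matrix.symplecticGroup (Fin n) ℝ)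
    (hM : ∀ t ∈ Icc (0 : ℝ) 1, HasMatrixDerivWithinAt M (J0 n * S t * M t) (Icc 0 1) t) :
    IsHamiltonianPath S M := by
  refine ⟨hS.1, fun t ht => ?_, hM⟩
  -- `Mᵀ J₀ M` is a constant of motion because `S` is symmetric.
  have h1 : ∀ t ∈ Icc (0 : ℝ) 1,
      HasMatrixDerivWithinAt (fun t => (M t)ᵀ * (J0 n * M t)) 0 (Icc 0 1) t := fun t ht => by
    have h2 := (hM t ht).transpose.mul ((hM t ht).const_mul (J0 n))
    have e : (J0 n * S t * M t)ᵀ * (J0 n * M t) + (M t)ᵀ * (J0 n * (J0 n * S t * M t)) = 0 := by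
      rw [Matrix.transpose_mul, Matrix.transpose_mul, (hS.2 t ht).eq, J0_transpose]
      simp only [mul_neg, neg_mul, mul_assoc]
      simp only [← mul_assoc (J0 n) (J0 n), J0_mul_J0]
      simp
    rwa [e] at h2
  have h3 := HasMatrixDerivWithinAt.eq_of_zero h1 ht
  have h4 : (M 0)ᵀ * J0 n * M 0 = J0 n := symplectic_transpose_mul h0
  rw [mul_assoc] at h4
  rw [SymplecticGroup.mem_iff', mul_assoc]
  exact h3.trans h4

theorem IsFundamentalSolution.isHamiltonianPath (hS : IsSymmetricPath S)
    (hM : IsFundamentalSolution S M) : IsHamiltonianPath S M :=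
  isHamiltonianPath_of_symm hS (by rw [hM.1]; exact one_mem _) hM.2

end Index

/-! ### Monotonicity through the quotient path -/

section Comparison

variable {n : ℕ}

theorem J0_mul_J0_mul (A : Mat2 n) : J0 n * (J0 n * A) = -A := by
  rw [← mul_assoc, J0_mul_J0, neg_one_mul]

/-- The inverse of a symplectic matrix. -/
def symplecticInv (M : Mat2 n) : Mat2 n := -(J0 n * Mᵀ * J0 n)

theorem symplecticInv_mul {M : Mat2 n} (hM : M ∈ Matrix.symplecticGroup (Fin n) ℝ) :
    symplecticInv M * M = 1 := by
  rw [symplecticInv, neg_mul]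
  exact SymplecticGroup.inv_left_mul_aux hM

theorem mul_symplecticInv {M : Mat2 n} (hM : M ∈ Matrix.symplecticGroup (Fin n) ℝ) :
    M * symplecticInv M = 1 := mul_eq_one_comm.1 (symplecticInv_mul hM)

theorem symplecticInv_mem {M : Mat2 n} (hM : M ∈ Matrix.symplecticGroup (Fin n) ℝ) :
    symplecticInv M ∈ Matrix.symplecticGroup (Fin n) ℝ :=
  SymplecticGroup.neg_mem (mul_mem (mul_mem (SymplecticGroup.J_mem (Fin n) ℝ)
    (SymplecticGroup.transpose_mem hM)) (SymplecticGroup.J_mem (Fin n) ℝ))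

theorem J0_mul_symplecticInv_transpose (M : Mat2 n) :
    J0 n * (symplecticInv M)ᵀ = M * J0 n := by
  simp only [symplecticInv, Matrix.transpose_neg, Matrix.transpose_mul, Matrix.transpose_transpose,
    J0_transpose, neg_mul, mul_neg, neg_neg, J0_mul_J0_mul]

variable {S₀ S₁ Φ₀ Φ₁ : ℝ → Mat2 n}

theorem continuousOn_symplecticInv_mul (h₀ : ContinuousOn Φ₀ (Icc 0 1))
    (h₁ : ContinuousOn Φ₁ (Icc 0 1)) :
    ContinuousOn (fun t => symplecticInv (Φ₀ t) * Φ₁ t) (Icc 0 1) := by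
  have hT : ContinuousOn (fun t => (Φ₀ t)ᵀ) (Icc 0 1) :=
    (continuous_id.matrix_transpose).comp_continuousOn h₀
  exact ((continuousOn_const.mul hT).mul continuousOn_const).neg.mul h₁

/-- The path `s ↦ Φ₀(1) Φ₀(s)⁻¹ Φ₁(s)` is Hamiltonian for a conjugate of `S₁ - S₀`. -/
theorem IsHamiltonianPath.quotient (h₀ : IsHamiltonianPath S₀ Φ₀) (h₁ : IsHamiltonianPath S₁ Φ₁)
    (hS₀ : ∀ t ∈ Icc (0 : ℝ) 1, (S₀ t).IsSymm) :
    IsHamiltonianPath (fun s => (Φ₀ s * symplecticInv (Φ₀ 1))ᵀ * (S₁ s - S₀ s)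
        * (Φ₀ s * symplecticInv (Φ₀ 1)))
      (fun s => Φ₀ 1 * (symplecticInv (Φ₀ s) * Φ₁ s)) := by
  have m1 : (1 : ℝ) ∈ Icc (0 : ℝ) 1 := by simp
  refine ⟨?_, fun t ht => ?_, fun t ht => ?_⟩
  · have h2 : ContinuousOn (fun s => Φ₀ s * symplecticInv (Φ₀ 1)) (Icc 0 1) :=
      h₀.continuousOn_path.mul continuousOn_const
    have h3 : ContinuousOn (fun s => (Φ₀ s * symplecticInv (Φ₀ 1))ᵀ) (Icc 0 1) :=
      (continuous_id.matrix_transpose).comp_continuousOn h2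
    exact (h3.mul (h₁.continuousOn.sub h₀.continuousOn)).mul h2
  · exact mul_mem (h₀.mem 1 m1) (mul_mem (symplecticInv_mem (h₀.mem t ht)) (h₁.mem t ht))
  · have h2 := ((((h₀.deriv t ht).transpose.const_mul (-J0 n)).mul
      ((h₁.deriv t ht).const_mul (J0 n)))).const_mul (Φ₀ 1)
    have e : Φ₀ 1 * (-J0 n * (J0 n * S₀ t * Φ₀ t)ᵀ * (J0 n * Φ₁ t)
          + -J0 n * (Φ₀ t)ᵀ * (J0 n * (J0 n * S₁ t * Φ₁ t)))
        = J0 n * ((Φ₀ t * symplecticInv (Φ₀ 1))ᵀ * (S₁ t - S₀ t) * (Φ₀ t * symplecticInv (Φ₀ 1)))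
          * (Φ₀ 1 * (symplecticInv (Φ₀ t) * Φ₁ t)) := by
      have e1 : Φ₀ t * symplecticInv (Φ₀ 1) * (Φ₀ 1 * (symplecticInv (Φ₀ t) * Φ₁ t)) = Φ₁ t := by
        rw [mul_assoc, ← mul_assoc (symplecticInv (Φ₀ 1)), symplecticInv_mul (h₀.mem 1 m1), one_mul,
          ← mul_assoc, mul_symplecticInv (h₀.mem t ht), one_mul]
      have e2 : ∀ L D K Y : Mat2 n, J0 n * (L * D * K) * Y = J0 n * L * (D * (K * Y)) :=
        fun L D K Y => by simp only [mul_assoc]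
      rw [e2, e1, Matrix.transpose_mul (Φ₀ t) (symplecticInv (Φ₀ 1)),
        ← mul_assoc (J0 n) (symplecticInv (Φ₀ 1))ᵀ,
        J0_mul_symplecticInv_transpose, Matrix.transpose_mul, Matrix.transpose_mul,
        (hS₀ t ht).eq, J0_transpose]
      simp only [mul_assoc, neg_mul, mul_neg, neg_neg, J0_mul_J0_mul, mul_sub, sub_mul, mul_add]
      abel
    rw [e] at h2
    refine h2.congr (fun τ _ => ?_) ?_ <;>
      simp only [symplecticInv, neg_mul, mul_neg, mul_assoc]

theorem symplecticInv_mul_mem (h₀ : IsHamiltonianPath S₀ Φ₀) (h₁ : IsHamiltonianPath S₁ Φ₁)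
    {s t : ℝ} (hs : s ∈ Icc (0 : ℝ) 1) (ht : t ∈ Icc (0 : ℝ) 1) :
    Φ₀ t * (symplecticInv (Φ₀ s) * Φ₁ s) ∈ Matrix.symplecticGroup (Fin n) ℝ :=
  mul_mem (h₀.mem t ht) (mul_mem (symplecticInv_mem (h₀.mem s hs)) (h₁.mem s hs))

/-- One phase on the square `Φ₀(t) Φ₀(s)⁻¹ Φ₁(s)` serves all three paths: `θ(1,1) - θ(0,0)` is the
increment along `Φ₀` plus that along the edge `t = 1`. The latter is controlled by
`corrected_phase_le`. -/
theorem czIndex_add_le (h₀ : IsHamiltonianPath S₀ Φ₀) (h₁ : IsHamiltonianPath S₁ Φ₁)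
    (hS₀ : ∀ t ∈ Icc (0 : ℝ) 1, (S₀ t).IsSymm) (hΦ₀ : Φ₀ 0 = 1) (hΦ₁ : Φ₁ 0 = 1)
    (hle : ∀ t ∈ Icc (0 : ℝ) 1, ∀ v, 0 ≤ v ⬝ᵥ (S₁ t - S₀ t) *ᵥ v) {e c : ℝ} (he : |e| ≤ 2)
    (he' : |1 + e| ≤ 2) (hc : (SignType.sign e : ℝ) = c) (hc' : (SignType.sign (1 + e) : ℝ) = c) :
    2 * Real.pi * czIndex Φ₀ + Real.pi * (c * (Module.finrank ℝ (fixedSpace (Φ₀ 1)) : ℝ))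
      ≤ 2 * Real.pi * czIndex Φ₁ + Real.pi * (c * (Module.finrank ℝ (fixedSpace (Φ₁ 1)) : ℝ)) := by
  have m0 : (0 : ℝ) ∈ Icc (0 : ℝ) 1 := by simp
  have m1 : (1 : ℝ) ∈ Icc (0 : ℝ) 1 := by simp
  obtain ⟨θ, hθ⟩ := exists_isPhase_frames
    (F := fun p : ℝ × ℝ => graphFrame (Φ₀ p.1 * (symplecticInv (Φ₀ p.2) * Φ₁ p.2)))
    (continuous_graphFrame.comp_continuousOn
      ((h₀.continuousOn_path.comp continuousOn_fst fun p hp => hp.1).mul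
        ((continuousOn_symplecticInv_mul h₀.continuousOn_path h₁.continuousOn_path).comp
          continuousOn_snd fun p hp => hp.2)))
    (fun p hp => isLagrangianFrame_graphFrame (symplecticInv_mul_mem h₀ h₁ hp.2 hp.1))
  have e0 : ∀ t, Φ₀ t * (symplecticInv (Φ₀ 0) * Φ₁ 0) = Φ₀ t := fun t => by
    have h := symplecticInv_mul (h₀.mem 0 m0)
    rw [hΦ₀, mul_one] at h
    rw [hΦ₀, hΦ₁, h, one_mul, mul_one]
  have e1 : ∀ t ∈ Icc (0 : ℝ) 1, Φ₀ t * (symplecticInv (Φ₀ t) * Φ₁ t) = Φ₁ t := fun t ht => by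
    rw [← mul_assoc, mul_symplecticInv (h₀.mem t ht), one_mul]
  have p0 : IsPhase (fun t => (graphSouriau (Φ₀ t)).det) (Icc 0 1) (fun t => θ (t, 0)) :=
    (hθ.comp (g := fun t : ℝ => (t, (0 : ℝ))) (by fun_prop) fun t ht => ⟨ht, m0⟩).congr
      fun t _ => by rw [e0]; rfl
  have p1 : IsPhase (fun t => (graphSouriau (Φ₁ t)).det) (Icc 0 1) (fun t => θ (t, t)) :=
    (hθ.comp (g := fun t : ℝ => (t, t)) (by fun_prop) fun t ht => ⟨ht, ht⟩).congr
      fun t ht => by rw [e1 t ht]; rfl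
  have p2 : IsPhase (fun s => (graphSouriau (Φ₀ 1 * (symplecticInv (Φ₀ s) * Φ₁ s))).det) (Icc 0 1)
      (fun s => θ (1, s)) :=
    hθ.comp (g := fun s : ℝ => ((1 : ℝ), s)) (by fun_prop) fun s hs => ⟨m1, hs⟩
  have hq := h₀.quotient h₁ hS₀
  have hmain := hq.corrected_phase_le (fun t ht v => by
    rw [← Matrix.mulVec_mulVec, ← Matrix.mulVec_mulVec, Matrix.dotProduct_mulVec,
      Matrix.vecMul_transpose]
    exact hle t ht _) p2 he he' hc hc'
  rw [e0, e1 1 m1] at hmain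
  rw [h₀.two_pi_mul_czIndex p0, h₁.two_pi_mul_czIndex p1, hΦ₀, hΦ₁]
  linarith

theorem maxCZIndex_eq (Φ : ℝ → Mat2 n) :
    maxCZIndex Φ = czIndex Φ + 1 / 2 * (Module.finrank ℝ (fixedSpace (Φ 1)) : ℝ) := rfl

/-- The Conley–Zehnder index and its maximal version are monotone. -/
theorem czIndex_le_and_maxCZIndex_le (hS₀ : IsSymmetricPath S₀) (hS₁ : IsSymmetricPath S₁)
    (hΦ₀ : IsFundamentalSolution S₀ Φ₀) (hΦ₁ : IsFundamentalSolution S₁ Φ₁)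
    (hle : ∀ t ∈ Icc (0 : ℝ) 1, ∀ v, 0 ≤ v ⬝ᵥ (S₁ t - S₀ t) *ᵥ v) :
    czIndex Φ₀ ≤ czIndex Φ₁ ∧ maxCZIndex Φ₀ ≤ maxCZIndex Φ₁ := by
  have h := fun {e c : ℝ} => czIndex_add_le (e := e) (c := c) (hΦ₀.isHamiltonianPath hS₀)
    (hΦ₁.isHamiltonianPath hS₁) hS₀.2 hΦ₀.1 hΦ₁.1 hle
  -- Pushing both ends forward (`e = 1`) gives monotonicity of `CZ + ½ dim`; pushing both backward
  -- (`e = -2`) gives that of `CZ - ½ dim`. The sum of the two yields `CZ`.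
  have h1 := h (e := 1) (c := 1) (by norm_num) (by norm_num) (by simp)
    (by rw [sign_pos (by norm_num)]; simp)
  have h2 := h (e := -2) (c := -1) (by norm_num) (by norm_num) (by rw [sign_neg (by norm_num)]; simp)
    (by rw [sign_neg (by norm_num)]; simp)
  rw [maxCZIndex_eq, maxCZIndex_eq]
  have hpi := Real.pi_pos
  constructor
  · refine le_of_mul_le_mul_left ?_ Real.two_pi_pos
    linarith
  · refine le_of_mul_le_mul_left ?_ Real.two_pi_pos
    linarith

end Comparison

/-! ### Index of a rotation with two speeds -/

section Model

variable {n : ℕ} {P : Mat2 n}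

/-- An orthogonal projection of `ℝ ^ (2n)` onto a complex subspace. -/
structure IsComplexProjection (P : Mat2 n) : Prop where
  symm : P.IsSymm
  idem : P * P = P
  comm : P * J0 n = J0 n * P

theorem sum_affine_eigenvalues (hH : P.IsHermitian) (x y : ℝ) :
    ∑ j, (x * hH.eigenvalues j + y * (1 - hH.eigenvalues j))
      = x * P.trace + y * (2 * n - P.trace) := by
  have h1 : P.trace = ∑ j, hH.eigenvalues j := by
    simpa using hH.trace_eq_sum_eigenvalues
  rw [h1, Finset.sum_add_distrib, ← Finset.mul_sum, ← Finset.mul_sum, Finset.sum_sub_distrib]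
  simp
  left
  ring

/-- The diagonal flow rotating the range of `P` and its complement. -/
def splitFlow (P : Mat2 n) (α β : ℝ) : Mat2 n := rot n α * P + rot n β * (1 - P)

/-- The generator of the diagonal flow. -/
def splitGenerator (P : Mat2 n) (a b : ℝ) : Mat2 n := a • P + b • (1 - P)

namespace IsComplexProjection

theorem mul_rot (hP : IsComplexProjection P) (θ : ℝ) : P * rot n θ = rot n θ * P := by
  simp only [rot, mul_add, add_mul, mul_smul_comm, smul_mul_assoc, mul_one, one_mul, hP.comm]

theorem isSymmetricPath (hP : IsComplexProjection P) (a b : ℝ) :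
    IsSymmetricPath fun _ => splitGenerator P a b := by
  refine ⟨continuousOn_const, fun _ _ => ?_⟩
  rw [Matrix.IsSymm, splitGenerator, Matrix.transpose_add, Matrix.transpose_smul,
    Matrix.transpose_smul, Matrix.transpose_sub, Matrix.transpose_one, hP.symm.eq]

theorem splitGenerator_mul_splitFlow (hP : IsComplexProjection P) (a b α β : ℝ) :
    splitGenerator P a b * splitFlow P α β = a • (rot n α * P) + b • (rot n β * (1 - P)) := by
  have h1 : ∀ X : Mat2 n, P * (rot n α * X) = rot n α * (P * X) := fun X => by
    rw [← mul_assoc, hP.mul_rot, mul_assoc]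
  have h2 : ∀ X : Mat2 n, P * (rot n β * X) = rot n β * (P * X) := fun X => by
    rw [← mul_assoc, hP.mul_rot, mul_assoc]
  have h3 : P * (1 - P) = 0 := by rw [mul_sub, mul_one, hP.idem, sub_self]
  simp only [splitGenerator, splitFlow, mul_add, add_mul, smul_mul_assoc, sub_mul, one_mul, h1, h2,
    hP.idem, h3, mul_zero, smul_zero, sub_self, add_zero, zero_add, sub_zero]

theorem isFundamentalSolution (hP : IsComplexProjection P) (a b : ℝ) :
    IsFundamentalSolution (fun _ => splitGenerator P a b)
      fun t => splitFlow P (a * t) (b * t) := by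
  refine ⟨by simp [splitFlow, rot_zero], fun t _ => ?_⟩
  have hd : ∀ c : ℝ, HasDerivWithinAt (fun t => c * t) c (Icc 0 1) t := fun c => by
    simpa using (hasDerivWithinAt_id t (Icc 0 1)).const_mul c
  have h := ((hasMatrixDerivWithinAt_rot (n := n) (hd a)).mul (.const P)).add
    ((hasMatrixDerivWithinAt_rot (n := n) (hd b)).mul (.const (1 - P)))
  have e : J0 n * splitGenerator P a b * splitFlow P (a * t) (b * t)
      = (a • (J0 n * rot n (a * t)) * P + rot n (a * t) * 0)
        + (b • (J0 n * rot n (b * t)) * (1 - P) + rot n (b * t) * 0) := by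
    rw [mul_assoc, hP.splitGenerator_mul_splitFlow]
    simp only [mul_add, mul_smul_comm, smul_mul_assoc, mul_zero, add_zero, mul_assoc]
  rw [e]
  exact h

/-- The relation `W (X - iY) = X + iY` determines `W`, so it is enough to check it for the proposed
matrix, which is the scalar `exp(iα)` on the range of `P` and `exp(iβ)` on the complement. -/
theorem graphSouriau_splitFlow (hP : IsComplexProjection P) {α β : ℝ}
    (h : splitFlow P α β ∈ Matrix.symplecticGroup (Fin n) ℝ) :
    graphSouriau (splitFlow P α β) = Complex.exp (β * Complex.I) • 1
      + (Complex.exp (α * Complex.I) - Complex.exp (β * Complex.I)) • P.map Complex.ofRealHom := by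
  have hL := (isLagrangianFrame_graphFrame h).isLagrangianPair
  have hu := hL.isUnit_det_complexFrame_neg
  have h1 := hL.souriau_mul_complexFrame
  rw [graphSouriau, frameSouriau]
  set W : Matrix (Fin n ⊕ Fin n) (Fin n ⊕ Fin n) ℂ := Complex.exp (β * Complex.I) • 1
      + (Complex.exp (α * Complex.I) - Complex.exp (β * Complex.I)) • P.map Complex.ofRealHom with hW
  suffices h2 : W * complexFrame (frameX (graphFrame (splitFlow P α β)))
      (-frameY (graphFrame (splitFlow P α β)))
      = complexFrame (frameX (graphFrame (splitFlow P α β)))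
      (frameY (graphFrame (splitFlow P α β))) by
    have h3 := congrArg (fun A => A * (complexFrame (frameX (graphFrame (splitFlow P α β)))
      (-frameY (graphFrame (splitFlow P α β))))⁻¹) (h1.trans h2.symm)
    simpa only [mul_assoc, Matrix.mul_nonsing_inv _ hu, mul_one] using h3
  rw [frameX_graphFrame, frameY_graphFrame]
  have eX : 1 + splitFlow P α β = (1 + Real.cos β) • (1 : Mat2 n)
      + (Real.cos α - Real.cos β) • P + Real.sin β • J0 n
      + (Real.sin α - Real.sin β) • (J0 n * P) := by
    simp only [splitFlow, rot, mul_sub, add_mul, smul_mul_assoc, one_mul, mul_one]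
    module
  have eY : J0 n * (1 - splitFlow P α β) = Real.sin β • (1 : Mat2 n)
      + (Real.sin α - Real.sin β) • P + (1 - Real.cos β) • J0 n
      + (Real.cos β - Real.cos α) • (J0 n * P) := by
    simp only [splitFlow, rot, mul_sub, add_mul, mul_add, smul_mul_assoc, mul_smul_comm, one_mul,
      mul_one, ← mul_assoc, J0_mul_J0, neg_mul]
    module
  have hmap : ∀ a b c d : ℝ, (a • (1 : Mat2 n) + b • P + c • J0 n
        + d • (J0 n * P)).map Complex.ofRealHom
      = (a : ℂ) • 1 + (b : ℂ) • P.map Complex.ofRealHom + (c : ℂ) • (J0 n).map Complex.ofRealHom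
        + (d : ℂ) • ((J0 n).map Complex.ofRealHom * P.map Complex.ofRealHom) := by
    intro a b c d
    rw [← Matrix.map_mul, ← Matrix.map_one Complex.ofRealHom (by simp) (by simp)]
    ext i j
    simp only [Matrix.map_apply, Matrix.add_apply, Matrix.smul_apply, smul_eq_mul,
      Complex.ofRealHom_eq_coe]
    push_cast
    rfl
  have hneg : ∀ a b c d : ℝ, -(a • (1 : Mat2 n) + b • P + c • J0 n + d • (J0 n * P))
      = (-a) • (1 : Mat2 n) + (-b) • P + (-c) • J0 n + (-d) • (J0 n * P) := by
    intro a b c d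
    module
  have hPc : P.map Complex.ofRealHom * P.map Complex.ofRealHom = P.map Complex.ofRealHom := by
    rw [← Matrix.map_mul, hP.idem]
  have hPJ : P.map Complex.ofRealHom * (J0 n).map Complex.ofRealHom
      = (J0 n).map Complex.ofRealHom * P.map Complex.ofRealHom := by
    rw [← Matrix.map_mul, ← Matrix.map_mul, hP.comm]
  have hPJP : P.map Complex.ofRealHom * ((J0 n).map Complex.ofRealHom * P.map Complex.ofRealHom)
      = (J0 n).map Complex.ofRealHom * P.map Complex.ofRealHom := by
    rw [← mul_assoc, hPJ, mul_assoc, hPc]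
  rw [eX, eY, hneg, complexFrame, complexFrame, hmap, hmap, hmap, hW, Complex.exp_mul_I,
    Complex.exp_mul_I]
  simp only [add_mul, mul_add, smul_mul_assoc, mul_smul_comm, one_mul, mul_one, hPc, hPJ, hPJP,
    smul_add, smul_smul]
  push_cast
  have ha := Complex.sin_sq_add_cos_sq (α : ℂ)
  have hb := Complex.sin_sq_add_cos_sq (β : ℂ)
  have hI := Complex.I_mul_I
  generalize Complex.sin (α : ℂ) = s at *
  generalize Complex.cos (α : ℂ) = c at *
  generalize Complex.sin (β : ℂ) = s' at *
  generalize Complex.cos (β : ℂ) = c' at *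
  match_scalars
  · linear_combination hb - s' ^ 2 * hI
  · linear_combination ha - s ^ 2 * hI - hb + s' ^ 2 * hI
  · linear_combination Complex.I * hb - (s' - s' * c') * hI
  · linear_combination Complex.I * ha - (s - s * c) * hI - Complex.I * hb + (s' - s' * c') * hI

theorem graphSouriau_splitFlow_mul (hP : IsComplexProjection P) {α β : ℝ}
    (h : splitFlow P α β ∈ Matrix.symplecticGroup (Fin n) ℝ) :
    graphSouriau (splitFlow P α β) * ((1 : ℂ) • 1 + (0 : ℂ) • P.map Complex.ofRealHom)
      = Complex.exp (β * Complex.I) • 1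
        + (Complex.exp (α * Complex.I) - Complex.exp (β * Complex.I)) • P.map Complex.ofRealHom := by
  rw [zero_smul, add_zero, one_smul, mul_one, hP.graphSouriau_splitFlow h]

theorem eigenvalues_eq (hP : IsComplexProjection P) (hH : P.IsHermitian) (j : Fin n ⊕ Fin n) :
    hH.eigenvalues j = 0 ∨ hH.eigenvalues j = 1 := by
  have h1 := hH.mulVec_eigenvectorBasis j
  have h2 : P *ᵥ (P *ᵥ (hH.eigenvectorBasis j).ofLp)
      = P *ᵥ (hH.eigenvalues j • (hH.eigenvectorBasis j).ofLp) := congrArg _ h1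
  rw [Matrix.mulVec_mulVec, hP.idem, Matrix.mulVec_smul, h1] at h2
  have h3 : (hH.eigenvectorBasis j).ofLp ≠ 0 := by
    have := hH.eigenvectorBasis.orthonormal.ne_zero j
    simpa using this
  rw [smul_smul, ← sub_eq_zero, ← sub_smul, smul_eq_zero, or_iff_left h3] at h2
  have h4 : hH.eigenvalues j * (1 - hH.eigenvalues j) = 0 := by linarith
  rcases mul_eq_zero.1 h4 with h5 | h5
  · exact Or.inl h5
  · exact Or.inr (by linarith)

/-- The eigenvalues of `P` are `0` or `1`, so an affine function of them selects `α` or `β`, and the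
trace counts how often each occurs. -/
theorem det_graphSouriau_splitFlow (hP : IsComplexProjection P) {α β : ℝ}
    (h : splitFlow P α β ∈ Matrix.symplecticGroup (Fin n) ℝ) :
    (graphSouriau (splitFlow P α β)).det
      = Complex.exp ((α * P.trace + β * (2 * n - P.trace) : ℝ) * Complex.I) := by
  have hH : P.IsHermitian := hP.symm
  rw [det_of_moebius hH (by simp) (hP.graphSouriau_splitFlow_mul h),
    ← sum_affine_eigenvalues hH, Complex.ofReal_sum, Finset.sum_mul, Complex.exp_sum]
  refine Finset.prod_congr rfl fun j _ => ?_
  rcases hP.eigenvalues_eq hH j with h1 | h1 <;> simp [h1]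

theorem spectralPhase_graphSouriau_splitFlow (hP : IsComplexProjection P) {α β : ℝ}
    (h : splitFlow P α β ∈ Matrix.symplecticGroup (Fin n) ℝ) :
    spectralPhase (graphSouriau (splitFlow P α β))
      = oppositeArg (Complex.exp (α * Complex.I)) * P.trace
        + oppositeArg (Complex.exp (β * Complex.I)) * (2 * n - P.trace) := by
  have hH : P.IsHermitian := hP.symm
  rw [spectralPhase_of_moebius hH (by simp) (hP.graphSouriau_splitFlow_mul h),
    ← sum_affine_eigenvalues hH]
  refine Finset.sum_congr rfl fun j _ => ?_
  rcases hP.eigenvalues_eq hH j with h1 | h1 <;> simp [h1]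

/-- Pairing `exp(θJ₀) w = w` with `w` kills the `J₀` term and leaves `(cos θ - 1)|w|² = 0`; this
applies to each of the two components. -/
theorem fixedSpace_splitFlow (hP : IsComplexProjection P) {α β : ℝ} (hα : Real.cos α ≠ 1)
    (hβ : Real.cos β ≠ 1) : fixedSpace (splitFlow P α β) = ⊥ := by
  have key : ∀ θ : ℝ, Real.cos θ ≠ 1 → ∀ w : R2 n, rot n θ *ᵥ w = w → w = 0 := by
    intro θ hθ w hw
    have h1 := congrArg (fun u => w ⬝ᵥ u) hw
    have h2 : w ⬝ᵥ J0 n *ᵥ w = 0 := by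
      have := J0_dotProduct w w
      rw [dotProduct_comm] at this
      linarith
    simp only [rot, Matrix.add_mulVec, Matrix.smul_mulVec, Matrix.one_mulVec, dotProduct_add,
      dotProduct_smul, smul_eq_mul, h2, mul_zero, add_zero] at h1
    have h3 : (Real.cos θ - 1) * (w ⬝ᵥ w) = 0 := by linarith
    exact dotProduct_self_eq_zero.1 ((mul_eq_zero.1 h3).resolve_left (sub_ne_zero.2 hθ))
  have h1 : ∀ a b, splitGenerator P a b * splitFlow P α β
      = a • (rot n α * P) + b • (rot n β * (1 - P)) :=
    fun a b => hP.splitGenerator_mul_splitFlow a b α β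
  rw [eq_bot_iff]
  intro v hv
  rw [mem_fixedSpace] at hv
  have h2 : rot n α *ᵥ (P *ᵥ v) = P *ᵥ v := by
    have := congrArg (fun A => A *ᵥ v) (h1 1 0)
    simpa [splitGenerator, ← Matrix.mulVec_mulVec, hv] using this.symm
  have h3 : rot n β *ᵥ ((1 - P) *ᵥ v) = (1 - P) *ᵥ v := by
    have := congrArg (fun A => A *ᵥ v) (h1 0 1)
    simpa [splitGenerator, ← Matrix.mulVec_mulVec, hv] using this.symm
  have h4 := key α hα _ h2
  have h5 := key β hβ _ h3
  rwa [Matrix.sub_mulVec, Matrix.one_mulVec, h4, sub_zero] at h5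

/-- The maximal Conley–Zehnder index of a diagonal rotation. -/
theorem maxCZIndex_splitFlow (hP : IsComplexProjection P) {c e : ℝ} {m : ℤ}
    (hc : 2 * Real.pi * m < c) (hc' : c < 2 * Real.pi * (m + 1)) (he : 0 < e)
    (he' : e < 2 * Real.pi) :
    maxCZIndex (fun t => splitFlow P (-c * t) (-e * t)) = -n - P.trace * m := by
  have hF := hP.isFundamentalSolution (-c) (-e)
  have hH := hF.isHamiltonianPath (hP.isSymmetricPath (-c) (-e))
  have m0 : (0 : ℝ) ∈ Icc (0 : ℝ) 1 := by simp
  have m1 : (1 : ℝ) ∈ Icc (0 : ℝ) 1 := by simp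
  have hφ : IsPhase (fun t => (graphSouriau (splitFlow P (-c * t) (-e * t))).det) (Icc 0 1)
      (fun t => -c * t * P.trace + -e * t * (2 * n - P.trace)) :=
    ⟨by fun_prop, fun t ht => (hP.det_graphSouriau_splitFlow (hH.mem t ht)).symm⟩
  have h1 := hH.two_pi_mul_czIndex hφ
  rw [hP.spectralPhase_graphSouriau_splitFlow (hH.mem 0 m0),
    hP.spectralPhase_graphSouriau_splitFlow (hH.mem 1 m1)] at h1
  have hcirc : ∀ (x : ℝ) (k : ℤ), 2 * Real.pi * k < x → x < 2 * Real.pi * (k + 1) →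
      oppositeArg (Complex.exp ((-x * 1 : ℝ) * Complex.I)) = Real.pi - x + 2 * Real.pi * k ∧
        Real.cos (-x * 1) ≠ 1 := by
    intro x k hx hx'
    -- Adding `k + 1` full turns brings `-x` into `(0, 2π)`.
    have e1 : -x * 1 = (2 * Real.pi * (k + 1) - x) + (-k - 1 : ℤ) * (2 * Real.pi) := by
      push_cast
      ring
    refine ⟨?_, fun h => ?_⟩
    · rw [e1, oppositeArg_exp_add_int_mul_two_pi, oppositeArg_exp (by linarith) (by linarith)]
      ring
    · rw [e1, Real.cos_add_int_mul_two_pi,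
        Real.cos_eq_one_iff_of_lt_of_lt (by linarith [Real.pi_pos]) (by linarith)] at h
      linarith
  obtain ⟨hc1, hc2⟩ := hcirc c m hc hc'
  obtain ⟨he1, he2⟩ := hcirc e 0 (by simpa using he) (by simpa using he')
  have h0 : oppositeArg 1 = 0 := by simp [oppositeArg]
  rw [hc1, he1] at h1
  simp only [mul_zero, Complex.ofReal_zero, zero_mul, Complex.exp_zero, h0] at h1
  rw [maxCZIndex_eq, hP.fixedSpace_splitFlow hc2 he2, finrank_bot]
  have hpi := Real.two_pi_pos
  -- The speeds cancel between the phase and its correction: each direction in the range of `P`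
  -- contributes `-π - 2πm`, and each complementary one `-π`.
  refine mul_left_cancel₀ hpi.ne' ?_
  rw [mul_add, h1]
  push_cast
  ring

end IsComplexProjection

end Model

/-! ### Complex subspaces and comparison with the model -/

section Splitting

variable {n : ℕ}

/-- The identification `ℝ ^ (2n) = ℂ ^ n` as a real linear equivalence. -/
def toComplexEquiv (n : ℕ) : R2 n ≃ₗ[ℝ] (Fin n → ℂ) where
  toFun := toComplex
  map_add' v w := by
    funext j
    simp only [toComplex, Pi.add_apply]
    push_cast
    ring
  map_smul' c v := by
    funext j
    simp only [toComplex, Pi.smul_apply, smul_eq_mul, RingHom.id_apply, Complex.real_smul]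
    push_cast
    ring
  invFun z := Sum.elim (fun j => (z j).re) (fun j => (z j).im)
  left_inv v := by
    funext j
    rcases j with j | j <;> simp [toComplex]
  right_inv z := by
    funext j
    simp [toComplex]

/-- The real subspace of `ℝ ^ (2n)` underlying a complex subspace of `ℂ ^ n`. -/
def realSubspace (V : Submodule ℂ (Fin n → ℂ)) : Submodule ℝ (R2 n) :=
  (V.restrictScalars ℝ).comap (toComplexEquiv n).toLinearMap

theorem mem_realSubspace {V : Submodule ℂ (Fin n → ℂ)} {v : R2 n} :
    v ∈ realSubspace V ↔ toComplex v ∈ V := Iff.rfl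

theorem J0_mem_realSubspace {V : Submodule ℂ (Fin n → ℂ)} {v : R2 n} (hv : v ∈ realSubspace V) :
    J0 n *ᵥ v ∈ realSubspace V := by
  rw [mem_realSubspace, toComplex_J0]
  exact V.smul_mem _ hv

theorem finrank_realSubspace (V : Submodule ℂ (Fin n → ℂ)) :
    Module.finrank ℝ (realSubspace V) = 2 * Module.finrank ℂ V := by
  have h1 : (realSubspace V).map (toComplexEquiv n).toLinearMap = V.restrictScalars ℝ :=
    Submodule.map_comap_eq_of_surjective (toComplexEquiv n).surjective _
  rw [((toComplexEquiv n).submoduleMap (realSubspace V)).finrank_eq]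
  change Module.finrank ℝ ((realSubspace V).map (toComplexEquiv n).toLinearMap) = _
  rw [h1]
  exact finrank_real_of_complex V

/-- The orthogonal projection onto a subspace, as a matrix. -/
theorem exists_orthogonal_projection (U : Submodule ℝ (R2 n)) :
    ∃ P : Mat2 n, (∀ v, P *ᵥ v ∈ U) ∧ (∀ v, ∀ u ∈ U, u ⬝ᵥ (v - P *ᵥ v) = 0) ∧
      P.trace = Module.finrank ℝ U := by
  set B : LinearMap.BilinForm ℝ (R2 n) := Matrix.toLinearMap₂' ℝ (1 : Mat2 n) with hBdef
  have hB : ∀ v w, B v w = v ⬝ᵥ w := fun v w => by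
    rw [hBdef, Matrix.toLinearMap₂'_apply', Matrix.one_mulVec]
  have hr : B.IsRefl := fun v w h => by rwa [hB, dotProduct_comm, ← hB]
  have hnd : (B.restrict U).Nondegenerate := nondegenerate_of_ne_zero fun v hv h => hv (by
    have : (v : R2 n) ⬝ᵥ v = 0 := by rw [← hB]; exact h
    exact Subtype.ext (dotProduct_self_eq_zero.1 this))
  have hc := LinearMap.BilinForm.isCompl_orthogonal_of_restrict_nondegenerate hr hnd
  have hproj : LinearMap.IsProj U (U.projection (B.orthogonal U) hc) :=
    ⟨fun v => Submodule.projection_apply_mem hc v, fun v hv =>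
      Submodule.projection_apply_left hc ⟨v, hv⟩⟩
  refine ⟨LinearMap.toMatrix' (U.projection (B.orthogonal U) hc), fun v => ?_, fun v u hu => ?_, ?_⟩
  · rw [LinearMap.toMatrix'_mulVec]
    exact hproj.map_mem v
  · rw [LinearMap.toMatrix'_mulVec, ← hB]
    exact Submodule.sub_projection_mem hc v u hu
  · rw [← Matrix.trace_toLin'_eq, Matrix.toLin'_toMatrix', hproj.trace]

theorem exists_isComplexProjection (V : Submodule ℂ (Fin n → ℂ)) :
    ∃ P : Mat2 n, IsComplexProjection P ∧ (∀ v, P *ᵥ v ∈ realSubspace V) ∧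
      (∀ v, ∀ u ∈ realSubspace V, u ⬝ᵥ (v - P *ᵥ v) = 0) ∧
      P.trace = 2 * (Module.finrank ℂ V : ℝ) := by
  obtain ⟨P, h1, h2, h3⟩ := exists_orthogonal_projection (realSubspace V)
  -- Uniqueness of the orthogonal projection; idempotence and commutation with `J₀` both follow from
  -- it.
  have hid : ∀ v w : R2 n, w ∈ realSubspace V → (∀ u ∈ realSubspace V, u ⬝ᵥ (v - w) = 0) →
      P *ᵥ v = w := fun v w hw h => by
    have h4 := (realSubspace V).sub_mem (h1 v) hw
    refine sub_eq_zero.1 (dotProduct_self_eq_zero.1 ?_)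
    have e : P *ᵥ v - w = (v - w) - (v - P *ᵥ v) := by abel
    nth_rw 2 [e]
    rw [dotProduct_sub, h _ h4, h2 v _ h4, sub_zero]
  refine ⟨P, ⟨?_, ?_, ?_⟩, h1, h2, by rw [h3, finrank_realSubspace]; push_cast; ring⟩
  · refine matrix_ext_dotProduct fun v w => ?_
    have h4 := h2 v _ (h1 w)
    have h5 := h2 w _ (h1 v)
    rw [dotProduct_sub] at h4 h5
    rw [Matrix.dotProduct_mulVec, Matrix.vecMul_transpose, dotProduct_comm v]
    rw [dotProduct_comm (P *ᵥ w) (P *ᵥ v)] at h4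
    linarith
  · refine Matrix.ext_of_mulVec_single fun j => ?_
    rw [← Matrix.mulVec_mulVec]
    exact hid _ _ (h1 _) fun u _ => by rw [sub_self, dotProduct_zero]
  · refine Matrix.ext_of_mulVec_single fun j => ?_
    rw [← Matrix.mulVec_mulVec, ← Matrix.mulVec_mulVec]
    refine hid _ _ (J0_mem_realSubspace (h1 _)) fun u hu => ?_
    rw [← Matrix.mulVec_sub]
    have h4 := J0_dotProduct u (Pi.single j 1 - P *ᵥ Pi.single j 1)
    rw [h2 _ _ (J0_mem_realSubspace hu)] at h4
    linarith

/-- The generator is dominated by that of a two-speed rotation whose maximal index is exactly the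
bound. -/
theorem maxCZIndex_le_of_boundedOnSplitting {S Φ : ℝ → Mat2 n} {C ε : ℝ}
    {V : Submodule ℂ (Fin n → ℂ)} (hε : 0 < ε) (hS : IsSymmetricPath S)
    (hΦ : IsFundamentalSolution S Φ)
    (hbound : ∀ t ∈ Icc (0 : ℝ) 1, BoundedOnSplitting (S t) V C ε) :
    maxCZIndex Φ ≤ -(n : ℝ) - 2 * (Module.finrank ℂ V : ℝ) * (intBelow (C / (2 * Real.pi)) : ℝ) := by
  obtain ⟨P, hP, hPV, hPorth, htr⟩ := exists_isComplexProjection V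
  have hpi := Real.two_pi_pos
  set m := intBelow (C / (2 * Real.pi)) with hm
  have hm1 : 2 * Real.pi * m < C := by
    have h : (m : ℝ) < C / (2 * Real.pi) := (intBelow_isGreatest (C / (2 * Real.pi))).1
    rw [lt_div_iff₀ hpi] at h
    linarith
  have hm2 : C ≤ 2 * Real.pi * (m + 1) := by
    have h : C / (2 * Real.pi) ≤ (m : ℝ) + 1 := by
      rw [hm, intBelow]
      push_cast
      linarith [Int.le_ceil (C / (2 * Real.pi))]
    rw [div_le_iff₀ hpi] at h
    linarith
  -- The midpoint satisfies `2πm < c < C ≤ 2π(m + 1)`, so the model has no eigenvalue `1` at time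
  -- one even when `C` is a multiple of `2π`. Similarly `min ε 1` stays below `2π`.
  set c := (2 * Real.pi * m + C) / 2 with hc
  have he : 0 < min ε 1 := lt_min hε one_pos
  have hmodel := hP.maxCZIndex_splitFlow (c := c) (m := m) (by linarith) (by linarith) he
    (lt_of_le_of_lt (min_le_right ε 1) (by linarith [Real.pi_gt_three]))
  rw [htr] at hmodel
  rw [← hmodel]
  refine (czIndex_le_and_maxCZIndex_le hS (hP.isSymmetricPath (-c) (-min ε 1)) hΦ
    (hP.isFundamentalSolution _ _) fun t ht v => ?_).2
  have h1 := hbound t ht (P *ᵥ v) (v - P *ᵥ v) (hPV v) fun u hu => hPorth v u hu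
  rw [add_sub_cancel] at h1
  have h2 : v ⬝ᵥ splitGenerator P (-c) (-min ε 1) *ᵥ v
      = -c * ((P *ᵥ v) ⬝ᵥ (P *ᵥ v)) - min ε 1 * ((v - P *ᵥ v) ⬝ᵥ (v - P *ᵥ v)) := by
    have h3 := hPorth v _ (hPV v)
    rw [dotProduct_sub] at h3
    simp only [splitGenerator, Matrix.add_mulVec, Matrix.smul_mulVec, Matrix.sub_mulVec,
      Matrix.one_mulVec, dotProduct_add, dotProduct_smul, dotProduct_sub, sub_dotProduct,
      smul_eq_mul, dotProduct_comm v (P *ᵥ v)]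
    linear_combination (-c - min ε 1) * h3
  rw [Matrix.sub_mulVec, dotProduct_sub, h2]
  have h4 : 0 ≤ (P *ᵥ v) ⬝ᵥ (P *ᵥ v) := Finset.sum_nonneg fun i _ => mul_self_nonneg _
  have h5 : 0 ≤ (v - P *ᵥ v) ⬝ᵥ (v - P *ᵥ v) := Finset.sum_nonneg fun i _ => mul_self_nonneg _
  have h6 := mul_le_mul_of_nonneg_right (min_le_left ε 1) h5
  have h7 : c * ((P *ᵥ v) ⬝ᵥ (P *ᵥ v)) ≤ C * ((P *ᵥ v) ⬝ᵥ (P *ᵥ v)) :=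
    mul_le_mul_of_nonneg_right (by linarith) h4
  linarith

theorem dotProduct_mulVec_nonneg {A : Mat2 n} (hA : A.PosSemidef) (v : R2 n) : 0 ≤ v ⬝ᵥ A *ᵥ v := by
  simpa using hA.dotProduct_mulVec_nonneg v

end Splitting

end

theorem mainTheorem8 (n : ℕ) :
    (∀ S₀ S₁ Φ₀ Φ₁ : ℝ → Mat2 n,
      IsSymmetricPath S₀ → IsSymmetricPath S₁ →
      IsFundamentalSolution S₀ Φ₀ → IsFundamentalSolution S₁ Φ₁ →
      (∀ t ∈ Set.Icc (0 : ℝ) 1, (S₁ t - S₀ t).PosSemidef) →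
      czIndex Φ₀ ≤ czIndex Φ₁) ∧
    (∀ (S Φ : ℝ → Mat2 n) (C : ℝ),
      IsSymmetricPath S → IsFundamentalSolution S Φ →
      (∀ t ∈ Set.Icc (0 : ℝ) 1, ((-C) • (1 : Mat2 n) - S t).PosSemidef) →
      maxCZIndex Φ ≤ -(n : ℝ) - 2 * (n : ℝ) * (intBelow (C / (2 * Real.pi)) : ℝ)) ∧
    (∀ (S Φ : ℝ → Mat2 n) (C ε : ℝ) (V : Submodule ℂ (Fin n → ℂ)),
      0 < ε → IsSymmetricPath S → IsFundamentalSolution S Φ →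
      (∀ t ∈ Set.Icc (0 : ℝ) 1, BoundedOnSplitting (S t) V C ε) →
      maxCZIndex Φ ≤
        -(n : ℝ) - 2 * (Module.finrank ℂ V : ℝ) * (intBelow (C / (2 * Real.pi)) : ℝ)) := by
  refine ⟨fun S₀ S₁ Φ₀ Φ₁ hS₀ hS₁ hΦ₀ hΦ₁ hle => ?_, fun S Φ C hS hΦ hle => ?_,
    fun S Φ C ε V hε hS hΦ hb => maxCZIndex_le_of_boundedOnSplitting hε hS hΦ hb⟩
  · exact (czIndex_le_and_maxCZIndex_le hS₀ hS₁ hΦ₀ hΦ₁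
      fun t ht v => dotProduct_mulVec_nonneg (hle t ht) v).1
  -- The uniform bound is the case of the full space: the orthogonal component is zero, so any
  -- positive `ε` will do.
  · have h := maxCZIndex_le_of_boundedOnSplitting (C := C) (V := ⊤) one_pos hS hΦ
      fun t ht v w _ hw => by
        have hw0 : w = 0 := dotProduct_self_eq_zero.1 (hw w Submodule.mem_top)
        have h1 := dotProduct_mulVec_nonneg (hle t ht) v
        rw [Matrix.sub_mulVec, dotProduct_sub, Matrix.smul_mulVec, Matrix.one_mulVec,
          dotProduct_smul, smul_eq_mul] at h1
        rw [hw0, add_zero, dotProduct_zero, mul_zero, sub_zero]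
        linarith
    simpa using h
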